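/- Functions on the torus $\mathbb T^1=[-\pi,\pi]$ (endpoints identified) are $2\pi$-periodic functions on $\mathbb R$; $\vartheta$ is the geodesic distance, $\vartheta(z)=\min\{|z|,2\pi-|z|\}$ for $|z|\le\pi$, extended periodically; $⨍=\frac1{2\pi}\int_{-\pi}^{\pi}$; and $\|u\|_{H^1}^2=|⨍ u|^2+⨍|u_x|^2$. **Kernel.** Let $K(u,v)$ be $h/p$ homogeneous: there are $p\ge 0$ and $h\in C^1([1,\infty))$ with $K(v/\alpha,v)=h(\alpha)v^{-p}$ for all $v>0$, $\alpha\ge1$. Put $g(\alpha)=-\alpha^2h'(\alpha)$ and assume that either $g\in C^1([1,\infty))$ and $p<\tfrac12$, or, for some integer $m\ge0$ with $m>4p-2$, $g\in C^{m+1}([1,\infty))$ and $g(1)=g'(1)=\dots=g^{(m)}(1)=0$. $K_u$ denotes the derivative in the first argument (one-sided, from $u<v$, on the diagonal $u=v$). **Flow.** Call $\tau:\mathbb T^1\to\mathbb R^3$ *admissible* if $\tau\in H^1(\mathbb T^1)$, $⨍\tau=0$, $|\tau|\equiv1$, and the induced closed curve $$\gamma_\tau(x)=⨍ (z-\pi)\tau(z)\,dz+\int_{-\pi}^x\tau(z)\,dz$$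 is a bi-Lipschitz embedding, i.e. $\ell^{-1}\vartheta(x-y)\le|\gamma_\tau(x)-\gamma_\tau(y)|\le\vartheta(x-y)$ for some $\ell>0$ and all $x,y$. Its distortion is $\delta_\infty(\gamma_\tau)=\sup_{\vartheta(x-y)>0}\vartheta(x-y)/|\gamma_\tau(x)-\gamma_\tau(y)|$. For admissible $\tau$ let $f_\tau=\lim_{\epsilon\downarrow0}f_{\tau,\epsilon}$ in $L^2(\mathbb T^1)$, where $$f_{\tau,\epsilon}(x)=\int_{\vartheta(x-y)\ge\epsilon}K_u\big(|\gamma_\tau(x)-\gamma_\tau(y)|^2,\vartheta^2(x-y)\big)\,(\gamma_\tau(x)-\gamma_\tau(y))\,dy,$$ and let $$F_\tau(x)=⨍(z-\pi)f_\tau(z)\,dz+\int_{-\pi}^xf_\tau(z)\,dz.$$ Define $\lambda_\tau\in\mathbb R^3$ and $\mu_\tau\in L^1(\mathbb T^1)$ by $$\Big(\mathrm{Id}-⨍\tfrac{\tau\otimes\tau}{|\tau|^2}\Big)\lambda_\tau=⨍\tfrac{\langle F_\tau,\tau\rangle-|\tau_x|^2}{|\tau|^2}\,\tau,\qquad \mu_\tau=\tfrac{|\tau_x|^2-\langle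 F_\tau,\tau\rangle-\langle\lambda_\tau,\tau\rangle}{|\tau|^2}.$$ Put $G(\tau)=F_\tau+\lambda_\tau+\mu_\tau\tau$. A *mild solution* on $[0,T]$ of $$\tau_t=\tau_{xx}+F_\tau+\lambda_\tau+\mu_\tau\tau,\qquad \tau(0)=\tau_0,$$ is a $\tau\in C([0,T];H^1(\mathbb T^1))$ with every $\tau(t)$ admissible and $$\tau(t)=S(t)\tau_0+\int_0^tS(t-s)\,G(\tau(s))\,ds\quad\text{for all }t\in[0,T],$$ where $S$ is the heat semigroup on $\mathbb T^1$. Let $T^*\in[0,\infty]$ be the supremum of all $T>0$ for which a mild solution on $[0,T]$ exists. **Statement.** Let $\tau_0$ be admissible. Then $T^*>0$, and there is a $\tau:[0,T^*)\to H^1(\mathbb T^1)$ that is a mild solution on $[0,T]$ for every $0<T<T^*$ and with which every mild solution with datum $\tau_0$ agrees at all times $t<T^*$ at which the latter is defined. If $T^*<\infty$, then $$\limsup_{t\nearrow T^*}\|\tau(t)\|_{H^1(\mathbb T^1)}=+\infty\qquad\text{or}\qquad\limsup_{t\nearrow T^*}\delta_\infty(\gamma_{\tau(t)})=+\infty .$$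 Consequently, if $\|\tau(t)\|_{H^1}$ and $\delta_\infty(\gamma_{\tau(t)})$ are bounded uniformly over $t\in[0,T^*)$, then $T^*=\infty$ and $\tau$ is a mild solution on $[0,T]$ for every $T>0$. -/

import Mathlib

open Filter Topology MeasureTheory Set
open scoped ENNReal Real

noncomputable section

namespace CurveFlow

/-! Functions on the torus `[-π, π]` with endpoints identified are represented by
`2π`-periodic functions on `ℝ`; integrals over the torus are integrals over `(-π, π]`. -/

abbrev E3 : Type := EuclideanSpace ℝ (Fin 3)

/-- Lebesgue measure on the fundamental domain `(-π, π]` of the torus. -/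
def torusMeasure : Measure ℝ := volume.restrict (Ioc (-π) π)

/-- The mean value `(2π)⁻¹ ∫_{-π}^{π} u`. -/
def mean {F : Type*} [NormedAddCommGroup F] [NormedSpace ℝ F] (u : ℝ → F) : F :=
  (2 * π)⁻¹ • ∫ x in (-π)..π, u x

/-- The geodesic distance to `0` on the torus: the `2π`-periodic extension of
`z ↦ min |z| (2π - |z|)` from `[-π, π]` (see `theta_eq_min`). -/
def theta (z : ℝ) : ℝ := ‖(z : AddCircle (2 * π))‖

lemma theta_eq_min {z : ℝ} (hz : |z| ≤ π) : theta z = min |z| (2 * π - |z|) := by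
  have hp : (2 * π) ≠ 0 := by positivity
  have h2 : |2 * π| = 2 * π := abs_of_pos (by positivity)
  have h : theta z = |z| := by
    unfold theta
    rw [(AddCircle.norm_coe_eq_abs_iff (2 * π) hp)]
    rw [h2]
    linarith
  rw [h, min_eq_left]
  linarith

/-- `H¹` of the torus with values in `ℝ³`, via the continuous representative: `u` is periodic
and is the primitive of a square integrable function (its weak derivative, which is the
a.e. derivative of `u`). -/
def MemH1 (u : ℝ → E3) : Prop :=
  Function.Periodic u (2 * π) ∧
    ∃ v : ℝ → E3, MemLp v 2 torusMeasure ∧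
      ∀ x ∈ Icc (-π) π, u x = u (-π) + ∫ z in (-π)..x, v z

/-- The norm `(|û₀|² + ∑ k² |ûₖ|²)^(1/2) = (|mean u|² + mean |u'|²)^(1/2)`. -/
def h1norm (u : ℝ → E3) : ℝ :=
  Real.sqrt (‖mean u‖ ^ 2 + mean (fun x => ‖deriv u x‖ ^ 2))

/-- The mean zero primitive `x ↦ mean ((z - π) f(z)) + ∫_{-π}^x f` of a mean zero `f`. -/
def primitive (f : ℝ → E3) (x : ℝ) : E3 :=
  mean (fun z => (z - π) • f z) + ∫ z in (-π)..x, f z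

/-- The closed curve induced by a mean zero tangent field. -/
def inducedCurve (τ : ℝ → E3) : ℝ → E3 := primitive τ

/-- The unit speed curve `γ` is a bi-Lipschitz embedding. -/
def IsBiLipschitz (γ : ℝ → E3) : Prop :=
  ∃ l : ℝ, 0 < l ∧ ∀ x y : ℝ,
    l⁻¹ * theta (x - y) ≤ ‖γ x - γ y‖ ∧ ‖γ x - γ y‖ ≤ theta (x - y)

/-- Gromov's distortion, with the value `∞` allowed (a quotient with vanishing denominator
is `∞`). -/
def distortion (γ : ℝ → E3) : ℝ≥0∞ :=
  ⨆ (x : ℝ) (y : ℝ) (_ : 0 < theta (x - y)),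
    ENNReal.ofReal (theta (x - y)) / ENNReal.ofReal ‖γ x - γ y‖

/-- Tangent fields in `H¹` with mean zero and unit speed that induce a bi-Lipschitz
embedding. -/
structure IsAdmissible (τ : ℝ → E3) : Prop where
  memH1 : MemH1 τ
  mean_zero : mean τ = 0
  unit_speed : ∀ x, ‖τ x‖ = 1
  biLipschitz : IsBiLipschitz (inducedCurve τ)

/-! ### Kernels -/

/-- `h/p` homogeneity of the kernel `K(u, v)`. -/
structure IsHomogeneous (K : ℝ → ℝ → ℝ) (h : ℝ → ℝ) (p : ℝ) : Prop where
  contDiffOn : ContDiffOn ℝ 1 h (Ici 1)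
  exponent_nonneg : 0 ≤ p
  eq : ∀ v α : ℝ, 0 < v → 1 ≤ α → K (v / α) v = h α * v ^ (-p)

/-- `g(α) = -α² h'(α)` on `[1, ∞)`. -/
def degeneracyFun (h : ℝ → ℝ) (α : ℝ) : ℝ := -α ^ 2 * derivWithin h (Ici 1) α

/-- `0`-degeneracy. -/
def IsZeroDegenerate (h : ℝ → ℝ) (p : ℝ) : Prop :=
  ContDiffOn ℝ 1 (degeneracyFun h) (Ici 1) ∧ p < 1 / 2

/-- `m`-degeneracy. -/
def IsDegenerate (h : ℝ → ℝ) (p : ℝ) (m : ℕ) : Prop :=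
  4 * p - 2 < (m : ℝ) ∧
    ContDiffOn ℝ ((m + 1 : ℕ) : ℕ∞) (degeneracyFun h) (Ici 1) ∧
      ∀ j ≤ m, iteratedDerivWithin j (degeneracyFun h) (Ici 1) 1 = 0

/-- The partial derivative `K_u(u, v)`. On unit speed curves only `0 < u ≤ v` occurs, and only
there is a homogeneous kernel prescribed, so the derivative is taken relative to `(0, v]`: it is
the usual one for `u < v`, one-sided for `u = v`. -/
def kernelDeriv (K : ℝ → ℝ → ℝ) (u v : ℝ) : ℝ :=
  derivWithin (fun w => K w v) (Ioc 0 v) u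

/-! ### The nonlocal forcing -/

/-- The truncated integral `f_{γ,ε}`. -/
def truncatedForce (K : ℝ → ℝ → ℝ) (γ : ℝ → E3) (ε : ℝ) (x : ℝ) : E3 :=
  ∫ y in Ioc (-π) π ∩ {y | ε ≤ theta (x - y)},
    kernelDeriv K (‖γ x - γ y‖ ^ 2) (theta (x - y) ^ 2) • (γ x - γ y)

/-- `f` is the principal value integral `lim_{ε ↓ 0} f_{γ,ε}`, as a limit in `L²`. -/
def IsPrincipalValue (K : ℝ → ℝ → ℝ) (γ f : ℝ → E3) : Prop :=
  MemLp f 2 torusMeasure ∧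
    Tendsto (fun ε : ℝ => eLpNorm (truncatedForce K γ ε - f) 2 torusMeasure) (𝓝[>] 0) (𝓝 0)

open Classical in
/-- The principal value integral `f_γ`, unique up to null sets of `(-π, π]`. -/
def pvForce (K : ℝ → ℝ → ℝ) (γ : ℝ → E3) : ℝ → E3 :=
  if hf : ∃ f, IsPrincipalValue K γ f then hf.choose else 0

/-- The nonlocal forcing `F` of the curve induced by `τ`. -/
def forcing (K : ℝ → ℝ → ℝ) (τ : ℝ → E3) : ℝ → E3 :=
  primitive (pvForce K (inducedCurve τ))

/-! ### The Lagrange multipliers -/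

/-- `A_τ = Id - mean (τ ⊗ τ / |τ|²)`. -/
def multiplierMatrix (τ : ℝ → E3) : Matrix (Fin 3) (Fin 3) ℝ :=
  1 - Matrix.of fun i j => mean (fun x => τ x i * τ x j / ‖τ x‖ ^ 2)

/-- `λ_τ`, the solution of `A_τ λ_τ = mean (((⟨F, τ⟩ - |τ_x|²) / |τ|²) τ)`. -/
def lagrangeLambda (K : ℝ → ℝ → ℝ) (τ : ℝ → E3) : E3 :=
  Matrix.toEuclideanLin (multiplierMatrix τ)⁻¹
    (mean (fun x =>
      ((inner ℝ (forcing K τ x) (τ x) - ‖deriv τ x‖ ^ 2) / ‖τ x‖ ^ 2) • τ x))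

/-- `μ_τ = (|τ_x|² - ⟨F, τ⟩ - ⟨λ_τ, τ⟩) / |τ|²`. -/
def lagrangeMu (K : ℝ → ℝ → ℝ) (τ : ℝ → E3) (x : ℝ) : ℝ :=
  (‖deriv τ x‖ ^ 2 - inner ℝ (forcing K τ x) (τ x)
    - inner ℝ (lagrangeLambda K τ) (τ x)) / ‖τ x‖ ^ 2

/-- The lower order terms `G(τ, τ_x) = F + λ_τ + μ_τ τ`. -/
def lowerOrder (K : ℝ → ℝ → ℝ) (τ : ℝ → E3) (x : ℝ) : E3 :=
  forcing K τ x + lagrangeLambda K τ + lagrangeMu K τ x • τ x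

/-! ### Mild solutions -/

/-- The periodic heat kernel `(2π)⁻¹ ∑_{k ∈ ℤ} exp(-k² t) exp(i k z)` (for `t > 0`), in real
form. -/
def heatKernel (z t : ℝ) : ℝ :=
  (2 * π)⁻¹ * ∑' k : ℤ, Real.exp (-(k : ℝ) ^ 2 * t) * Real.cos (k * z)

/-- The heat semigroup on the torus. -/
def heatSemigroup (t : ℝ) (φ : ℝ → E3) (x : ℝ) : E3 :=
  if t = 0 then φ x else ∫ y in (-π)..π, heatKernel (x - y) t • φ y

/-- `τ` is a mild solution on `[0, T]` with datum `τ₀` of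
`τ_t = τ_xx + F + λ_τ + μ_τ τ`: a continuous curve in `H¹`, with values in the set of mean zero,
unit speed fields inducing bi-Lipschitz embeddings (on which the forcing is defined), that
satisfies the Duhamel formula. -/
structure IsMildSolution (K : ℝ → ℝ → ℝ) (τ₀ : ℝ → E3) (T : ℝ) (τ : ℝ → ℝ → E3) : Prop where
  admissible : ∀ t ∈ Icc 0 T, IsAdmissible (τ t)
  continuous : ∀ t ∈ Icc 0 T,
    Tendsto (fun s => h1norm (τ s - τ t)) (𝓝[Icc 0 T] t) (𝓝 0)
  duhamel : ∀ t ∈ Icc 0 T, ∀ x : ℝ,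
    τ t x = heatSemigroup t τ₀ x
      + ∫ s in (0 : ℝ)..t, heatSemigroup (t - s) (lowerOrder K (τ s)) x

/-- The set of existence times of mild solutions with datum `τ₀`. -/
def existenceTimes (K : ℝ → ℝ → ℝ) (τ₀ : ℝ → E3) : Set ℝ :=
  {T | 0 < T ∧ ∃ τ : ℝ → ℝ → E3, IsMildSolution K τ₀ T τ}

/-- The maximal existence time `T*` in `[0, ∞]`. -/
def maximalTime (K : ℝ → ℝ → ℝ) (τ₀ : ℝ → E3) : ℝ≥0∞ :=
  ⨆ T ∈ existenceTimes K τ₀, ENNReal.ofReal T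

end CurveFlow

end

open CurveFlow

/-! The unknown is changed from τ to its derivative v = τ_x in L². A mean-zero H¹ field is the
periodic mean-zero primitive `antideriv v`, and its H¹ norm is a fixed multiple of ‖v‖.
Differentiating Duhamel's formula in x gives a Volterra equation in L², namely v(t) = ∂ₓS(t)τ₀ + ∫₀ᵗ
∂ₓS(t-s) G(v(s)) ds. Since G contains |τ_x|²τ, it lies only in L¹. However, ‖∂ₓS(t)‖ from L¹ to L²
is at most C t^(-7/8) (`exists_norm_heatD_le`), which is integrable at 0. For a globally Lipschitz G
: L² → L¹ the equation therefore has exactly one continuous solution on every interval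
(`volterra_exists`, `volterra_unique`).

The true lower order terms are controlled on the sets `Regular R`, given by a bound on ‖v‖, a lower
bound on chord over arc, and coercivity of the multiplier matrix. `exists_nonlinearity` extends them
from there to a globally Lipschitz G. The main input is the principal value force. With s the
squared quotient of chord and arc, its integrand is g(1/s)|z|^(-2p-2) z times the mean of τ over the
arc. The part with g(1) in place of g(1/s) is linear in v and converges for p < 1/2 through
cancellation between z and -z (`exists_linForce`); for p ≥ 1/2 degeneracy gives g(1) = 0. The rest
is O((1-s)^(m+1)) = O(|z|^(m+1)), because 1 - s is a variance of an H¹ field, and is absolutely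
integrable (`exists_nlForce`).

Solutions of the extended equation must be shown to have unit length. The multiplier μ makes w =
|τ|² - 1 satisfy w_t = w_xx + 2μw with μ in L¹; an energy estimate with interpolation and Gronwall's
inequality gives w = 0 (`IsIntegralSolution.norm_eq_one`). The multiplier λ keeps the mean zero.
Hence regular solutions of the Volterra equation are mild solutions, and conversely.

Regularity is a closed condition and is stable under small perturbations at the price of R + 1,
which gives local existence and uniqueness. If the H¹ norm and the distortion stay bounded near a
finite T*, all fields before T* are regular with one R (`exists_regular`). The extended solution
then passes T* and is still regular shortly after, contradicting the definition of T*. -/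

noncomputable section

namespace CurveFlow

/-! ### Volterra equations with an integrable singular operator kernel -/

section Volterra

variable {X Y : Type*} [NormedAddCommGroup X] [NormedSpace ℝ X] [NormedAddCommGroup Y]
  [NormedSpace ℝ Y]

/-- A norm continuous family of operators on `(0, ∞)` with a locally integrable majorant. -/
structure IsSingularKernel (D : ℝ → Y →L[ℝ] X) (b : ℝ → ℝ) : Prop where
  continuousOn : ContinuousOn D (Ioi 0)
  bound : ∀ r, 0 < r → ‖D r‖ ≤ b r
  intervalIntegrable : ∀ T, IntervalIntegrable b volume 0 T

/-- The Volterra integral `∫₀ᵗ D(t - s) g(s) ds`. -/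
def volterra (D : ℝ → Y →L[ℝ] X) (g : ℝ → Y) (t : ℝ) : X := ∫ s in (0 : ℝ)..t, D (t - s) (g s)

variable {D : ℝ → Y →L[ℝ] X} {b : ℝ → ℝ} {g : ℝ → Y} {T : ℝ}

lemma IsSingularKernel.nonneg (hD : IsSingularKernel D b) {r : ℝ} (hr : 0 < r) : 0 ≤ b r :=
  (norm_nonneg _).trans (hD.bound r hr)

lemma IsSingularKernel.integral_nonneg (hD : IsSingularKernel D b) (hT : 0 ≤ T) :
    0 ≤ ∫ r in (0 : ℝ)..T, b r := by
  rw [intervalIntegral.integral_of_le hT]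
  exact setIntegral_nonneg measurableSet_Ioc fun r hr => hD.nonneg hr.1

lemma IsSingularKernel.integral_mono (hD : IsSingularKernel D b) {t : ℝ} (ht : 0 ≤ t)
    (htT : t ≤ T) : ∫ r in (0 : ℝ)..t, b r ≤ ∫ r in (0 : ℝ)..T, b r := by
  rw [intervalIntegral.integral_of_le ht, intervalIntegral.integral_of_le (ht.trans htT)]
  refine setIntegral_mono_set (hD.intervalIntegrable T).1 ?_ (Ioc_subset_Ioc_right htT).eventuallyLE
  filter_upwards [ae_restrict_mem measurableSet_Ioc] with r hr using hD.nonneg hr.1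

lemma volterra_eq_integral_sub (t : ℝ) : volterra D g t = ∫ r in (0 : ℝ)..t, D r (g (t - r)) := by
  have := intervalIntegral.integral_comp_sub_left (a := 0) (b := t)
    (fun s => D (t - s) (g s)) t
  simp only [sub_sub_cancel, sub_self, sub_zero] at this
  rw [volterra, this]

lemma IsSingularKernel.intervalIntegrable_comp (hD : IsSingularKernel D b) {t : ℝ} (ht : 0 ≤ t)
    (hg : ContinuousOn g (Icc 0 t)) :
    IntervalIntegrable (fun s => D (t - s) (g s)) volume 0 t := by
  obtain ⟨M, hM⟩ := isCompact_Icc.exists_bound_of_continuousOn hg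
  have hb : IntervalIntegrable (fun s => b (t - s) * M) volume 0 t := by
    have := (hD.intervalIntegrable t).comp_sub_left t
    simp only [sub_zero, sub_self] at this
    exact this.symm.mul_const M
  rw [intervalIntegrable_iff_integrableOn_Ioo_of_le ht] at hb ⊢
  refine Integrable.mono' hb ?_ ?_
  · refine ContinuousOn.aestronglyMeasurable ?_ measurableSet_Ioo
    refine ContinuousOn.clm_apply ?_ (hg.mono Ioo_subset_Icc_self)
    exact hD.continuousOn.comp (by fun_prop) fun s hs => by simpa using hs.2
  · filter_upwards [ae_restrict_mem measurableSet_Ioo] with s hs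
    have h0 : 0 < t - s := by linarith [hs.2]
    exact (ContinuousLinearMap.le_opNorm _ _).trans
      (mul_le_mul (hD.bound _ h0) (hM s (Ioo_subset_Icc_self hs)) (norm_nonneg _) (hD.nonneg h0))

lemma IsSingularKernel.norm_volterra_le (hD : IsSingularKernel D b) {t M : ℝ} (ht : 0 ≤ t)
    (htT : t ≤ T) (hM : ∀ s ∈ Icc 0 t, ‖g s‖ ≤ M) :
    ‖volterra D g t‖ ≤ M * ∫ r in (0 : ℝ)..T, b r := by
  have hM0 : 0 ≤ M := (norm_nonneg _).trans (hM 0 ⟨le_rfl, ht⟩)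
  refine le_trans ?_ (mul_le_mul_of_nonneg_left (hD.integral_mono ht htT) hM0)
  rw [volterra_eq_integral_sub, ← intervalIntegral.integral_const_mul]
  refine intervalIntegral.norm_integral_le_of_norm_le ht ?_ ((hD.intervalIntegrable t).const_mul M)
  refine Eventually.of_forall fun r hr => ?_
  rw [mul_comm]
  exact (ContinuousLinearMap.le_opNorm _ _).trans
      (mul_le_mul (hD.bound _ hr.1) (hM _ ⟨by linarith [hr.2], by linarith [hr.1]⟩)
        (norm_nonneg _) (hD.nonneg hr.1))

/-- After the substitution r = t - s the singular factor no longer depends on t and the moving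
endpoint becomes an indicator, so dominated convergence applies. -/
lemma IsSingularKernel.continuousOn_volterra (hD : IsSingularKernel D b) (hT : 0 ≤ T)
    (hg : ContinuousOn g (Icc 0 T)) : ContinuousOn (volterra D g) (Icc 0 T) := by
  -- The constant extension keeps the integrand defined and bounded when t - r leaves [0, T].
  set g' : ℝ → Y := IccExtend hT ((Icc 0 T).domRestrict g) with hg'
  have hg'c : Continuous g' := hg.domRestrict.Icc_extend'
  have hgg : ∀ s ∈ Icc 0 T, g' s = g s := fun s hs => by
    rw [hg', IccExtend_of_mem hT _ hs]; rfl
  obtain ⟨M, hM⟩ := isCompact_Icc.exists_bound_of_continuousOn hg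
  have hM' : ∀ s, ‖g' s‖ ≤ M := fun s => hM _ (Subtype.coe_prop (projIcc 0 T hT s))
  have hM0 : 0 ≤ M := (norm_nonneg _).trans (hM' 0)
  have key : ∀ t ∈ Icc 0 T, volterra D g t =
      ∫ r in Ioc 0 T, (Ioc 0 t).indicator (fun r => D r (g' (t - r))) r := by
    intro t ht
    rw [volterra_eq_integral_sub, intervalIntegral.integral_of_le ht.1,
      setIntegral_indicator measurableSet_Ioc,
      inter_eq_self_of_subset_right (Ioc_subset_Ioc_right ht.2)]
    refine setIntegral_congr_fun measurableSet_Ioc fun r hr => ?_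
    rw [hgg _ ⟨by linarith [hr.2], by linarith [hr.1, ht.2]⟩]
  refine ContinuousOn.congr ?_ key
  intro t₀ ht₀
  refine continuousWithinAt_of_dominated (bound := fun r => b r * M) ?_ ?_ ?_ ?_
  · refine Eventually.of_forall fun t => ?_
    refine AEStronglyMeasurable.indicator ?_ measurableSet_Ioc
    refine ContinuousOn.aestronglyMeasurable ?_ measurableSet_Ioc
    exact (hD.continuousOn.mono fun r hr => hr.1).clm_apply (by fun_prop)
  · refine Eventually.of_forall fun t => ?_
    filter_upwards [ae_restrict_mem measurableSet_Ioc] with r hr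
    refine (norm_indicator_le_norm_self _ _).trans ?_
    exact (ContinuousLinearMap.le_opNorm _ _).trans
      (mul_le_mul (hD.bound _ hr.1) (hM' _) (norm_nonneg _) (hD.nonneg hr.1))
  · exact (hD.intervalIntegrable T).1.mul_const M
  -- The integrand is continuous in t at t₀ except for r = t₀, where the indicator jumps.
  · have hne : ∀ᵐ r ∂(volume.restrict (Ioc 0 T)), r ≠ t₀ :=
      ae_restrict_of_ae (by simp [ae_iff, measure_singleton])
    filter_upwards [ae_restrict_mem measurableSet_Ioc, hne] with r hr hrt
    refine ContinuousAt.continuousWithinAt ?_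
    rcases lt_or_gt_of_ne hrt with h | h
    · have : (fun t => D r (g' (t - r))) =ᶠ[𝓝 t₀]
          fun t => (Ioc 0 t).indicator (fun r => D r (g' (t - r))) r := by
        filter_upwards [lt_mem_nhds h] with t ht
        rw [indicator_of_mem (show r ∈ Ioc 0 t from ⟨hr.1, ht.le⟩)]
      exact ContinuousAt.congr (by fun_prop) this
    · have : (fun _ => (0 : X)) =ᶠ[𝓝 t₀]
          fun t => (Ioc 0 t).indicator (fun r => D r (g' (t - r))) r := by
        filter_upwards [gt_mem_nhds h] with t ht
        rw [indicator_of_notMem (fun hh => absurd hh.2 (not_le.mpr ht))]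
      exact ContinuousAt.congr continuousAt_const this

lemma IsSingularKernel.volterra_sub (hD : IsSingularKernel D b) {g₁ g₂ : ℝ → Y} {t : ℝ}
    (ht : 0 ≤ t) (h₁ : ContinuousOn g₁ (Icc 0 t)) (h₂ : ContinuousOn g₂ (Icc 0 t)) :
    volterra D g₁ t - volterra D g₂ t = volterra D (fun s => g₁ s - g₂ s) t := by
  simp only [volterra, map_sub]
  rw [intervalIntegral.integral_sub (hD.intervalIntegrable_comp ht h₁)
    (hD.intervalIntegrable_comp ht h₂)]

section Contraction

variable {Γ : ℝ → X → Y} {L : ℝ} {φ : ℝ → X}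

/-- At a maximum point of ‖u₁ - u₂‖, the estimate bounds the maximum by itself times a factor below
one. -/
lemma IsSingularKernel.volterra_contraction_unique (hD : IsSingularKernel D b) (hT : 0 ≤ T)
    (hΓ : Continuous fun q : ℝ × X => Γ q.1 q.2) (hΓL : ∀ s x y, ‖Γ s x - Γ s y‖ ≤ L * ‖x - y‖)
    (hL0 : 0 ≤ L) (hL : L * (∫ r in (0 : ℝ)..T, b r) < 1) {u₁ u₂ : ℝ → X}
    (hu₁ : ContinuousOn u₁ (Icc 0 T)) (hu₂ : ContinuousOn u₂ (Icc 0 T))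
    (h₁ : ∀ t ∈ Icc 0 T, u₁ t = φ t + volterra D (fun s => Γ s (u₁ s)) t)
    (h₂ : ∀ t ∈ Icc 0 T, u₂ t = φ t + volterra D (fun s => Γ s (u₂ s)) t) :
    EqOn u₁ u₂ (Icc 0 T) := by
  obtain ⟨t₀, ht₀, hmax⟩ := isCompact_Icc.exists_isMaxOn (nonempty_Icc.mpr hT)
    (hu₁.sub hu₂).norm
  have hc : ∀ {u : ℝ → X}, ContinuousOn u (Icc 0 T) →
      ContinuousOn (fun s => Γ s (u s)) (Icc 0 t₀) := fun hu =>
    hΓ.comp_continuousOn (continuousOn_id.prodMk (hu.mono (Icc_subset_Icc_right ht₀.2)))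
  have h : ‖u₁ t₀ - u₂ t₀‖ ≤ L * ‖u₁ t₀ - u₂ t₀‖ * ∫ r in (0 : ℝ)..T, b r := by
    conv_lhs => rw [h₁ t₀ ht₀, h₂ t₀ ht₀, add_sub_add_left_eq_sub,
      hD.volterra_sub ht₀.1 (hc hu₁) (hc hu₂)]
    refine hD.norm_volterra_le ht₀.1 ht₀.2 fun s hs => (hΓL _ _ _).trans ?_
    exact mul_le_mul_of_nonneg_left (hmax ⟨hs.1, hs.2.trans ht₀.2⟩) hL0
  have h0 : ‖u₁ t₀ - u₂ t₀‖ = 0 := by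
    by_contra hne
    have : 0 < ‖u₁ t₀ - u₂ t₀‖ := lt_of_le_of_ne (norm_nonneg _) (Ne.symm hne)
    nlinarith
  intro t ht
  have := hmax ht
  simp only [mem_ofPred_eq, Pi.sub_apply, h0] at this
  exact sub_eq_zero.mp (norm_le_zero_iff.mp this)

/-- Banach's fixed point theorem in C([0, T], X). The nonlinearity may depend on time because the
exponential weights introduced below make it do so. -/
lemma IsSingularKernel.volterra_contraction_exists [CompleteSpace X] (hD : IsSingularKernel D b)
    (hT : 0 ≤ T)
    (hΓ : Continuous fun q : ℝ × X => Γ q.1 q.2) (hΓL : ∀ s x y, ‖Γ s x - Γ s y‖ ≤ L * ‖x - y‖)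
    (hL0 : 0 ≤ L) (hL : L * (∫ r in (0 : ℝ)..T, b r) < 1) (hφ : ContinuousOn φ (Icc 0 T)) :
    ∃ u : ℝ → X, ContinuousOn u (Icc 0 T) ∧
      ∀ t ∈ Icc 0 T, u t = φ t + volterra D (fun s => Γ s (u s)) t := by
  have hc : ∀ u : C(Icc 0 T, X), Continuous (fun s => Γ s (IccExtend hT u s)) := fun u =>
    hΓ.comp (continuous_id.prodMk u.continuous.Icc_extend')
  let Ψ : C(Icc 0 T, X) → C(Icc 0 T, X) := fun u =>
    ⟨fun t => φ t + volterra D (fun s => Γ s (IccExtend hT u s)) t,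
      hφ.domRestrict.add (hD.continuousOn_volterra hT (hc u).continuousOn).domRestrict⟩
  have hlip : LipschitzWith (Real.toNNReal (L * ∫ r in (0 : ℝ)..T, b r)) Ψ := by
    refine LipschitzWith.of_dist_le_mul fun u w => ?_
    rw [Real.coe_toNNReal _ (mul_nonneg hL0 (hD.integral_nonneg hT)),
      ContinuousMap.dist_le (mul_nonneg (mul_nonneg hL0 (hD.integral_nonneg hT)) dist_nonneg)]
    intro t
    change dist (φ t + volterra D _ t) (φ t + volterra D _ t) ≤ _
    rw [dist_add_left, dist_eq_norm, hD.volterra_sub t.2.1 (hc u).continuousOn (hc w).continuousOn]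
    refine (hD.norm_volterra_le (M := L * dist u w) t.2.1 t.2.2 fun s hs =>
      (hΓL _ _ _).trans ?_).trans (le_of_eq ?_)
    · rw [← dist_eq_norm]
      exact mul_le_mul_of_nonneg_left (ContinuousMap.dist_apply_le_dist _) hL0
    · ring
  have hcon : ContractingWith _ Ψ := ⟨Real.toNNReal_lt_one.mpr hL, hlip⟩
  have hfix := hcon.fixedPoint_isFixedPt
  set w := ContractingWith.fixedPoint Ψ hcon
  refine ⟨IccExtend hT w, w.continuous.Icc_extend'.continuousOn, fun t ht => ?_⟩
  have := DFunLike.congr_fun hfix ⟨t, ht⟩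
  rw [IccExtend_of_mem hT _ ht, ← this]
  rfl

end Contraction

/-- As κ → ∞ the damped majorant tends to 0 pointwise and stays below |b|, so its integral tends to
0. This replaces stepping over short time intervals. -/
lemma IsSingularKernel.exists_weight (hD : IsSingularKernel D b) (hT : 0 ≤ T) (L : ℝ) :
    ∃ κ : ℝ, L * (∫ r in (0 : ℝ)..T, Real.exp (-(κ * r)) * b r) < 1 := by
  have h : Tendsto (fun κ : ℝ => ∫ r in (0 : ℝ)..T, Real.exp (-(κ * r)) * b r) atTop
      (𝓝 (∫ r in (0 : ℝ)..T, (0 : ℝ))) := by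
    refine intervalIntegral.tendsto_integral_filter_of_dominated_convergence (fun r => ‖b r‖) ?_ ?_
      (hD.intervalIntegrable T).norm ?_
    · refine Eventually.of_forall fun κ => ?_
      exact AEStronglyMeasurable.mul (by fun_prop)
        (by rw [uIoc_of_le hT]; exact (hD.intervalIntegrable T).1.aestronglyMeasurable)
    · filter_upwards [eventually_ge_atTop 0] with κ hκ
      refine Eventually.of_forall fun r hr => ?_
      rw [uIoc_of_le hT] at hr
      rw [norm_mul, Real.norm_of_nonneg (Real.exp_nonneg _)]
      refine mul_le_of_le_one_left (norm_nonneg _) (Real.exp_le_one_iff.mpr ?_)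
      nlinarith [hr.1]
    · refine Eventually.of_forall fun r hr => ?_
      rw [uIoc_of_le hT] at hr
      have : Tendsto (fun κ : ℝ => Real.exp (-(κ * r))) atTop (𝓝 0) :=
        Real.tendsto_exp_neg_atTop_nhds_zero.comp (tendsto_id.atTop_mul_const hr.1)
      simpa using this.mul_const (b r)
  simp only [intervalIntegral.integral_zero] at h
  have h' := h.const_mul L
  rw [mul_zero] at h'
  exact ((tendsto_order.1 h').2 1 one_pos).exists

lemma IsSingularKernel.weighted (hD : IsSingularKernel D b) (κ : ℝ) :
    IsSingularKernel (fun r => Real.exp (-(κ * r)) • D r) (fun r => Real.exp (-(κ * r)) * b r) where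
  continuousOn := ContinuousOn.smul (f := fun r => Real.exp (-(κ * r))) (by fun_prop) hD.continuousOn
  bound r hr := by
    rw [norm_smul, Real.norm_of_nonneg (Real.exp_nonneg _)]
    exact mul_le_mul_of_nonneg_left (hD.bound r hr) (Real.exp_nonneg _)
  intervalIntegrable T := (hD.intervalIntegrable T).continuousOn_mul (by fun_prop)

section Global

variable {G : X → Y} {φ : ℝ → X}

/-- Since e^(-κ(t-s)) e^(-κs) = e^(-κt), the function e^(-κt) u solves an equation of the same kind
with a damped kernel. -/
lemma volterra_weighted (κ : ℝ) (u : ℝ → X) (t : ℝ) :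
    volterra (fun r => Real.exp (-(κ * r)) • D r)
      (fun s => Real.exp (-(κ * s)) • G (Real.exp (κ * s) • (Real.exp (-(κ * s)) • u s))) t
      = Real.exp (-(κ * t)) • volterra D (fun s => G (u s)) t := by
  rw [volterra, volterra, ← intervalIntegral.integral_smul]
  congr 1; ext s
  rw [smul_smul (Real.exp (κ * s)), ← Real.exp_add, add_neg_cancel, Real.exp_zero, one_smul,
    _root_.smul_apply, map_smul, smul_smul, ← Real.exp_add]
  congr 2; ring

variable {L : NNReal}

/-- The two weights cancel, so damping the kernel costs nothing in the Lipschitz constant. -/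
lemma weighted_lipschitz (hG : LipschitzWith L G) (κ s : ℝ) (x y : X) :
    ‖Real.exp (-(κ * s)) • G (Real.exp (κ * s) • x) - Real.exp (-(κ * s)) • G (Real.exp (κ * s) • y)‖
      ≤ L * ‖x - y‖ := by
  rw [← smul_sub, norm_smul, Real.norm_of_nonneg (Real.exp_nonneg _)]
  have h := hG.dist_le_mul (Real.exp (κ * s) • x) (Real.exp (κ * s) • y)
  rw [dist_eq_norm, dist_eq_norm, ← smul_sub, norm_smul, Real.norm_of_nonneg (Real.exp_nonneg _)] at h
  calc _ ≤ Real.exp (-(κ * s)) * (L * (Real.exp (κ * s) * ‖x - y‖)) :=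
        mul_le_mul_of_nonneg_left h (Real.exp_nonneg _)
    _ = (Real.exp (-(κ * s)) * Real.exp (κ * s)) * (L * ‖x - y‖) := by ring
    _ = _ := by rw [← Real.exp_add, neg_add_cancel, Real.exp_zero, one_mul]

/-- Volterra equations with a Lipschitz nonlinearity have at most one continuous solution. -/
theorem IsSingularKernel.volterra_unique (hD : IsSingularKernel D b) (hT : 0 ≤ T)
    (hG : LipschitzWith L G) {u₁ u₂ : ℝ → X}
    (hu₁ : ContinuousOn u₁ (Icc 0 T)) (hu₂ : ContinuousOn u₂ (Icc 0 T))
    (h₁ : ∀ t ∈ Icc 0 T, u₁ t = φ t + volterra D (fun s => G (u₁ s)) t)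
    (h₂ : ∀ t ∈ Icc 0 T, u₂ t = φ t + volterra D (fun s => G (u₂ s)) t) :
    EqOn u₁ u₂ (Icc 0 T) := by
  obtain ⟨κ, hκ⟩ := hD.exists_weight hT L
  have hGc := hG.continuous
  have := (hD.weighted κ).volterra_contraction_unique hT
    (Γ := fun s x => Real.exp (-(κ * s)) • G (Real.exp (κ * s) • x)) (L := L)
    (φ := fun t => Real.exp (-(κ * t)) • φ t)
    (u₁ := fun t => Real.exp (-(κ * t)) • u₁ t) (u₂ := fun t => Real.exp (-(κ * t)) • u₂ t)
    (by fun_prop) (weighted_lipschitz hG κ) L.2 hκ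
    (ContinuousOn.smul (by fun_prop) hu₁) (ContinuousOn.smul (by fun_prop) hu₂)
    (fun t ht => by rw [volterra_weighted, ← smul_add, ← h₁ t ht])
    (fun t ht => by rw [volterra_weighted, ← smul_add, ← h₂ t ht])
  intro t ht
  exact smul_right_injective X (Real.exp_ne_zero (-(κ * t))) (this ht)

/-- Volterra equations with a Lipschitz nonlinearity have global continuous solutions. -/
theorem IsSingularKernel.volterra_exists [CompleteSpace X] (hD : IsSingularKernel D b)
    (hT : 0 ≤ T) (hG : LipschitzWith L G) (hφ : ContinuousOn φ (Icc 0 T)) :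
    ∃ u : ℝ → X, ContinuousOn u (Icc 0 T) ∧
      ∀ t ∈ Icc 0 T, u t = φ t + volterra D (fun s => G (u s)) t := by
  obtain ⟨κ, hκ⟩ := hD.exists_weight hT L
  have hGc := hG.continuous
  obtain ⟨w, hw, hwe⟩ := (hD.weighted κ).volterra_contraction_exists hT
    (Γ := fun s x => Real.exp (-(κ * s)) • G (Real.exp (κ * s) • x)) (L := L)
    (φ := fun t => Real.exp (-(κ * t)) • φ t)
    (by fun_prop) (weighted_lipschitz hG κ) L.2 hκ (ContinuousOn.smul (by fun_prop) hφ)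
  have hw' : ∀ s, w s = Real.exp (-(κ * s)) • (Real.exp (κ * s) • w s) := fun s => by
    rw [smul_smul, ← Real.exp_add, neg_add_cancel, Real.exp_zero, one_smul]
  refine ⟨fun t => Real.exp (κ * t) • w t, ContinuousOn.smul (by fun_prop) hw, fun t ht => ?_⟩
  have h := hwe t ht
  have h2 : volterra (fun r => Real.exp (-(κ * r)) • D r)
      (fun s => Real.exp (-(κ * s)) • G (Real.exp (κ * s) • w s)) t
      = Real.exp (-(κ * t)) • volterra D (fun s => G (Real.exp (κ * s) • w s)) t := by
    rw [← volterra_weighted (D := D) (G := G) κ (fun s => Real.exp (κ * s) • w s) t]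
    simp only [← hw']
  rw [h2, ← smul_add] at h
  simp only
  conv_lhs => rw [h]
  rw [smul_smul, ← Real.exp_add, add_neg_cancel, Real.exp_zero, one_smul]

end Global

end Volterra

/-! ### Lebesgue spaces on the torus -/

instance : IsFiniteMeasure torusMeasure := by unfold torusMeasure; infer_instance

abbrev LOne : Type := Lp E3 1 torusMeasure
abbrev LTwo : Type := Lp E3 2 torusMeasure
abbrev LInf : Type := Lp E3 ∞ torusMeasure

lemma neg_pi_le_pi : (-π : ℝ) ≤ π := by linarith [Real.pi_pos]

lemma neg_pi_lt_pi : (-π : ℝ) < π := by linarith [Real.pi_pos]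

lemma integral_torusMeasure {F : Type*} [NormedAddCommGroup F] [NormedSpace ℝ F] (f : ℝ → F) :
    ∫ x, f x ∂torusMeasure = ∫ x in (-π)..π, f x := by
  rw [intervalIntegral.integral_of_le neg_pi_le_pi, torusMeasure]

lemma torusMeasure_real_univ : torusMeasure.real univ = 2 * π := by
  simp [torusMeasure, Measure.real]
  rw [ENNReal.toReal_ofReal] <;> linarith [Real.pi_pos]

/-- The inclusion `L² ⊆ L¹`. -/
def toOne : LTwo →L[ℝ] LOne :=
  (ContinuousLinearMap.lsmul ℝ ℝ).holderL torusMeasure 2 2 1 (Lp.const 2 torusMeasure (1 : ℝ))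

/-- The inclusion `L^∞ ⊆ L¹`. -/
def infToOne : LInf →L[ℝ] LOne :=
  (ContinuousLinearMap.lsmul ℝ ℝ).holderL torusMeasure 1 ∞ 1 (Lp.const 1 torusMeasure (1 : ℝ))

lemma coeFn_toOne (v : LTwo) : toOne v =ᵐ[torusMeasure] v := by
  unfold toOne
  rw [ContinuousLinearMap.holderL_apply_apply]
  filter_upwards [(ContinuousLinearMap.lsmul ℝ ℝ).coeFn_holder (r := 1)
    (Lp.const 2 torusMeasure (1 : ℝ)) v, Lp.coeFn_const (p := 2) (μ := torusMeasure) (1 : ℝ)]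
    with x h1 h2
  rw [h1, h2]
  simp

lemma coeFn_infToOne (v : LInf) : infToOne v =ᵐ[torusMeasure] v := by
  unfold infToOne
  rw [ContinuousLinearMap.holderL_apply_apply]
  filter_upwards [(ContinuousLinearMap.lsmul ℝ ℝ).coeFn_holder (r := 1)
    (Lp.const 1 torusMeasure (1 : ℝ)) v, Lp.coeFn_const (p := 1) (μ := torusMeasure) (1 : ℝ)]
    with x h1 h2
  rw [h1, h2]
  simp

lemma LOne.integrable (g : LOne) : Integrable g torusMeasure := L1.integrable_coeFn g

lemma LTwo.integrable (g : LTwo) : Integrable g torusMeasure :=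
  (Lp.memLp g).integrable (by norm_num)

lemma LTwo.norm_sq_eq (v : LTwo) : ‖v‖ ^ 2 = ∫ x, ‖v x‖ ^ 2 ∂torusMeasure := by
  rw [← real_inner_self_eq_norm_sq, L2.inner_def]
  simp

/-! ### Fourier coefficients -/

/-- The functional `g ↦ ∫ φ g`. -/
def coefL (φ : Lp ℝ ∞ torusMeasure) : LOne →L[ℝ] E3 :=
  (ContinuousLinearMap.lsmul ℝ ℝ : ℝ →L[ℝ] E3 →L[ℝ] E3).lpPairing torusMeasure ∞ 1 φ

lemma coefL_apply (φ : Lp ℝ ∞ torusMeasure) (g : LOne) :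
    coefL φ g = ∫ x, φ x • g x ∂torusMeasure := by
  rw [coefL, ContinuousLinearMap.lpPairing_eq_integral]
  rfl

/-- Hölder's inequality with exponents ∞ and 1. It bounds the trigonometric coefficients uniformly
in the frequency for data that are merely in L¹. -/
lemma norm_coefL_le (φ : Lp ℝ ∞ torusMeasure) (hφ : ‖φ‖ ≤ 1) (g : LOne) :
    ‖coefL φ g‖ ≤ ‖g‖ := by
  rw [coefL_apply, L1.norm_eq_integral_norm]
  refine norm_integral_le_of_norm_le (LOne.integrable g).norm ?_
  have h := ae_le_eLpNormEssSup (f := φ) (μ := torusMeasure)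
  filter_upwards [h] with x hx
  rw [norm_smul]
  refine mul_le_of_le_one_left (norm_nonneg _) (le_trans ?_ hφ)
  rw [Lp.norm_def, eLpNorm_exponent_top]
  have hfin : eLpNormEssSup φ torusMeasure ≠ ∞ := by
    rw [← eLpNorm_exponent_top]; exact Lp.eLpNorm_ne_top φ
  rw [← toReal_enorm]
  exact ENNReal.toReal_mono hfin hx

/-- The operator `c ↦ φ c`. -/
def mulConst (φ : Lp ℝ ∞ torusMeasure) : E3 →L[ℝ] LTwo :=
  ((ContinuousLinearMap.lsmul ℝ ℝ : ℝ →L[ℝ] E3 →L[ℝ] E3).holderL torusMeasure ∞ 2 2 φ).comp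
    (Lp.constL 2 torusMeasure ℝ)

lemma coeFn_mulConst (φ : Lp ℝ ∞ torusMeasure) (c : E3) :
    mulConst φ c =ᵐ[torusMeasure] fun x => φ x • c := by
  unfold mulConst
  rw [ContinuousLinearMap.comp_apply, ContinuousLinearMap.holderL_apply_apply]
  filter_upwards [(ContinuousLinearMap.lsmul ℝ ℝ : ℝ →L[ℝ] E3 →L[ℝ] E3).coeFn_holder (r := 2)
    φ (Lp.const 2 torusMeasure c), Lp.coeFn_const (p := 2) (μ := torusMeasure) c] with x h1 h2
  change ((ContinuousLinearMap.lsmul ℝ ℝ : ℝ →L[ℝ] E3 →L[ℝ] E3).holder 2 φ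
    (Lp.const 2 torusMeasure c)) x = _
  rw [h1, h2]
  rfl

lemma memLp_top_of_continuous_bounded {f : ℝ → ℝ} (hf : Continuous f) {C : ℝ}
    (hC : ∀ x, |f x| ≤ C) : MemLp f ∞ torusMeasure :=
  memLp_top_of_bound hf.aestronglyMeasurable C (Eventually.of_forall hC)

/-- `x ↦ cos (k x)` in `L^∞`. -/
def cosInf (k : ℤ) : Lp ℝ ∞ torusMeasure :=
  (memLp_top_of_continuous_bounded (f := fun x => Real.cos (k * x)) (by fun_prop)
    fun _ => Real.abs_cos_le_one _).toLp

/-- `x ↦ sin (k x)` in `L^∞`. -/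
def sinInf (k : ℤ) : Lp ℝ ∞ torusMeasure :=
  (memLp_top_of_continuous_bounded (f := fun x => Real.sin (k * x)) (by fun_prop)
    fun _ => Real.abs_sin_le_one _).toLp

lemma coeFn_cosInf (k : ℤ) : cosInf k =ᵐ[torusMeasure] fun x => Real.cos (k * x) :=
  MemLp.coeFn_toLp _

lemma coeFn_sinInf (k : ℤ) : sinInf k =ᵐ[torusMeasure] fun x => Real.sin (k * x) :=
  MemLp.coeFn_toLp _

lemma norm_toLp_top_le {f : ℝ → ℝ} (hf : MemLp f ∞ torusMeasure) (hC : ∀ x, |f x| ≤ 1) :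
    ‖hf.toLp‖ ≤ 1 := by
  rw [Lp.norm_toLp]
  refine ENNReal.toReal_le_of_le_ofReal zero_le_one ?_
  rw [eLpNorm_exponent_top]
  exact eLpNormEssSup_le_of_ae_bound (Eventually.of_forall hC)

lemma norm_cosInf_le (k : ℤ) : ‖cosInf k‖ ≤ 1 :=
  norm_toLp_top_le _ fun _ => Real.abs_cos_le_one _

lemma norm_sinInf_le (k : ℤ) : ‖sinInf k‖ ≤ 1 :=
  norm_toLp_top_le _ fun _ => Real.abs_sin_le_one _

/-- The cosine coefficient `∫ cos (k x) g(x) dx`. -/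
def cosCoef (k : ℤ) : LOne →L[ℝ] E3 := coefL (cosInf k)

/-- The sine coefficient `∫ sin (k x) g(x) dx`. -/
def sinCoef (k : ℤ) : LOne →L[ℝ] E3 := coefL (sinInf k)

lemma cosCoef_apply (k : ℤ) (g : LOne) :
    cosCoef k g = ∫ x, Real.cos (k * x) • g x ∂torusMeasure := by
  rw [cosCoef, coefL_apply]
  refine integral_congr_ae ?_
  filter_upwards [coeFn_cosInf k] with x hx
  rw [hx]

lemma sinCoef_apply (k : ℤ) (g : LOne) :
    sinCoef k g = ∫ x, Real.sin (k * x) • g x ∂torusMeasure := by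
  rw [sinCoef, coefL_apply]
  refine integral_congr_ae ?_
  filter_upwards [coeFn_sinInf k] with x hx
  rw [hx]

lemma norm_cosCoef_le (k : ℤ) (g : LOne) : ‖cosCoef k g‖ ≤ ‖g‖ :=
  norm_coefL_le _ (norm_cosInf_le k) g

lemma norm_sinCoef_le (k : ℤ) (g : LOne) : ‖sinCoef k g‖ ≤ ‖g‖ :=
  norm_coefL_le _ (norm_sinInf_le k) g

lemma integrable_cos_smul (k : ℤ) {g : ℝ → E3} (hg : Integrable g torusMeasure) :
    Integrable (fun x => Real.cos (k * x) • g x) torusMeasure :=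
  hg.bdd_smul (φ := fun x => Real.cos (k * x)) 1 (by fun_prop)
    (Eventually.of_forall fun _ => Real.abs_cos_le_one _)

lemma integrable_sin_smul (k : ℤ) {g : ℝ → E3} (hg : Integrable g torusMeasure) :
    Integrable (fun x => Real.sin (k * x) • g x) torusMeasure :=
  hg.bdd_smul (φ := fun x => Real.sin (k * x)) 1 (by fun_prop)
    (Eventually.of_forall fun _ => Real.abs_sin_le_one _)

/-- Parseval's identity for real valued functions, in terms of cosine and sine integrals. -/
lemma hasSum_sq_trig_real {f : ℝ → ℝ} (hf : MemLp f 2 torusMeasure) :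
    HasSum (fun k : ℤ => (∫ x, Real.cos (k * x) * f x ∂torusMeasure) ^ 2
      + (∫ x, Real.sin (k * x) * f x ∂torusMeasure) ^ 2)
      (2 * π * ∫ x, f x ^ 2 ∂torusMeasure) := by
  -- The complex coefficient is (2π)⁻¹(c - is) with real cosine and sine integrals c and s, so its
  -- squared modulus is (2π)⁻²(c² + s²).
  have h := hasSum_sq_fourierCoeffOn (f := fun x => (f x : ℂ)) neg_pi_lt_pi hf.ofReal
  have hi : Integrable f torusMeasure := hf.integrable (by norm_num)
  have hco : ∀ k : ℤ, fourierCoeffOn neg_pi_lt_pi (fun x => (f x : ℂ)) k =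
      (2 * π : ℝ)⁻¹ • (((∫ x, Real.cos (k * x) * f x ∂torusMeasure : ℝ) : ℂ)
        - ((∫ x, Real.sin (k * x) * f x ∂torusMeasure : ℝ) : ℂ) * Complex.I) := by
    intro k
    rw [fourierCoeffOn_eq_integral, ← integral_torusMeasure, ← integral_complex_ofReal, ← integral_complex_ofReal,
      ← integral_mul_const, ← integral_sub]
    · rw [one_div]
      congr 1
      · congr 1; ring
      · refine integral_congr_ae (Eventually.of_forall fun x => ?_)
        have h1 : (2 * π * Complex.I * ((-k : ℤ) : ℂ) * x / ((π - -π : ℝ) : ℂ) : ℂ)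
            = ((-(k * x) : ℝ) : ℂ) * Complex.I := by
          have : (π : ℂ) ≠ 0 := by exact_mod_cast Real.pi_ne_zero
          push_cast
          field_simp
          ring
        simp only [fourier_coe_apply, smul_eq_mul]
        rw [h1, Complex.exp_mul_I, ← Complex.ofReal_cos, ← Complex.ofReal_sin, Real.cos_neg,
          Real.sin_neg]
        push_cast
        ring
    · exact (hi.bdd_mul (c := 1) (by fun_prop)
        (Eventually.of_forall fun x => Real.abs_cos_le_one _)).ofReal
    · exact ((hi.bdd_mul (c := 1) (by fun_prop)
        (Eventually.of_forall fun x => Real.abs_sin_le_one _)).ofReal).mul_const _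
  have hn : ∀ a b : ℝ, ‖(2 * π : ℝ)⁻¹ • ((a : ℂ) - (b : ℂ) * Complex.I)‖ ^ 2
      = (2 * π)⁻¹ ^ 2 * (a ^ 2 + b ^ 2) := by
    intro a b
    rw [norm_smul, mul_pow, Real.norm_eq_abs, sq_abs, ← Complex.normSq_eq_norm_sq]
    congr 1
    simp [Complex.normSq_apply]
    ring
  simp only [hco, hn] at h
  have h2 := h.mul_left ((2 * π) ^ 2)
  have hp : (2 * π) ≠ 0 := by positivity
  have hp2 : (2 * π) ^ 2 * (2 * π)⁻¹ ^ 2 = 1 := by field_simp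
  simp only [← mul_assoc, hp2, one_mul] at h2
  convert! h2 using 1
  rw [← integral_torusMeasure]
  have : (π - -π) = 2 * π := by ring
  rw [this, smul_eq_mul, ← mul_assoc]
  congr 1
  · field_simp
  · refine integral_congr_ae (Eventually.of_forall fun x => ?_)
    simp

lemma integral_apply {g : ℝ → E3} (hg : Integrable g torusMeasure) (i : Fin 3) :
    (∫ x, g x ∂torusMeasure) i = ∫ x, g x i ∂torusMeasure :=
  ((EuclideanSpace.proj i : E3 →L[ℝ] ℝ).integral_comp_comm hg).symm

/-- Parseval's identity. -/
theorem hasSum_sq_coef (v : LTwo) :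
    HasSum (fun k : ℤ => ‖cosCoef k (toOne v)‖ ^ 2 + ‖sinCoef k (toOne v)‖ ^ 2)
      (2 * π * ‖v‖ ^ 2) := by
  have hv : Integrable (toOne v) torusMeasure := LOne.integrable _
  have hcomp : ∀ i : Fin 3, MemLp (fun x => toOne v x i) 2 torusMeasure := fun i => by
    have h2 : MemLp (toOne v) 2 torusMeasure := (memLp_congr_ae (coeFn_toOne v)).mpr (Lp.memLp v)
    exact (EuclideanSpace.proj i : E3 →L[ℝ] ℝ).comp_memLp' h2
  have h := hasSum_sum (s := Finset.univ) fun i _ => hasSum_sq_trig_real (hcomp i)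
  convert! h using 1
  · ext k
    rw [EuclideanSpace.norm_sq_eq, EuclideanSpace.norm_sq_eq, Finset.sum_add_distrib]
    congr 1 <;> refine Finset.sum_congr rfl fun i _ => ?_
    · rw [cosCoef_apply, integral_apply (integrable_cos_smul k hv), Real.norm_eq_abs, sq_abs]
      rfl
    · rw [sinCoef_apply, integral_apply (integrable_sin_smul k hv), Real.norm_eq_abs, sq_abs]
      rfl
  · rw [← Finset.mul_sum, LTwo.norm_sq_eq, ← integral_finsetSum]
    · congr 1
      refine integral_congr_ae ?_
      filter_upwards [coeFn_toOne v] with x hx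
      simp only [hx]
      rw [EuclideanSpace.norm_sq_eq]
      simp
    · intro i _
      exact (hcomp i).integrable_sq

/-! ### Orthogonality of the trigonometric functions -/

lemma integral_cos_int (n : ℤ) :
    ∫ x, Real.cos (n * x) ∂torusMeasure = if n = 0 then 2 * π else 0 := by
  rw [integral_torusMeasure]
  split_ifs with h
  · simp [h]; ring
  · have hn : (n : ℝ) ≠ 0 := by exact_mod_cast h
    rw [intervalIntegral.integral_comp_mul_left (fun x => Real.cos x) hn, integral_cos]
    simp [Real.sin_int_mul_pi]

lemma integral_sin_int (n : ℤ) : ∫ x, Real.sin (n * x) ∂torusMeasure = 0 := by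
  rw [integral_torusMeasure]
  rcases eq_or_ne n 0 with rfl | h
  · simp
  · have hn : (n : ℝ) ≠ 0 := by exact_mod_cast h
    rw [intervalIntegral.integral_comp_mul_left (fun x => Real.sin x) hn, integral_sin]
    simp

lemma integrable_of_continuous_torus {F : Type*} [NormedAddCommGroup F] {f : ℝ → F}
    (hf : Continuous f) : Integrable f torusMeasure :=
  (hf.integrableOn_Icc (a := -π) (b := π)).mono_set Ioc_subset_Icc_self

/-- The two conditions are kept apart because k runs over all integers; for j = k = 0 both hold and
together give 2π. -/
lemma integral_cos_mul_cos (j k : ℤ) : ∫ x, Real.cos (j * x) * Real.cos (k * x) ∂torusMeasure =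
    (if k = j then π else 0) + if k = -j then π else 0 := by
  have h : ∀ x : ℝ, Real.cos (j * x) * Real.cos (k * x) =
      (1 / 2) * (Real.cos ((k - j : ℤ) * x) + Real.cos ((k + j : ℤ) * x)) := fun x => by
    push_cast
    rw [sub_mul, add_mul, Real.cos_sub, Real.cos_add]; ring
  simp only [h]
  rw [integral_const_mul, integral_add (integrable_of_continuous_torus (by fun_prop))
    (integrable_of_continuous_torus (by fun_prop)), integral_cos_int, integral_cos_int]
  simp only [sub_eq_zero, add_eq_zero_iff_eq_neg]
  split_ifs <;> ring

lemma integral_sin_mul_sin (j k : ℤ) : ∫ x, Real.sin (j * x) * Real.sin (k * x) ∂torusMeasure =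
    (if k = j then π else 0) - if k = -j then π else 0 := by
  have h : ∀ x : ℝ, Real.sin (j * x) * Real.sin (k * x) =
      (1 / 2) * (Real.cos ((k - j : ℤ) * x) - Real.cos ((k + j : ℤ) * x)) := fun x => by
    push_cast
    rw [sub_mul, add_mul, Real.cos_sub, Real.cos_add]; ring
  simp only [h]
  rw [integral_const_mul, integral_sub (integrable_of_continuous_torus (by fun_prop))
    (integrable_of_continuous_torus (by fun_prop)), integral_cos_int, integral_cos_int]
  simp only [sub_eq_zero, add_eq_zero_iff_eq_neg]
  split_ifs <;> ring

lemma integral_sin_mul_cos (j k : ℤ) :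
    ∫ x, Real.sin (j * x) * Real.cos (k * x) ∂torusMeasure = 0 := by
  have h : ∀ x : ℝ, Real.sin (j * x) * Real.cos (k * x) =
      (1 / 2) * (Real.sin ((k + j : ℤ) * x) - Real.sin ((k - j : ℤ) * x)) := fun x => by
    push_cast
    rw [sub_mul, add_mul, Real.sin_sub, Real.sin_add]; ring
  simp only [h]
  rw [integral_const_mul, integral_sub (integrable_of_continuous_torus (by fun_prop))
    (integrable_of_continuous_torus (by fun_prop)), integral_sin_int, integral_sin_int]
  simp

lemma integral_cos_mul_sin (j k : ℤ) :
    ∫ x, Real.cos (j * x) * Real.sin (k * x) ∂torusMeasure = 0 := by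
  rw [← integral_sin_mul_cos k j]
  simp only [mul_comm]

/-! ### The derivative of the heat semigroup, `L¹ → L²` -/

/-- The operator `g ↦ cos (k x) ∫ sin (k y) g(y) dy - sin (k x) ∫ cos (k y) g(y) dy`. -/
def trigDeriv (k : ℤ) : LOne →L[ℝ] LTwo :=
  (mulConst (cosInf k)).comp (sinCoef k) - (mulConst (sinInf k)).comp (cosCoef k)

lemma trigDeriv_apply (k : ℤ) (g : LOne) :
    trigDeriv k g = mulConst (cosInf k) (sinCoef k g) - mulConst (sinInf k) (cosCoef k g) := rfl

lemma exists_norm_trigDeriv_le : ∃ C, 0 ≤ C ∧ ∀ k, ‖trigDeriv k‖ ≤ C := by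
  have hm : ∀ φ : Lp ℝ ∞ torusMeasure, ‖φ‖ ≤ 1 → ‖mulConst φ‖ ≤
      ‖(ContinuousLinearMap.lsmul ℝ ℝ : ℝ →L[ℝ] E3 →L[ℝ] E3).holderL torusMeasure ∞ 2 2‖
        * ‖(Lp.constL 2 torusMeasure ℝ : E3 →L[ℝ] LTwo)‖ := fun φ hφ => by
    refine (ContinuousLinearMap.opNorm_comp_le _ _).trans ?_
    refine mul_le_mul_of_nonneg_right ?_ (norm_nonneg _)
    exact (ContinuousLinearMap.le_opNorm _ _).trans (mul_le_of_le_one_right (norm_nonneg _) hφ)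
  set A := ‖(ContinuousLinearMap.lsmul ℝ ℝ : ℝ →L[ℝ] E3 →L[ℝ] E3).holderL torusMeasure ∞ 2 2‖
        * ‖(Lp.constL 2 torusMeasure ℝ : E3 →L[ℝ] LTwo)‖ with hA
  have hA0 : 0 ≤ A := by positivity
  refine ⟨A + A, by positivity, fun k => ?_⟩
  refine ContinuousLinearMap.opNorm_le_bound _ (by positivity) fun g => ?_
  rw [trigDeriv_apply, add_mul]
  refine (norm_sub_le _ _).trans (add_le_add ?_ ?_)
  · exact (ContinuousLinearMap.le_opNorm _ _).trans
      (mul_le_mul (hm _ (norm_cosInf_le k)) (norm_sinCoef_le k g) (norm_nonneg _) hA0)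
  · exact (ContinuousLinearMap.le_opNorm _ _).trans
      (mul_le_mul (hm _ (norm_sinInf_le k)) (norm_cosCoef_le k g) (norm_nonneg _) hA0)

/-- The Fourier weights `k exp (-k² t)`. -/
def heatWeight (k : ℤ) (t : ℝ) : ℝ := k * Real.exp (-(k : ℝ) ^ 2 * t)

/-- The operator `∂ₓ S(t)` from `L¹` to `L²`. -/
def heatD (t : ℝ) : LOne →L[ℝ] LTwo := (2 * π)⁻¹ • ∑' k : ℤ, heatWeight k t • trigDeriv k

/-- The inequality y²/2 ≤ e^y at y = k²ε gains four powers of k, enough to dominate the heat series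
uniformly for t ≥ ε. -/
lemma exp_neg_sq_mul_le (k : ℤ) (hk : k ≠ 0) {t ε : ℝ} (hε : 0 < ε) (ht : ε ≤ t) :
    Real.exp (-(k : ℝ) ^ 2 * t) ≤ 2 / ε ^ 2 * (1 / |(k : ℝ)| ^ 4) := by
  have hk' : (0 : ℝ) < |(k : ℝ)| := abs_pos.mpr (by exact_mod_cast hk)
  set y : ℝ := (k : ℝ) ^ 2 * ε with hy
  have hy0 : 0 < y := by rw [hy, ← sq_abs]; positivity
  have h1 : y ^ 2 / 2 ≤ Real.exp y := by
    nlinarith [Real.quadratic_le_exp_of_nonneg hy0.le]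
  have h2 : Real.exp (-(k : ℝ) ^ 2 * t) ≤ Real.exp (-y) := by
    refine Real.exp_le_exp.mpr ?_
    rw [hy]
    nlinarith [sq_nonneg (k : ℝ)]
  refine h2.trans ?_
  rw [Real.exp_neg, inv_le_comm₀ (Real.exp_pos _) (by positivity)]
  refine le_trans (le_of_eq ?_) h1
  rw [hy, show (k : ℝ) ^ 2 = |(k : ℝ)| ^ 2 from (sq_abs _).symm]
  field_simp

lemma abs_heatWeight_le (k : ℤ) {t ε : ℝ} (hε : 0 < ε) (ht : ε ≤ t) :
    |heatWeight k t| ≤ 2 / ε ^ 2 * (1 / |(k : ℝ)| ^ 2) := by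
  rcases eq_or_ne k 0 with rfl | hk
  · simp [heatWeight]
  · have hk' : (1 : ℝ) ≤ |(k : ℝ)| := by exact_mod_cast Int.one_le_abs hk
    rw [heatWeight, abs_mul, abs_of_pos (Real.exp_pos _)]
    calc _ ≤ |(k : ℝ)| * (2 / ε ^ 2 * (1 / |(k : ℝ)| ^ 4)) :=
          mul_le_mul_of_nonneg_left (exp_neg_sq_mul_le k hk hε ht) (by positivity)
      _ = 2 / ε ^ 2 * (1 / |(k : ℝ)| ^ 3) := by field_simp
      _ ≤ _ := by
          gcongr
          · norm_num

lemma summable_one_div_abs_sq : Summable fun k : ℤ => 1 / |(k : ℝ)| ^ 2 := by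
  simp only [sq_abs]
  exact Real.summable_one_div_int_pow.mpr (by norm_num)

lemma hasSum_heatD {t : ℝ} (ht : 0 < t) :
    HasSum (fun k : ℤ => ((2 * π)⁻¹ * heatWeight k t) • trigDeriv k) (heatD t) := by
  obtain ⟨C, hC0, hC⟩ := exists_norm_trigDeriv_le
  have : Summable fun k : ℤ => heatWeight k t • trigDeriv k := by
    refine Summable.of_norm_bounded ((summable_one_div_abs_sq.mul_left (2 / t ^ 2)).mul_right C)
      fun k => ?_
    rw [norm_smul]
    exact mul_le_mul (abs_heatWeight_le k ht le_rfl) (hC k) (norm_nonneg _) (by positivity)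
  simpa only [heatD, smul_smul] using this.hasSum.const_smul (2 * π)⁻¹

/-- The series is dominated in operator norm only away from t = 0, so continuity is shown on each
(ε, ∞). -/
lemma continuousOn_heatD : ContinuousOn heatD (Ioi 0) := by
  obtain ⟨C, hC0, hC⟩ := exists_norm_trigDeriv_le
  have key : ∀ ε : ℝ, 0 < ε → ContinuousOn heatD (Ioi ε) := fun ε hε => by
    have h : ContinuousOn (fun t => ∑' k : ℤ, heatWeight k t • trigDeriv k) (Ioi ε) := by
      refine continuousOn_tsum
        (u := fun k : ℤ => 2 / ε ^ 2 * (1 / |(k : ℝ)| ^ 2) * C) (fun k => ?_)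
        ((summable_one_div_abs_sq.mul_left _).mul_right C) fun k t ht => ?_
      · exact ContinuousOn.smul (f := fun t => heatWeight k t) (by unfold heatWeight; fun_prop)
          continuousOn_const
      · rw [norm_smul]
        exact mul_le_mul (abs_heatWeight_le k hε (le_of_lt ht)) (hC k) (norm_nonneg _) (by positivity)
    exact h.const_smul ((2 * π)⁻¹ : ℝ)
  intro t ht
  exact ((key (t / 2) (half_pos ht)).continuousAt
    (Ioi_mem_nhds (half_lt_self ht))).continuousWithinAt

/-- With Φ a Fourier coefficient this diagonalises ∂ₓS(t); with Φ a point evaluation of the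
primitive it recovers the heat kernel. -/
lemma hasSum_heatD_apply {F : Type*} [NormedAddCommGroup F] [NormedSpace ℝ F] (Φ : LTwo →L[ℝ] F)
    {t : ℝ} (ht : 0 < t) (g : LOne) :
    HasSum (fun k : ℤ => ((2 * π)⁻¹ * heatWeight k t) • Φ (trigDeriv k g)) (Φ (heatD t g)) := by
  have h := (hasSum_heatD ht).mapL (Φ.comp (ContinuousLinearMap.apply ℝ LTwo g))
  simpa using h

lemma coeFn_toOne_mulConst (φ : Lp ℝ ∞ torusMeasure) (c : E3) :
    toOne (mulConst φ c) =ᵐ[torusMeasure] fun x => φ x • c :=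
  (coeFn_toOne _).trans (coeFn_mulConst φ c)

lemma coefL_toOne_mulConst (ψ φ : Lp ℝ ∞ torusMeasure) (c : E3) :
    coefL ψ (toOne (mulConst φ c)) = (∫ x, ψ x * φ x ∂torusMeasure) • c := by
  rw [coefL_apply, ← integral_smul_const]
  refine integral_congr_ae ?_
  filter_upwards [coeFn_toOne_mulConst φ c] with x hx
  rw [hx, smul_smul]

lemma cosCoef_trigDeriv (j k : ℤ) (g : LOne) : cosCoef j (toOne (trigDeriv k g)) =
    ((if k = j then π else 0) + if k = -j then π else 0) • sinCoef k g := by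
  rw [trigDeriv_apply, map_sub, map_sub, cosCoef, coefL_toOne_mulConst, coefL_toOne_mulConst]
  have h1 : ∫ x, cosInf j x * cosInf k x ∂torusMeasure =
      ∫ x, Real.cos (j * x) * Real.cos (k * x) ∂torusMeasure :=
    integral_congr_ae ((coeFn_cosInf j).mul (coeFn_cosInf k))
  have h2 : ∫ x, cosInf j x * sinInf k x ∂torusMeasure =
      ∫ x, Real.cos (j * x) * Real.sin (k * x) ∂torusMeasure :=
    integral_congr_ae ((coeFn_cosInf j).mul (coeFn_sinInf k))
  rw [h1, h2, integral_cos_mul_cos, integral_cos_mul_sin, zero_smul, sub_zero]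

lemma sinCoef_trigDeriv (j k : ℤ) (g : LOne) : sinCoef j (toOne (trigDeriv k g)) =
    -(((if k = j then π else 0) - if k = -j then π else 0) • cosCoef k g) := by
  rw [trigDeriv_apply, map_sub, map_sub, sinCoef, coefL_toOne_mulConst, coefL_toOne_mulConst]
  have h1 : ∫ x, sinInf j x * cosInf k x ∂torusMeasure =
      ∫ x, Real.sin (j * x) * Real.cos (k * x) ∂torusMeasure :=
    integral_congr_ae ((coeFn_sinInf j).mul (coeFn_cosInf k))
  have h2 : ∫ x, sinInf j x * sinInf k x ∂torusMeasure =
      ∫ x, Real.sin (j * x) * Real.sin (k * x) ∂torusMeasure :=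
    integral_congr_ae ((coeFn_sinInf j).mul (coeFn_sinInf k))
  rw [h1, h2, integral_sin_mul_sin, integral_sin_mul_cos, zero_smul, zero_sub]

lemma cosCoef_neg (k : ℤ) (g : LOne) : cosCoef (-k) g = cosCoef k g := by
  simp only [cosCoef_apply]
  push_cast
  simp only [neg_mul, Real.cos_neg]

lemma sinCoef_neg (k : ℤ) (g : LOne) : sinCoef (-k) g = -sinCoef k g := by
  simp only [sinCoef_apply]
  push_cast
  simp only [neg_mul, Real.sin_neg, neg_smul, integral_neg]

lemma heatWeight_neg (k : ℤ) (t : ℝ) : heatWeight (-k) t = -heatWeight k t := by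
  simp [heatWeight]

/-- Only the modes ±j contribute. The weight and the sine coefficient are both odd in k, so the two
contributions agree and cancel the factor 2π. For j = 0 the modes coincide, but the weight vanishes.
-/
lemma cosCoef_heatD {t : ℝ} (ht : 0 < t) (g : LOne) (j : ℤ) :
    cosCoef j (toOne (heatD t g)) = heatWeight j t • sinCoef j g := by
  have h := hasSum_heatD_apply ((cosCoef j).comp toOne) ht g
  simp only [ContinuousLinearMap.comp_apply, cosCoef_trigDeriv, add_smul, ite_smul, zero_smul,
    smul_add] at h
  have h1 := (hasSum_ite_eq j (((2 * π)⁻¹ * heatWeight j t) • π • sinCoef j g)).add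
    (hasSum_ite_eq (-j) (((2 * π)⁻¹ * heatWeight (-j) t) • π • sinCoef (-j) g))
  rw [h.unique (h1.congr_fun fun k => ?_)]
  · rw [heatWeight_neg, sinCoef_neg, smul_neg, smul_neg, mul_neg, neg_smul, neg_neg, ← two_smul ℝ,
      smul_smul, smul_smul]
    congr 1
    field_simp
  · congr 1 <;> split_ifs with hk
    · rw [hk]
    · simp
    · rw [hk]
    · simp

lemma sinCoef_heatD {t : ℝ} (ht : 0 < t) (g : LOne) (j : ℤ) :
    sinCoef j (toOne (heatD t g)) = -(heatWeight j t • cosCoef j g) := by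
  have h := hasSum_heatD_apply ((sinCoef j).comp toOne) ht g
  simp only [ContinuousLinearMap.comp_apply, sinCoef_trigDeriv, sub_smul, ite_smul, zero_smul,
    neg_sub, smul_sub] at h
  have h1 := (hasSum_ite_eq (-j) (((2 * π)⁻¹ * heatWeight (-j) t) • π • cosCoef (-j) g)).sub
    (hasSum_ite_eq j (((2 * π)⁻¹ * heatWeight j t) • π • cosCoef j g))
  rw [h.unique (h1.congr_fun fun k => ?_)]
  · rw [heatWeight_neg, cosCoef_neg, mul_neg, neg_smul, sub_eq_add_neg, ← neg_add, ← two_smul ℝ,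
      smul_smul, smul_smul]
    congr 2
    field_simp
  · congr 1 <;> split_ifs with hk
    · rw [hk]
    · simp
    · rw [hk]
    · simp

/-- The inequality y^s ≤ 2e^(2y) at y = k²t with s = 7/4. Summability of k^(2-2s) requires s > 3/2,
and integrability of t^(-s/2) at 0 requires s < 2. -/
lemma heatWeight_sq_le (k : ℤ) {t : ℝ} (ht : 0 < t) :
    heatWeight k t ^ 2 ≤ 2 * t ^ (-(7 / 4) : ℝ) * |(k : ℝ)| ^ (-(3 / 2) : ℝ) := by
  rcases eq_or_ne k 0 with rfl | hk
  · simp [heatWeight]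
  have hk' : (0 : ℝ) < |(k : ℝ)| := abs_pos.mpr (by exact_mod_cast hk)
  set y : ℝ := |(k : ℝ)| ^ 2 * t with hy
  have hy0 : 0 < y := by positivity
  have h1 : y ^ (7 / 4 : ℝ) ≤ 2 * Real.exp (2 * y) := by
    have h2 : y ^ (7 / 4 : ℝ) ≤ 1 + y ^ 2 := by
      rcases le_total y 1 with h | h
      · nlinarith [Real.rpow_le_one hy0.le h (show (0 : ℝ) ≤ 7 / 4 by norm_num), sq_nonneg y]
      · have := Real.rpow_le_rpow_of_exponent_le h (show (7 / 4 : ℝ) ≤ 2 by norm_num)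
        rw [Real.rpow_two] at this
        linarith
    have h3 := Real.quadratic_le_exp_of_nonneg hy0.le
    have h4 : Real.exp y ≤ Real.exp (2 * y) := Real.exp_le_exp.mpr (by linarith)
    nlinarith
  have h5 : heatWeight k t ^ 2 = |(k : ℝ)| ^ 2 * (Real.exp (2 * y))⁻¹ := by
    rw [heatWeight, mul_pow, ← Real.exp_nat_mul, ← Real.exp_neg, sq_abs, hy, sq_abs]
    congr 2
    push_cast
    ring
  have h6 : y ^ (7 / 4 : ℝ) = |(k : ℝ)| ^ (7 / 2 : ℝ) * t ^ (7 / 4 : ℝ) := by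
    rw [hy, Real.mul_rpow (by positivity) ht.le, ← Real.rpow_natCast, ← Real.rpow_mul hk'.le]
    norm_num
  have h7 : (Real.exp (2 * y))⁻¹ ≤ 2 * (y ^ (7 / 4 : ℝ))⁻¹ := by
    have := Real.rpow_pos_of_pos hy0 (7 / 4)
    rw [← div_eq_mul_inv, inv_eq_one_div, div_le_div_iff₀ (Real.exp_pos _) this]
    linarith
  rw [h5]
  refine (mul_le_mul_of_nonneg_left h7 (by positivity)).trans (le_of_eq ?_)
  rw [h6, mul_inv, ← Real.rpow_neg hk'.le, ← Real.rpow_neg ht.le,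
    show (-(3 / 2) : ℝ) = 2 + (-(7 / 2)) by norm_num, Real.rpow_add hk', Real.rpow_two]
  ring

/-- The smoothing estimate `‖∂ₓ S(t)‖_{L¹ → L²} ≤ C t^{-7/8}`. -/
lemma exists_norm_heatD_le : ∃ C, 0 ≤ C ∧ ∀ t, 0 < t → ‖heatD t‖ ≤ C * t ^ (-(7 / 8) : ℝ) := by
  have hs : Summable fun k : ℤ => |(k : ℝ)| ^ (-(3 / 2) : ℝ) :=
    Real.summable_abs_int_rpow (by norm_num)
  set S := ∑' k : ℤ, |(k : ℝ)| ^ (-(3 / 2) : ℝ) with hS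
  have hS0 : 0 ≤ S := tsum_nonneg fun k => by positivity
  refine ⟨Real.sqrt (4 * S), Real.sqrt_nonneg _, fun t ht => ?_⟩
  refine ContinuousLinearMap.opNorm_le_bound _ (by positivity) fun g => ?_
  refine abs_le_of_sq_le_sq' ?_ (by positivity) |>.2
  -- Parseval turns the L² norm into a weighted sum over coefficients of g, each of which is at most
  -- ‖g‖.
  have hP := hasSum_sq_coef (heatD t g)
  have hle := hasSum_le (fun k => ?_) hP
    ((hs.hasSum.mul_left (2 * t ^ (-(7 / 4) : ℝ))).mul_right (2 * ‖g‖ ^ 2))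
  · have h2 : (t ^ (-(7 / 8) : ℝ)) ^ 2 = t ^ (-(7 / 4) : ℝ) := by
      rw [← Real.rpow_natCast, ← Real.rpow_mul ht.le]; norm_num
    rw [mul_pow, mul_pow, Real.sq_sqrt (by positivity), h2]
    have hpi := Real.pi_gt_three
    nlinarith [sq_nonneg ‖heatD t g‖]
  · rw [cosCoef_heatD ht, sinCoef_heatD ht, norm_neg, norm_smul, norm_smul, mul_pow, mul_pow,
      ← mul_add, Real.norm_eq_abs, sq_abs]
    refine mul_le_mul (heatWeight_sq_le k ht) ?_ (by positivity) (by positivity)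
    have h1 := pow_le_pow_left₀ (norm_nonneg _) (norm_sinCoef_le k g) 2
    have h2 := pow_le_pow_left₀ (norm_nonneg _) (norm_cosCoef_le k g) 2
    linarith

/-- The majorant of `‖∂ₓ S(t)‖`. -/
def heatBound (t : ℝ) : ℝ := exists_norm_heatD_le.choose * t ^ (-(7 / 8) : ℝ)

lemma isSingularKernel_heatD : IsSingularKernel heatD heatBound where
  continuousOn := continuousOn_heatD
  bound := exists_norm_heatD_le.choose_spec.2
  intervalIntegrable _ := (intervalIntegral.intervalIntegrable_rpow' (by norm_num)).const_mul _

/-! ### Primitives -/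

/-- Cauchy-Schwarz against the constant 1, from ∫ (f - a)² ≥ 0 with a the mean value of f. -/
lemma sq_integral_le {α : Type*} {m : MeasurableSpace α} {ν : Measure α} [IsFiniteMeasure ν]
    {f : α → ℝ} (hf : MemLp f 2 ν) : (∫ x, f x ∂ν) ^ 2 ≤ ν.real univ * ∫ x, f x ^ 2 ∂ν := by
  have hi : Integrable f ν := hf.integrable (by norm_num)
  have h2 : Integrable (fun x => f x ^ 2) ν := hf.integrable_sq
  have h : ∀ a : ℝ, 0 ≤ (∫ x, f x ^ 2 ∂ν) - 2 * a * (∫ x, f x ∂ν) + a ^ 2 * ν.real univ := by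
    intro a
    have : ∫ x, (f x - a) ^ 2 ∂ν
        = (∫ x, f x ^ 2 ∂ν) - 2 * a * (∫ x, f x ∂ν) + a ^ 2 * ν.real univ := by
      have : ∀ x, (f x - a) ^ 2 = f x ^ 2 - 2 * a * f x + a ^ 2 := fun x => by ring
      simp only [this]
      rw [integral_add (f := fun x => f x ^ 2 - 2 * a * f x) (h2.sub (hi.const_mul _))
        (integrable_const _), integral_sub h2 (hi.const_mul _), integral_const_mul, integral_const, smul_eq_mul]
      ring
    rw [← this]
    exact integral_nonneg fun x => sq_nonneg _
  rcases eq_or_lt_of_le (measureReal_nonneg (μ := ν) (s := univ)) with h0 | h0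
  · have : ν = 0 := by
      rw [eq_comm, measureReal_eq_zero_iff] at h0
      exact Measure.measure_univ_eq_zero.mp h0
    simp [this]
  · have := h ((∫ x, f x ∂ν) / ν.real univ)
    have e : (∫ x, f x ^ 2 ∂ν) - 2 * ((∫ x, f x ∂ν) / ν.real univ) * (∫ x, f x ∂ν)
        + ((∫ x, f x ∂ν) / ν.real univ) ^ 2 * ν.real univ
        = (∫ x, f x ^ 2 ∂ν) - (∫ x, f x ∂ν) ^ 2 / ν.real univ := by
      field_simp
      ring
    rw [e, sub_nonneg, div_le_iff₀ h0] at this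
    linarith

lemma torus_intervalIntegrable {F : Type*} [NormedAddCommGroup F] {f : ℝ → F}
    (hf : Integrable f torusMeasure) {a b : ℝ} (ha : a ∈ Icc (-π) π) (hb : b ∈ Icc (-π) π) :
    IntervalIntegrable f volume a b := by
  have h : IntervalIntegrable f volume (-π) π :=
    (intervalIntegrable_iff_integrableOn_Ioc_of_le neg_pi_le_pi).mpr hf
  refine h.mono_set ?_
  rw [uIcc_of_le neg_pi_le_pi]
  exact uIcc_subset_Icc ha hb

lemma ae_mem_Ioc : ∀ᵐ x ∂torusMeasure, x ∈ Ioc (-π) π := ae_restrict_mem measurableSet_Ioc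

/-- `F` is a primitive of the integrable function `f` on `[-π, π]`. -/
structure HasPrim {V : Type*} [NormedAddCommGroup V] [NormedSpace ℝ V] (F f : ℝ → V) : Prop where
  integrable : Integrable f torusMeasure
  eq : ∀ x ∈ Icc (-π) π, F x = F (-π) + ∫ z in (-π)..x, f z

section HasPrim

variable {V : Type*} [NormedAddCommGroup V] [NormedSpace ℝ V] {F f G g : ℝ → V}

lemma HasPrim.intervalIntegrable (h : HasPrim F f) {a b : ℝ} (ha : a ∈ Icc (-π) π)
    (hb : b ∈ Icc (-π) π) : IntervalIntegrable f volume a b :=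
  torus_intervalIntegrable h.integrable ha hb

lemma neg_pi_mem : (-π : ℝ) ∈ Icc (-π) π := ⟨le_rfl, neg_pi_le_pi⟩

lemma pi_mem : (π : ℝ) ∈ Icc (-π) π := ⟨neg_pi_le_pi, le_rfl⟩

lemma HasPrim.integral_eq (h : HasPrim F f) : ∫ x, f x ∂torusMeasure = F π - F (-π) := by
  rw [integral_torusMeasure, h.eq π pi_mem, add_sub_cancel_left]

lemma HasPrim.continuousOn (h : HasPrim F f) : ContinuousOn F (Icc (-π) π) := by
  refine ContinuousOn.congr ?_ h.eq
  refine continuousOn_const.add ?_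
  have := intervalIntegral.continuousOn_primitive_interval (μ := volume) (f := f) (a := -π)
    (b := π) ?_
  · rwa [uIcc_of_le neg_pi_le_pi] at this
  · rw [uIcc_of_le neg_pi_le_pi, integrableOn_Icc_iff_integrableOn_Ioc]
    exact h.integrable

lemma HasPrim.aestronglyMeasurable (h : HasPrim F f) : AEStronglyMeasurable F torusMeasure :=
  (h.continuousOn.mono Ioc_subset_Icc_self).aestronglyMeasurable measurableSet_Ioc

lemma HasPrim.exists_bound (h : HasPrim F f) : ∃ C, ∀ x ∈ Icc (-π) π, ‖F x‖ ≤ C :=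
  isCompact_Icc.exists_bound_of_continuousOn h.continuousOn

lemma HasPrim.memLp_top (h : HasPrim F f) : MemLp F ∞ torusMeasure := by
  obtain ⟨C, hC⟩ := h.exists_bound
  refine memLp_top_of_bound h.aestronglyMeasurable C ?_
  filter_upwards [ae_mem_Ioc] with x hx using hC x (Ioc_subset_Icc_self hx)

lemma HasPrim.congr_ae (h : HasPrim F f) (hfg : f =ᵐ[torusMeasure] g) : HasPrim F g where
  integrable := h.integrable.congr hfg
  eq x hx := by
    rw [h.eq x hx]
    congr 1
    refine intervalIntegral.integral_congr_ae ?_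
    have := (ae_restrict_iff' measurableSet_Ioc).mp (show ∀ᵐ z ∂volume.restrict (Ioc (-π) π),
      f z = g z from hfg)
    filter_upwards [this] with z hz hzx
    rw [uIoc_of_le hx.1] at hzx
    exact hz ⟨hzx.1, hzx.2.trans hx.2⟩

lemma HasPrim.congr (h : HasPrim F f) (hFG : ∀ x ∈ Icc (-π) π, G x = F x) : HasPrim G f where
  integrable := h.integrable
  eq x hx := by rw [hFG x hx, hFG _ neg_pi_mem, h.eq x hx]

lemma HasPrim.add (h₁ : HasPrim F f) (h₂ : HasPrim G g) :
    HasPrim (fun x => F x + G x) (fun x => f x + g x) where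
  integrable := h₁.integrable.add h₂.integrable
  eq x hx := by
    rw [intervalIntegral.integral_add (h₁.intervalIntegrable neg_pi_mem hx)
      (h₂.intervalIntegrable neg_pi_mem hx), h₁.eq x hx, h₂.eq x hx]
    abel

lemma HasPrim.const (c : V) : HasPrim (fun _ => c) (fun _ => (0 : V)) where
  integrable := integrable_zero _ _ _
  eq x hx := by simp

lemma HasPrim.clm_comp [CompleteSpace V] {W : Type*} [NormedAddCommGroup W] [NormedSpace ℝ W]
    [CompleteSpace W] (ℓ : V →L[ℝ] W) (h : HasPrim F f) :
    HasPrim (fun x => ℓ (F x)) (fun x => ℓ (f x)) where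
  integrable := ℓ.integrable_comp h.integrable
  eq x hx := by
    rw [ℓ.intervalIntegral_comp_comm (h.intervalIntegrable neg_pi_mem hx), ← map_add, ← h.eq x hx]

lemma HasPrim.of_hasDerivAt [CompleteSpace V] (hF : ∀ x, HasDerivAt F (f x) x)
    (hf : Continuous f) : HasPrim F f where
  integrable := integrable_of_continuous_torus hf
  eq x _ := by
    rw [intervalIntegral.integral_eq_sub_of_hasDerivAt (fun x _ => hF x)
      (hf.intervalIntegrable _ _), add_sub_cancel]

end HasPrim

/-- Integration by parts in differential form. -/
lemma HasPrim.mul {F f G g : ℝ → ℝ} (h₁ : HasPrim F f) (h₂ : HasPrim G g) :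
    HasPrim (fun x => F x * G x) (fun x => f x * G x + F x * g x) where
  integrable := (h₁.integrable.mul_of_top_left h₂.memLp_top).add
    (h₂.integrable.mul_of_top_right h₁.memLp_top)
  eq x hx := by
    -- F and G are primitives only on [-π, π]. The integrals F' and G' agree with them there and are
    -- absolutely continuous, which gives the product rule.
    set F' : ℝ → ℝ := fun x => F (-π) + ∫ z in (-π)..x, f z
    set G' : ℝ → ℝ := fun x => G (-π) + ∫ z in (-π)..x, g z
    have hc : ∀ c : ℝ, AbsolutelyContinuousOnInterval (fun _ : ℝ => c) (-π) x := fun c =>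
      (LipschitzWith.const c).lipschitzOnWith.absolutelyContinuousOnInterval
    have hF' : AbsolutelyContinuousOnInterval F' (-π) x :=
      (hc _).fun_add ((h₁.intervalIntegrable neg_pi_mem
        hx).absolutelyContinuousOnInterval_intervalIntegral left_mem_uIcc)
    have hG' : AbsolutelyContinuousOnInterval G' (-π) x :=
      (hc _).fun_add ((h₂.intervalIntegrable neg_pi_mem
        hx).absolutelyContinuousOnInterval_intervalIntegral left_mem_uIcc)
    have h := hF'.integral_deriv_mul_eq_sub hG'
    have hx0 : F' (-π) = F (-π) ∧ G' (-π) = G (-π) := by simp [F', G']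
    rw [hx0.1, hx0.2, ← show F x = F' x from h₁.eq x hx, ← show G x = G' x from h₂.eq x hx] at h
    rw [← sub_eq_iff_eq_add', ← h]
    refine intervalIntegral.integral_congr_ae ?_
    filter_upwards [(h₁.intervalIntegrable neg_pi_mem hx).ae_hasDerivAt_integral,
      (h₂.intervalIntegrable neg_pi_mem hx).ae_hasDerivAt_integral] with z hz₁ hz₂ hz
    have hz' : z ∈ uIcc (-π) x := uIoc_subset_uIcc hz
    have hzI : z ∈ Icc (-π) π := uIcc_subset_Icc neg_pi_mem hx hz'
    have d₁ : HasDerivAt F' (f z) z := (hz₁ hz' (-π) left_mem_uIcc).const_add _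
    have d₂ : HasDerivAt G' (g z) z := (hz₂ hz' (-π) left_mem_uIcc).const_add _
    rw [d₁.deriv, d₂.deriv, ← show F z = F' z from h₁.eq z hzI, ← show G z = G' z from h₂.eq z hzI]

lemma HasPrim.of_apply {F f : ℝ → E3} (hf : Integrable f torusMeasure)
    (h : ∀ i, HasPrim (fun x => F x i) (fun x => f x i)) : HasPrim F f where
  integrable := hf
  eq x hx := by
    ext i
    rw [PiLp.add_apply, (h i).eq x hx]
    congr 1
    exact (EuclideanSpace.proj i : E3 →L[ℝ] ℝ).intervalIntegral_comp_comm
      (torus_intervalIntegrable hf neg_pi_mem hx)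

lemma HasPrim.apply {F f : ℝ → E3} (h : HasPrim F f) (i : Fin 3) :
    HasPrim (fun x => F x i) (fun x => f x i) :=
  h.clm_comp (EuclideanSpace.proj i : E3 →L[ℝ] ℝ)

lemma HasPrim.smul {F f : ℝ → ℝ} {G g : ℝ → E3} (h₁ : HasPrim F f) (h₂ : HasPrim G g) :
    HasPrim (fun x => F x • G x) (fun x => f x • G x + F x • g x) :=
  HasPrim.of_apply ((h₁.integrable.smul_of_top_left h₂.memLp_top).add
    (h₂.integrable.smul_of_top_right h₁.memLp_top)) fun i => by
      simpa using h₁.mul (h₂.apply i)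

lemma HasPrim.inner {F f G g : ℝ → E3} (h₁ : HasPrim F f) (h₂ : HasPrim G g) :
    HasPrim (fun x => inner ℝ (F x) (G x))
      (fun x => inner ℝ (f x) (G x) + inner ℝ (F x) (g x)) := by
  have h : ∀ a b : E3, (Inner.inner ℝ a b : ℝ) = a 0 * b 0 + a 1 * b 1 + a 2 * b 2 := fun a b => by
    rw [PiLp.inner_apply, Fin.sum_univ_three]
    simp only [RCLike.inner_apply, conj_trivial]
    ring
  simp only [h]
  have := (((h₁.apply 0).mul (h₂.apply 0)).add ((h₁.apply 1).mul (h₂.apply 1))).add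
    ((h₁.apply 2).mul (h₂.apply 2))
  convert! this using 2
  ring

/-! ### Mean-zero primitives as bounded operators on L¹ -/

section Primitive

variable {f g : ℝ → E3}

lemma primitive_sub {a b : ℝ} (ha : IntervalIntegrable f volume (-π) a)
    (hb : IntervalIntegrable f volume (-π) b) :
    primitive f b - primitive f a = ∫ z in a..b, f z := by
  rw [primitive, primitive, add_sub_add_left_eq_sub]
  exact intervalIntegral.integral_interval_sub_left hb ha

lemma primitive_congr_ae (h : f =ᵐ[torusMeasure] g) {x : ℝ} (hx : x ∈ Icc (-π) π) :
    primitive f x = primitive g x := by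
  unfold primitive mean
  congr 1
  · congr 1
    rw [← integral_torusMeasure, ← integral_torusMeasure]
    refine integral_congr_ae ?_
    filter_upwards [h] with z hz
    rw [hz]
  · refine intervalIntegral.integral_congr_ae ?_
    have := (ae_restrict_iff' measurableSet_Ioc).mp (show ∀ᵐ z ∂volume.restrict (Ioc (-π) π),
      f z = g z from h)
    filter_upwards [this] with z hz hzx
    rw [uIoc_of_le hx.1] at hzx
    exact hz ⟨hzx.1, hzx.2.trans hx.2⟩

/-- Multiplication by `z - π`, as an element of `L^∞`. -/
def shiftInf : Lp ℝ ∞ torusMeasure :=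
  (memLp_top_of_bound (μ := torusMeasure) (f := fun z : ℝ => z - π) (by fun_prop) (2 * π) (by
    filter_upwards [ae_mem_Ioc] with z hz
    rw [Real.norm_eq_abs, abs_le]
    constructor <;> linarith [hz.1, hz.2, Real.pi_pos])).toLp

/-- The indicator function of `(-π, x]`. -/
def indicatorInf (x : ℝ) : Lp ℝ ∞ torusMeasure :=
  (memLp_top_of_bound (μ := torusMeasure) (f := (Ioc (-π) x).indicator fun _ => (1 : ℝ))
    (aestronglyMeasurable_const.indicator measurableSet_Ioc) 1
    (Eventually.of_forall fun z => (norm_indicator_le_norm_self _ _).trans (by simp))).toLp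

lemma coeFn_shiftInf : shiftInf =ᵐ[torusMeasure] fun z => z - π := MemLp.coeFn_toLp _

lemma coeFn_indicatorInf (x : ℝ) :
    indicatorInf x =ᵐ[torusMeasure] (Ioc (-π) x).indicator fun _ => (1 : ℝ) := MemLp.coeFn_toLp _

/-- Evaluation of the mean zero primitive at a point of `[-π, π]`. -/
def primEval (x : ℝ) : LOne →L[ℝ] E3 := (2 * π)⁻¹ • coefL shiftInf + coefL (indicatorInf x)

lemma primEval_apply (f : LOne) {x : ℝ} (hx : x ∈ Icc (-π) π) : primEval x f = primitive f x := by
  change (2 * π)⁻¹ • coefL shiftInf f + coefL (indicatorInf x) f = _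
  rw [primitive, mean, ← integral_torusMeasure, coefL_apply, coefL_apply]
  congr 1
  · congr 1
    refine integral_congr_ae ?_
    filter_upwards [coeFn_shiftInf] with z hz
    rw [hz]
  · have h : (fun z => indicatorInf x z • f z) =ᵐ[torusMeasure] (Ioc (-π) x).indicator f := by
      filter_upwards [coeFn_indicatorInf x] with z hz
      rw [hz]
      by_cases h : z ∈ Ioc (-π) x <;> simp [h]
    have hr : torusMeasure.restrict (Ioc (-π) x) = volume.restrict (Ioc (-π) x) := by
      rw [torusMeasure, Measure.restrict_restrict measurableSet_Ioc,
        inter_eq_self_of_subset_left (Ioc_subset_Ioc_right hx.2)]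
    rw [integral_congr_ae h, integral_indicator measurableSet_Ioc, hr,
      intervalIntegral.integral_of_le hx.1]

lemma exists_norm_primEval_le : ∃ C, 0 ≤ C ∧ ∀ x (f : LOne), ‖primEval x f‖ ≤ C * ‖f‖ := by
  refine ⟨‖(2 * π)⁻¹ • coefL shiftInf‖ + 1, by positivity, fun x f => ?_⟩
  rw [add_mul, one_mul]
  refine (norm_add_le _ _).trans (add_le_add (ContinuousLinearMap.le_opNorm _ _) ?_)
  refine norm_coefL_le _ ?_ f
  exact norm_toLp_top_le _ fun z => (norm_indicator_le_norm_self (f := fun _ => (1 : ℝ)) z).trans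
    (by simp)

lemma hasPrim_primitive (hf : Integrable f torusMeasure) : HasPrim (primitive f) f where
  integrable := hf
  eq x hx := by simp [primitive]

lemma memLp_top_primitive (f : LOne) : MemLp (primitive f) ∞ torusMeasure :=
  (hasPrim_primitive (LOne.integrable f)).memLp_top

/-- The mean zero primitive, as an operator from `L¹` to `L^∞`. -/
def primInf : LOne →L[ℝ] LInf :=
  LinearMap.mkContinuous
    { toFun := fun f => (memLp_top_primitive f).toLp
      map_add' := fun f g => by
        rw [← MemLp.toLp_add, MemLp.toLp_eq_toLp_iff]
        filter_upwards [ae_mem_Ioc] with x hx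
        have hx' := Ioc_subset_Icc_self hx
        rw [Pi.add_apply, ← primEval_apply _ hx', ← primEval_apply _ hx', ← primEval_apply _ hx',
          map_add]
      map_smul' := fun c f => by
        rw [RingHom.id_apply, ← MemLp.toLp_const_smul, MemLp.toLp_eq_toLp_iff]
        filter_upwards [ae_mem_Ioc] with x hx
        have hx' := Ioc_subset_Icc_self hx
        rw [Pi.smul_apply, ← primEval_apply _ hx', ← primEval_apply _ hx', map_smul] }
    exists_norm_primEval_le.choose fun f => by
      obtain ⟨h0, hC⟩ := exists_norm_primEval_le.choose_spec
      change ‖(memLp_top_primitive f).toLp‖ ≤ _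
      rw [Lp.norm_toLp]
      refine ENNReal.toReal_le_of_le_ofReal (by positivity) ?_
      rw [eLpNorm_exponent_top]
      refine eLpNormEssSup_le_of_ae_bound ?_
      filter_upwards [ae_mem_Ioc] with x hx
      rw [← primEval_apply f (Ioc_subset_Icc_self hx)]
      exact hC x f

lemma coeFn_primInf (f : LOne) : primInf f =ᵐ[torusMeasure] primitive f :=
  MemLp.coeFn_toLp (memLp_top_primitive f)

/-- Integration by parts against x - π: the factor vanishes at π, and the boundary term at -π is
cancelled by the constant `mean (fun z => (z - π) • f z)`. -/
lemma mean_primitive (hf : Integrable f torusMeasure) : mean (primitive f) = 0 := by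
  have hP := hasPrim_primitive hf
  have h1 : HasPrim (fun x : ℝ => x - π) (fun _ => 1) :=
    HasPrim.of_hasDerivAt (fun x => (hasDerivAt_id x).sub_const π) continuous_const
  have h := (h1.smul hP).integral_eq
  have hi1 : Integrable (primitive f) torusMeasure := hP.memLp_top.integrable le_top
  have hi2 : Integrable (fun x => (x - π) • f x) torusMeasure :=
    hf.smul_of_top_right h1.memLp_top
  simp only [one_smul] at h
  rw [integral_add hi1 hi2, sub_self, zero_smul, zero_sub, primitive, mean, integral_torusMeasure,
    integral_torusMeasure, intervalIntegral.integral_same, add_zero, smul_smul,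
    ← neg_smul, show -((-π - π) * (2 * π)⁻¹) = 1 by field_simp; ring, one_smul,
    add_eq_right] at h
  rw [mean, h, smul_zero]

end Primitive

/-! ### `H¹` fields and their derivatives -/

lemma mean_eq_cosCoef (g : LOne) : mean g = (2 * π)⁻¹ • cosCoef 0 g := by
  rw [mean, cosCoef_apply, integral_torusMeasure]
  simp

lemma mean_congr_ae {F : Type*} [NormedAddCommGroup F] [NormedSpace ℝ F] {f g : ℝ → F}
    (h : f =ᵐ[torusMeasure] g) : mean f = mean g := by
  rw [mean, mean, ← integral_torusMeasure, ← integral_torusMeasure, integral_congr_ae h]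

/-- The mean value of an integrable field. -/
def meanL : LOne →L[ℝ] E3 := (2 * π)⁻¹ • cosCoef 0

lemma meanL_apply (g : LOne) : meanL g = mean g := (mean_eq_cosCoef g).symm

/-- The projection of `L²` to mean zero fields. -/
def centre : LTwo →L[ℝ] LTwo :=
  ContinuousLinearMap.id ℝ LTwo - (Lp.constL 2 torusMeasure ℝ).comp (meanL.comp toOne)

lemma centre_apply (v : LTwo) :
    centre v = v - Lp.const 2 torusMeasure (mean v) := by
  have : mean v = meanL (toOne v) := by
    rw [meanL_apply]; exact mean_congr_ae (coeFn_toOne v).symm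
  rw [this]
  rfl

lemma coeFn_centre (v : LTwo) : centre v =ᵐ[torusMeasure] fun x => v x - mean v := by
  rw [centre_apply]
  filter_upwards [Lp.coeFn_sub v (Lp.const 2 torusMeasure (mean v)),
    Lp.coeFn_const (p := 2) (μ := torusMeasure) (mean v)] with x h1 h2
  rw [h1, Pi.sub_apply, h2]
  rfl

lemma centre_eq_self {v : LTwo} (hv : mean v = 0) : centre v = v := by
  rw [centre_apply, hv]
  simp

lemma integral_centre (v : LTwo) : ∫ x in (-π)..π, centre v x = 0 := by
  rw [← integral_torusMeasure, integral_congr_ae (coeFn_centre v),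
    integral_sub (LTwo.integrable v) (integrable_const _), integral_const, torusMeasure_real_univ,
    mean, integral_torusMeasure, smul_smul, mul_inv_cancel₀ (by positivity), one_smul, sub_self]

/-- The periodic extension of a field on the torus. -/
def perExt {V : Type*} (w : ℝ → V) (y : ℝ) : V := w (toIocMod Real.two_pi_pos (-π) y)

/-! ### Periodic extension from the fundamental domain -/

section perExt

variable {V : Type*} {w : ℝ → V}

lemma perExt_periodic (w : ℝ → V) : Function.Periodic (perExt w) (2 * π) := fun y => by
  rw [perExt, perExt, toIocMod_add_right]

lemma toIocMod_eq_self_of_mem {y : ℝ} (hy : y ∈ Ioc (-π) π) :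
    toIocMod Real.two_pi_pos (-π) y = y := by
  rw [toIocMod_eq_self]
  exact ⟨hy.1, by linarith [hy.2]⟩

lemma perExt_eq {y : ℝ} (hy : y ∈ Ioc (-π) π) : perExt w y = w y := by
  rw [perExt, toIocMod_eq_self_of_mem hy]

lemma toIocMod_mem_torus (y : ℝ) : toIocMod Real.two_pi_pos (-π) y ∈ Ioc (-π) π := by
  have := toIocMod_mem_Ioc Real.two_pi_pos (-π) y
  exact ⟨this.1, by linarith [this.2]⟩

lemma _root_.Function.Periodic.apply_toIocMod {f : ℝ → V} (hf : Function.Periodic f (2 * π))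
    (y : ℝ) : f (toIocMod Real.two_pi_pos (-π) y) = f y := by
  rw [toIocMod, hf.sub_zsmul_eq]

lemma perExt_ae_eq (w : ℝ → V) : perExt w =ᵐ[torusMeasure] w := by
  filter_upwards [ae_mem_Ioc] with y hy using perExt_eq hy

variable [NormedAddCommGroup V]

lemma _root_.Function.Periodic.intervalIntegrable_torus {f : ℝ → V}
    (hf : Function.Periodic f (2 * π)) (hi : Integrable f torusMeasure) (a b : ℝ) :
    IntervalIntegrable f volume a b := by
  refine hf.intervalIntegrable (t := -π) (by positivity) ?_ a b
  rw [show -π + 2 * π = π by ring]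
  exact torus_intervalIntegrable hi neg_pi_mem pi_mem

lemma perExt_intervalIntegrable (hw : Integrable w torusMeasure) (a b : ℝ) :
    IntervalIntegrable (perExt w) volume a b :=
  (perExt_periodic w).intervalIntegrable_torus (hw.congr (perExt_ae_eq w).symm) a b

lemma perExt_locallyIntegrable (hw : Integrable w torusMeasure) :
    LocallyIntegrable (perExt w) volume := by
  intro x
  refine ⟨Ioc (x - 1) (x + 1), Filter.mem_of_superset (Ioo_mem_nhds (by linarith) (by linarith))
    Ioo_subset_Ioc_self, ?_⟩
  exact (intervalIntegrable_iff_integrableOn_Ioc_of_le (by linarith)).mp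
    (perExt_intervalIntegrable hw _ _)

lemma _root_.Function.Periodic.integral_period [NormedSpace ℝ V] {f : ℝ → V}
    (hf : Function.Periodic f (2 * π)) (a : ℝ) :
    ∫ x in a..a + 2 * π, f x = ∫ x, f x ∂torusMeasure := by
  rw [hf.intervalIntegral_add_eq a (-π), integral_torusMeasure, show -π + 2 * π = π by ring]

end perExt

/-- The mean zero primitive of (the mean zero part of) `v`, a periodic function. -/
def antideriv (v : LTwo) : ℝ → E3 := primitive (perExt (centre v))

lemma antideriv_sub_eq (v : LTwo) (a b : ℝ) :
    antideriv v b - antideriv v a = ∫ z in a..b, perExt (centre v) z :=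
  primitive_sub (perExt_intervalIntegrable (LTwo.integrable _) _ _)
    (perExt_intervalIntegrable (LTwo.integrable _) _ _)

/-- True for every v because `centre` removes the mean first. All of L² can thus serve as phase
space, without passing to a subspace. -/
lemma antideriv_periodic (v : LTwo) : Function.Periodic (antideriv v) (2 * π) := fun x => by
  rw [← sub_eq_zero, antideriv_sub_eq, (perExt_periodic _).integral_period,
    integral_congr_ae (perExt_ae_eq _), integral_torusMeasure, integral_centre]

/-- Evaluation of `antideriv`. -/
def antiEval (x : ℝ) : LTwo →L[ℝ] E3 :=
  (primEval (toIocMod Real.two_pi_pos (-π) x)).comp (toOne.comp centre)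

lemma antideriv_eq_primitive (v : LTwo) {x : ℝ} (hx : x ∈ Icc (-π) π) :
    antideriv v x = primitive (toOne (centre v)) x :=
  primitive_congr_ae ((perExt_ae_eq _).trans (coeFn_toOne _).symm) hx

/-- Point evaluation of the primitive is bounded and linear in v, so it commutes with series and
with Volterra integrals. -/
lemma antiEval_apply (x : ℝ) (v : LTwo) : antiEval x v = antideriv v x := by
  rw [← (antideriv_periodic v).apply_toIocMod x, antideriv_eq_primitive v
    (Ioc_subset_Icc_self (toIocMod_mem_torus x)), ← primEval_apply _
    (Ioc_subset_Icc_self (toIocMod_mem_torus x))]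
  rfl

lemma antideriv_sub (v w : LTwo) (x : ℝ) :
    antideriv (v - w) x = antideriv v x - antideriv w x := by
  simp only [← antiEval_apply, map_sub]

lemma exists_norm_antideriv_le : ∃ C, 0 ≤ C ∧ ∀ v x, ‖antideriv v x‖ ≤ C * ‖v‖ := by
  obtain ⟨C, hC0, hC⟩ := exists_norm_primEval_le
  refine ⟨C * ‖toOne.comp centre‖, by positivity, fun v x => ?_⟩
  rw [← antiEval_apply, mul_assoc]
  exact (hC _ _).trans (mul_le_mul_of_nonneg_left (ContinuousLinearMap.le_opNorm _ _) hC0)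

lemma continuous_antideriv (v : LTwo) : Continuous (antideriv v) := by
  refine Continuous.add continuous_const ?_
  exact intervalIntegral.continuous_primitive (perExt_intervalIntegrable (LTwo.integrable _)) _

lemma mean_antideriv (v : LTwo) : mean (antideriv v) = 0 :=
  mean_primitive ((LTwo.integrable _).congr (perExt_ae_eq _).symm)

lemma hasPrim_antideriv (v : LTwo) : HasPrim (antideriv v) (centre v) :=
  (hasPrim_primitive ((LTwo.integrable _).congr (perExt_ae_eq _).symm)).congr_ae (perExt_ae_eq _)

lemma ae_hasDerivAt_antideriv (v : LTwo) :
    ∀ᵐ x ∂torusMeasure, HasDerivAt (antideriv v) (centre v x) x := by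
  have h : ∀ᵐ x ∂torusMeasure, ∀ c, HasDerivAt (fun x => ∫ t in c..x, perExt (centre v) t)
      (perExt (centre v) x) x :=
    ae_restrict_of_ae (_root_.LocallyIntegrable.ae_hasDerivAt_integral
      (perExt_locallyIntegrable (LTwo.integrable _)))
  filter_upwards [h, ae_mem_Ioc] with x hx hmem
  rw [perExt_eq hmem] at hx
  exact (hx (-π)).const_add _

/-- `antideriv` as an operator from `L²` to `L^∞`. -/
def antiInf : LTwo →L[ℝ] LInf := primInf.comp (toOne.comp centre)

lemma coeFn_antiInf (v : LTwo) : antiInf v =ᵐ[torusMeasure] antideriv v := by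
  have h : antiInf v =ᵐ[torusMeasure] primitive (toOne (centre v)) := coeFn_primInf _
  filter_upwards [h, ae_mem_Ioc] with x hx hmem
  rw [hx, antideriv_eq_primitive v (Ioc_subset_Icc_self hmem)]

lemma integral_sq_perExt (w : LTwo) (a : ℝ) :
    ∫ x in a..a + 2 * π, ‖perExt w x‖ ^ 2 = ‖w‖ ^ 2 := by
  rw [LTwo.norm_sq_eq]
  have : Function.Periodic (fun x => ‖perExt w x‖ ^ 2) (2 * π) := fun x => by
    simp only [perExt_periodic (w : ℝ → E3) x]
  rw [this.integral_period]
  refine integral_congr_ae ?_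
  filter_upwards [perExt_ae_eq (w : ℝ → E3)] with x hx
  rw [hx]

lemma integrable_sq_perExt (w : LTwo) (a b : ℝ) :
    IntervalIntegrable (fun x => ‖perExt w x‖ ^ 2) volume a b := by
  refine perExt_intervalIntegrable (w := fun x => ‖w x‖ ^ 2) ?_ a b
  exact (Lp.memLp w).integrable_norm_pow (by norm_num)

lemma memLp_perExt (w : LTwo) {a b : ℝ} (hab : a ≤ b) :
    MemLp (perExt w) 2 (volume.restrict (Ioc a b)) := by
  have h1 := (perExt_intervalIntegrable (LTwo.integrable w) a b)
  have h2 := (integrable_sq_perExt w a b)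
  rw [intervalIntegrable_iff_integrableOn_Ioc_of_le hab] at h1 h2
  exact (memLp_two_iff_integrable_sq_norm h1.aestronglyMeasurable).mpr h2

lemma sq_integral_norm_perExt_le (w : LTwo) {a b : ℝ} (hab : a ≤ b) (hb : b ≤ a + 2 * π) :
    (∫ x in a..b, ‖perExt w x‖) ^ 2 ≤ (b - a) * ‖w‖ ^ 2 := by
  rw [intervalIntegral.integral_of_le hab]
  refine (sq_integral_le (memLp_perExt w hab).norm).trans ?_
  rw [measureReal_restrict_apply_univ, Real.volume_real_Ioc_of_le hab]
  refine mul_le_mul_of_nonneg_left ?_ (by linarith)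
  rw [← integral_sq_perExt w a, intervalIntegral.integral_of_le (by linarith)]
  refine setIntegral_mono_set ?_ (Eventually.of_forall fun x => by positivity)
    (Ioc_subset_Ioc_right hb).eventuallyLE
  exact (intervalIntegrable_iff_integrableOn_Ioc_of_le (by linarith)).mp (integrable_sq_perExt w _ _)

lemma norm_centre_le (v : LTwo) : ‖centre v‖ ≤ ‖(centre : LTwo →L[ℝ] LTwo)‖ * ‖v‖ :=
  ContinuousLinearMap.le_opNorm _ _

/-- The Hölder constant of `antideriv v` is controlled by `‖v‖`. -/
def holderConst : ℝ := ‖(centre : LTwo →L[ℝ] LTwo)‖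

lemma holderConst_nonneg : 0 ≤ holderConst := norm_nonneg _

/-- The embedding of H¹ in the Hölder space of exponent 1/2: Cauchy-Schwarz on an arc that winds
around at most once. -/
lemma norm_antideriv_sub_le (v : LTwo) {x y : ℝ} (hxy : |x - y| ≤ 2 * π) :
    ‖antideriv v x - antideriv v y‖ ≤ holderConst * ‖v‖ * √|x - y| := by
  wlog h : y ≤ x generalizing x y
  · rw [norm_sub_rev, abs_sub_comm]
    exact this (by rwa [abs_sub_comm]) (le_of_not_ge h)
  rw [abs_of_nonneg (sub_nonneg.mpr h)] at hxy ⊢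
  rw [antideriv_sub_eq]
  refine (intervalIntegral.norm_integral_le_integral_norm h).trans ?_
  refine abs_le_of_sq_le_sq' ?_ (by have := holderConst_nonneg; positivity) |>.2
  refine (sq_integral_norm_perExt_le (centre v) h (by linarith)).trans ?_
  rw [mul_pow, Real.sq_sqrt (sub_nonneg.mpr h), mul_comm]
  exact mul_le_mul_of_nonneg_right (pow_le_pow_left₀ (norm_nonneg _) (norm_centre_le v) 2)
    (sub_nonneg.mpr h)

/-! ### `MemH1` -/

open Classical in
/-- The derivative of an `H¹` field as an element of `L²`. -/
def derivTwo (τ : ℝ → E3) : LTwo :=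
  if h : MemLp (deriv τ) 2 torusMeasure then h.toLp else 0

/-- Both functions are primitives of the same w on one period, so they differ by a constant, which
vanishes because both means do. -/
lemma MemH1.exists_antideriv {τ : ℝ → E3} (h : MemH1 τ) (hm : mean τ = 0) :
    ∃ v : LTwo, mean v = 0 ∧ ∀ x, τ x = antideriv v x := by
  obtain ⟨hper, w, hw, heq⟩ := h
  have hwi : Integrable w torusMeasure := hw.integrable (by norm_num)
  have hτ : HasPrim τ w := ⟨hwi, heq⟩
  have hw' : hw.toLp =ᵐ[torusMeasure] w := hw.coeFn_toLp
  have h0 : mean w = 0 := by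
    rw [mean, ← integral_torusMeasure, hτ.integral_eq, show π = -π + 2 * π by ring, hper,
      show -(-π + 2 * π) = -π by ring, sub_self, smul_zero]
  have hm0 : mean hw.toLp = 0 := by rw [mean_congr_ae hw', h0]
  refine ⟨hw.toLp, hm0, fun x => ?_⟩
  rw [← hper.apply_toIocMod, ← (antideriv_periodic _).apply_toIocMod x]
  set y := toIocMod Real.two_pi_pos (-π) x
  have hy : y ∈ Icc (-π) π := Ioc_subset_Icc_self (toIocMod_mem_torus x)
  have hA : HasPrim (antideriv hw.toLp) w := by
    refine (hasPrim_antideriv _).congr_ae ?_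
    rw [centre_eq_self hm0]
    exact hw'
  have hconst : ∀ z ∈ Icc (-π) π, τ z = antideriv hw.toLp z + (τ (-π) - antideriv hw.toLp (-π)) :=
    fun z hz => by rw [hτ.eq z hz, hA.eq z hz]; abel
  have hc : τ (-π) - antideriv hw.toLp (-π) = 0 := by
    have h1 : mean τ = mean (antideriv hw.toLp) + (τ (-π) - antideriv hw.toLp (-π)) := by
      rw [mean, mean, intervalIntegral.integral_congr (g := fun z => antideriv hw.toLp z +
        (τ (-π) - antideriv hw.toLp (-π))) (fun z hz => hconst z (by
          rwa [uIcc_of_le neg_pi_le_pi] at hz)), intervalIntegral.integral_add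
        ((continuous_antideriv _).intervalIntegrable _ _) _root_.intervalIntegrable_const,
        intervalIntegral.integral_const, smul_add, smul_smul,
        show (2 * π)⁻¹ * (π - -π) = 1 by field_simp; ring, one_smul]
    rw [hm, mean_antideriv, zero_add] at h1
    exact h1.symm
  rw [hconst y hy, hc, add_zero]

/-- By Lebesgue differentiation the pointwise derivative is `centre v` almost everywhere, so the
default branch of `derivTwo` is not taken. -/
lemma derivTwo_antideriv (v : LTwo) : derivTwo (antideriv v) = centre v := by
  have h : deriv (antideriv v) =ᵐ[torusMeasure] centre v := by
    filter_upwards [ae_hasDerivAt_antideriv v] with x hx using hx.deriv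
  have hm : MemLp (deriv (antideriv v)) 2 torusMeasure := (memLp_congr_ae h).mpr (Lp.memLp _)
  rw [derivTwo, dif_pos hm]
  exact Lp.ext (hm.coeFn_toLp.trans h)

lemma MemH1.antideriv_derivTwo {τ : ℝ → E3} (h : MemH1 τ) (hm : mean τ = 0) :
    antideriv (derivTwo τ) = τ := by
  obtain ⟨v, hv0, hv⟩ := h.exists_antideriv hm
  rw [funext hv, derivTwo_antideriv, centre_eq_self hv0]

lemma MemH1.mean_derivTwo {τ : ℝ → E3} (h : MemH1 τ) (hm : mean τ = 0) :
    mean (derivTwo τ) = 0 := by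
  obtain ⟨v, hv0, hv⟩ := h.exists_antideriv hm
  rw [funext hv, derivTwo_antideriv, centre_eq_self hv0, hv0]

lemma memH1_antideriv (v : LTwo) : MemH1 (antideriv v) :=
  ⟨antideriv_periodic v, centre v, Lp.memLp _, (hasPrim_antideriv v).eq⟩

/-- The mean term vanishes, so convergence of mean-zero fields in H¹ is convergence of their
derivatives in L². -/
lemma h1norm_antideriv (v : LTwo) : h1norm (antideriv v) = √((2 * π)⁻¹) * ‖centre v‖ := by
  have : mean (fun x => ‖deriv (antideriv v) x‖ ^ 2) = (2 * π)⁻¹ * ‖centre v‖ ^ 2 := by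
    rw [mean, LTwo.norm_sq_eq, ← integral_torusMeasure, smul_eq_mul]
    congr 1
    refine integral_congr_ae ?_
    filter_upwards [ae_hasDerivAt_antideriv v] with x hx
    rw [hx.deriv]
  rw [h1norm, mean_antideriv, this, norm_zero, zero_pow two_ne_zero, zero_add,
    Real.sqrt_mul (by positivity), Real.sqrt_sq (norm_nonneg _)]

lemma h1norm_antideriv_sub (v w : LTwo) :
    h1norm (antideriv v - antideriv w) = √((2 * π)⁻¹) * ‖centre v - centre w‖ := by
  rw [← map_sub, ← h1norm_antideriv]
  congr 1
  ext1 x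
  rw [antideriv_sub]
  rfl

/-! ### The heat semigroup in terms of `heatD` -/

lemma antideriv_eq_of_hasDerivAt {U w : ℝ → E3} (hU : ∀ x, HasDerivAt U (w x) x)
    (hw : Continuous w) (hper : Function.Periodic U (2 * π)) (hm : mean U = 0) {V : LTwo}
    (hV : V =ᵐ[torusMeasure] w) : antideriv V = U := by
  have hprim := HasPrim.of_hasDerivAt hU hw
  have hw2 : MemLp w 2 torusMeasure := (memLp_congr_ae hV).mp (Lp.memLp V)
  have hH : MemH1 U := ⟨hper, w, hw2, hprim.eq⟩
  have hd : deriv U = w := funext fun x => (hU x).deriv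
  have hVU : derivTwo U = V := by
    rw [derivTwo, dif_pos (by rw [hd]; exact hw2)]
    refine Lp.ext ((MemLp.coeFn_toLp _).trans ?_)
    rw [hd]
    exact hV.symm
  rw [← hVU, hH.antideriv_derivTwo hm]

lemma coeFn_trigDeriv (k : ℤ) (g : LOne) : trigDeriv k g =ᵐ[torusMeasure]
    fun x => Real.cos (k * x) • sinCoef k g - Real.sin (k * x) • cosCoef k g := by
  rw [trigDeriv_apply]
  filter_upwards [Lp.coeFn_sub (mulConst (cosInf k) (sinCoef k g))
    (mulConst (sinInf k) (cosCoef k g)), coeFn_mulConst (cosInf k) (sinCoef k g),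
    coeFn_mulConst (sinInf k) (cosCoef k g), coeFn_cosInf k, coeFn_sinInf k] with x h1 h2 h3 h4 h5
  rw [h1, Pi.sub_apply, h2, h3, h4, h5]

lemma antideriv_trigDeriv {k : ℤ} (hk : k ≠ 0) (g : LOne) (x : ℝ) : antideriv (trigDeriv k g) x =
    (k : ℝ)⁻¹ • (Real.cos (k * x) • cosCoef k g + Real.sin (k * x) • sinCoef k g) := by
  have hk' : (k : ℝ) ≠ 0 := by exact_mod_cast hk
  refine congr_fun (antideriv_eq_of_hasDerivAt (U := fun x => (k : ℝ)⁻¹ •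
    (Real.cos (k * x) • cosCoef k g + Real.sin (k * x) • sinCoef k g)) (w := fun x =>
    Real.cos (k * x) • sinCoef k g - Real.sin (k * x) • cosCoef k g) (fun x => ?_) (by fun_prop)
    (fun x => ?_) ?_ (coeFn_trigDeriv k g)) x
  · have h0 : HasDerivAt (fun x : ℝ => (k : ℝ) * x) k x := by
      simpa using (hasDerivAt_id x).const_mul (k : ℝ)
    have h := ((h0.cos.smul_const (cosCoef k g)).add
      (h0.sin.smul_const (sinCoef k g))).const_smul (k : ℝ)⁻¹
    convert! h using 1
    rw [smul_add, smul_smul, smul_smul, show (k : ℝ)⁻¹ * (-Real.sin (k * x) * k) =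
      -Real.sin (k * x) by field_simp, show (k : ℝ)⁻¹ * (Real.cos (k * x) * k) =
      Real.cos (k * x) by field_simp, neg_smul]
    abel
  · simp only
    rw [mul_add, show (k : ℝ) * (2 * π) = k * (2 * π) from rfl, Real.cos_add_int_mul_two_pi,
      Real.sin_add_int_mul_two_pi]
  · rw [mean, ← integral_torusMeasure, integral_smul, integral_add
      (integrable_of_continuous_torus (by fun_prop)) (integrable_of_continuous_torus (by fun_prop)),
      integral_smul_const, integral_smul_const, integral_cos_int, integral_sin_int, if_neg hk]
    simp

lemma summable_exp_neg_sq {t : ℝ} (ht : 0 < t) :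
    Summable fun k : ℤ => Real.exp (-(k : ℝ) ^ 2 * t) := by
  have h4 : Summable fun k : ℤ => 1 / |(k : ℝ)| ^ 4 := by
    have : (fun k : ℤ => 1 / |(k : ℝ)| ^ 4) = fun k : ℤ => 1 / (k : ℝ) ^ 4 := by
      ext k
      rw [Even.pow_abs (by decide)]
    rw [this]
    exact Real.summable_one_div_int_pow.mpr (by norm_num)
  refine Summable.of_nonneg_of_le (fun k => (Real.exp_pos _).le) (fun k => ?_)
    ((h4.mul_left (2 / t ^ 2)).add (hasSum_ite_eq (0 : ℤ) (1 : ℝ)).summable)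
  rcases eq_or_ne k 0 with rfl | hk
  · simp
  · rw [if_neg hk, add_zero]
    exact exp_neg_sq_mul_le k hk ht le_rfl

/-- The addition formula splits cos (k (x - y)); sum and integral are exchanged because ∑ exp (-k²
t) converges for t > 0. -/
lemma hasSum_heatSemigroup {t : ℝ} (ht : 0 < t) (g : LOne) (x : ℝ) :
    HasSum (fun k : ℤ => ((2 * π)⁻¹ * Real.exp (-(k : ℝ) ^ 2 * t)) •
      (Real.cos (k * x) • cosCoef k g + Real.sin (k * x) • sinCoef k g))
      (heatSemigroup t g x) := by
  have hg := LOne.integrable g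
  have hcs : ∀ k : ℤ, (fun y => (Real.exp (-(k : ℝ) ^ 2 * t) * Real.cos (k * (x - y))) • g y) =
      fun y => Real.exp (-(k : ℝ) ^ 2 * t) • (Real.cos (k * x) • (Real.cos (k * y) • g y) +
        Real.sin (k * x) • (Real.sin (k * y) • g y)) := fun k => by
    ext1 y
    rw [mul_sub, Real.cos_sub, smul_smul, smul_smul, ← add_smul, smul_smul]
  have hint : ∀ k : ℤ, Integrable (fun y =>
      (Real.exp (-(k : ℝ) ^ 2 * t) * Real.cos (k * (x - y))) • g y) torusMeasure := fun k => by
    rw [hcs]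
    exact (((integrable_cos_smul k hg).smul (Real.cos (k * x))).add
      ((integrable_sin_smul k hg).smul (Real.sin (k * x)))).smul (Real.exp (-(k : ℝ) ^ 2 * t))
  have hsum : Summable fun k : ℤ => ∫ y, ‖(Real.exp (-(k : ℝ) ^ 2 * t) *
      Real.cos (k * (x - y))) • g y‖ ∂torusMeasure := by
    refine Summable.of_nonneg_of_le (fun k => integral_nonneg fun y => norm_nonneg _) (fun k => ?_)
      ((summable_exp_neg_sq ht).mul_right (∫ y, ‖g y‖ ∂torusMeasure))
    rw [← integral_const_mul]
    refine integral_mono (hint k).norm (hg.norm.const_mul _) fun y => ?_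
    simp only [norm_smul, norm_mul, Real.norm_of_nonneg (Real.exp_pos _).le]
    refine mul_le_mul_of_nonneg_right ?_ (norm_nonneg _)
    exact mul_le_of_le_one_right (Real.exp_pos _).le (Real.abs_cos_le_one _)
  have h := hasSum_integral_of_summable_integral_norm hint hsum
  rw [heatSemigroup, if_neg ht.ne', ← integral_torusMeasure]
  have hk : (fun y => heatKernel (x - y) t • g y) = fun y => (2 * π)⁻¹ •
      ∑' k : ℤ, (Real.exp (-(k : ℝ) ^ 2 * t) * Real.cos (k * (x - y))) • g y := by
    ext1 y
    rw [heatKernel, mul_smul, Summable.tsum_smul_const]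
    refine Summable.of_norm_bounded (summable_exp_neg_sq ht) fun k => ?_
    rw [norm_mul, Real.norm_of_nonneg (Real.exp_pos _).le]
    exact mul_le_of_le_one_right (Real.exp_pos _).le (Real.abs_cos_le_one _)
  rw [hk, integral_smul]
  convert! h.const_smul ((2 * π)⁻¹ : ℝ) using 1
  ext1 k
  have hA : Integrable (fun y => Real.cos (k * x) • (Real.cos (k * y) • g y)) torusMeasure :=
    (integrable_cos_smul k hg).smul (Real.cos (k * x))
  have hB : Integrable (fun y => Real.sin (k * x) • (Real.sin (k * y) • g y)) torusMeasure :=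
    (integrable_sin_smul k hg).smul (Real.sin (k * x))
  rw [hcs, integral_smul, integral_add hA hB, integral_smul, integral_smul, cosCoef_apply,
    sinCoef_apply, smul_smul]

/-- For k ≠ 0 the primitive of the k-th mode of ∂ₓS(t)g is the k-th mode of S(t)g. The weight k
deletes the zero mode, whence the subtracted mean. This connects the Volterra equation in L² with
Duhamel's formula. -/
lemma antideriv_heatD {t : ℝ} (ht : 0 < t) (g : LOne) (x : ℝ) :
    antideriv (heatD t g) x = heatSemigroup t g x - mean g := by
  have h1 := hasSum_heatD_apply (antiEval x) ht g
  have h2 := (hasSum_heatSemigroup ht g x).sub (hasSum_ite_eq (0 : ℤ) (mean g))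
  rw [← antiEval_apply]
  refine h1.unique (h2.congr_fun fun k => ?_)
  rcases eq_or_ne k 0 with rfl | hk
  · simp [heatWeight, mean_eq_cosCoef]
  · have hk' : (k : ℝ) ≠ 0 := by exact_mod_cast hk
    rw [antiEval_apply, antideriv_trigDeriv hk, if_neg hk, sub_zero, smul_smul, heatWeight]
    congr 1
    field_simp

lemma heatSemigroup_congr_ae {f g : ℝ → E3} (h : f =ᵐ[torusMeasure] g) {t : ℝ} (ht : t ≠ 0)
    (x : ℝ) : heatSemigroup t f x = heatSemigroup t g x := by
  rw [heatSemigroup, heatSemigroup, if_neg ht, if_neg ht, ← integral_torusMeasure,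
    ← integral_torusMeasure]
  refine integral_congr_ae ?_
  filter_upwards [h] with y hy
  rw [hy]

lemma mean_heatD {t : ℝ} (ht : 0 < t) (g : LOne) : meanL (toOne (heatD t g)) = 0 := by
  change (2 * π)⁻¹ • cosCoef 0 (toOne (heatD t g)) = 0
  rw [cosCoef_heatD ht]
  simp [heatWeight]

/-- `antideriv v` as an element of `L¹`. -/
def antiOne : LTwo →L[ℝ] LOne := infToOne.comp antiInf

lemma coeFn_antiOne (v : LTwo) : antiOne v =ᵐ[torusMeasure] antideriv v :=
  (coeFn_infToOne _).trans (coeFn_antiInf v)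

lemma integral_trig_by_parts {φ φ' : ℝ → ℝ} (hφ : ∀ x, HasDerivAt φ (φ' x) x)
    (hφ' : Continuous φ') (hper : φ π = φ (-π)) (v : LTwo) :
    ∫ x, φ x • centre v x ∂torusMeasure = -∫ x, φ' x • antideriv v x ∂torusMeasure := by
  have h1 := HasPrim.of_hasDerivAt hφ hφ'
  have h := (h1.smul (hasPrim_antideriv v)).integral_eq
  have hA : antideriv v π = antideriv v (-π) := by
    rw [← antideriv_periodic v (-π)]; congr 1; ring
  have hB : Integrable (fun x => φ' x • antideriv v x) torusMeasure :=
    h1.integrable.smul_of_top_left (hasPrim_antideriv v).memLp_top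
  have hC : Integrable (fun x => φ x • centre v x) torusMeasure :=
    (LTwo.integrable _).smul_of_top_right h1.memLp_top
  rw [hper, hA, sub_self, integral_add hB hC] at h
  exact (neg_eq_of_add_eq_zero_right h).symm

lemma cosCoef_of_antideriv {v : LTwo} (hv : mean v = 0) (k : ℤ) :
    cosCoef k (toOne v) = (k : ℝ) • sinCoef k (antiOne v) := by
  have h := integral_trig_by_parts (φ := fun x => Real.cos (k * x))
    (φ' := fun x => -Real.sin (k * x) * k) (fun x => by
      simpa using ((hasDerivAt_id x).const_mul (k : ℝ)).cos) (by fun_prop) (by simp) v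
  rw [centre_eq_self hv] at h
  rw [cosCoef_apply, sinCoef_apply, ← integral_smul]
  rw [show ∫ x, Real.cos (k * x) • toOne v x ∂torusMeasure
    = ∫ x, Real.cos (k * x) • v x ∂torusMeasure from integral_congr_ae (by
      filter_upwards [coeFn_toOne v] with x hx; rw [hx]), h, ← integral_neg]
  refine integral_congr_ae ?_
  filter_upwards [coeFn_antiOne v] with x hx
  rw [hx, smul_smul, ← neg_smul]
  congr 1; ring

lemma sinCoef_of_antideriv {v : LTwo} (hv : mean v = 0) (k : ℤ) :
    sinCoef k (toOne v) = -((k : ℝ) • cosCoef k (antiOne v)) := by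
  have h := integral_trig_by_parts (φ := fun x => Real.sin (k * x))
    (φ' := fun x => Real.cos (k * x) * k) (fun x => by
      simpa using ((hasDerivAt_id x).const_mul (k : ℝ)).sin) (by fun_prop) (by
        simp [Real.sin_int_mul_pi]) v
  rw [centre_eq_self hv] at h
  rw [cosCoef_apply, sinCoef_apply, ← integral_smul]
  rw [show ∫ x, Real.sin (k * x) • toOne v x ∂torusMeasure
    = ∫ x, Real.sin (k * x) • v x ∂torusMeasure from integral_congr_ae (by
      filter_upwards [coeFn_toOne v] with x hx; rw [hx]), h]
  congr 1
  refine integral_congr_ae ?_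
  filter_upwards [coeFn_antiOne v] with x hx
  rw [hx, smul_smul]
  congr 1; ring

/-- The heat flow of the derivative of the datum `antideriv v`. -/
def heatFlow (v : LTwo) (t : ℝ) : LTwo := if t = 0 then v else heatD t (antiOne v)

lemma heatFlow_zero (v : LTwo) : heatFlow v 0 = v := if_pos rfl

lemma heatFlow_of_pos (v : LTwo) {t : ℝ} (ht : 0 < t) : heatFlow v t = heatD t (antiOne v) :=
  if_neg ht.ne'

/-- On coefficients of a mean-zero v, the map v ↦ `heatD t (antiOne v)` is multiplication by exp
(-k² t), because the weight k undoes the primitive. -/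
lemma hasSum_heatD_sub {v : LTwo} (hv : mean v = 0) {t : ℝ} (ht : 0 < t) :
    HasSum (fun k : ℤ => (Real.exp (-(k : ℝ) ^ 2 * t) - 1) ^ 2 *
      (‖cosCoef k (toOne v)‖ ^ 2 + ‖sinCoef k (toOne v)‖ ^ 2))
      (2 * π * ‖heatD t (antiOne v) - v‖ ^ 2) := by
  refine (hasSum_sq_coef _).congr_fun fun k => ?_
  rw [map_sub, map_sub, map_sub, cosCoef_heatD ht, sinCoef_heatD ht]
  have h1 : heatWeight k t • sinCoef k (antiOne v) - cosCoef k (toOne v)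
      = (Real.exp (-(k : ℝ) ^ 2 * t) - 1) • cosCoef k (toOne v) := by
    rw [cosCoef_of_antideriv hv, heatWeight, smul_smul, sub_mul, sub_smul, one_mul, mul_comm]
  have h2 : -(heatWeight k t • cosCoef k (antiOne v)) - sinCoef k (toOne v)
      = (Real.exp (-(k : ℝ) ^ 2 * t) - 1) • sinCoef k (toOne v) := by
    rw [sinCoef_of_antideriv hv, heatWeight, sub_smul, one_smul, smul_neg, smul_smul, mul_comm]
  rw [h1, h2, norm_smul, norm_smul, mul_pow, mul_pow, ← mul_add, Real.norm_eq_abs, sq_abs]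

/-- Dominated convergence in Parseval's series: each factor (exp (-k² t) - 1)² tends to 0 and is at
most 1. -/
lemma tendsto_heatD_zero {v : LTwo} (hv : mean v = 0) :
    Tendsto (fun t => heatD t (antiOne v)) (𝓝[>] 0) (𝓝 v) := by
  rw [tendsto_iff_norm_sub_tendsto_zero]
  have hS := (hasSum_sq_coef v).summable
  have h : Tendsto (fun t => ∑' k : ℤ, (Real.exp (-(k : ℝ) ^ 2 * t) - 1) ^ 2 *
      (‖cosCoef k (toOne v)‖ ^ 2 + ‖sinCoef k (toOne v)‖ ^ 2)) (𝓝[>] 0)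
      (𝓝 (∑' _ : ℤ, (0 : ℝ))) := by
    refine tendsto_tsum_of_dominated_convergence hS (fun k => ?_) ?_
    · have hc : Continuous fun t : ℝ => (Real.exp (-(k : ℝ) ^ 2 * t) - 1) ^ 2 *
          (‖cosCoef k (toOne v)‖ ^ 2 + ‖sinCoef k (toOne v)‖ ^ 2) := by fun_prop
      have := hc.tendsto 0
      simp only [mul_zero, Real.exp_zero, sub_self, ne_eq, OfNat.ofNat_ne_zero, not_false_eq_true,
        zero_pow, zero_mul] at this
      exact this.mono_left nhdsWithin_le_nhds
    · filter_upwards [self_mem_nhdsWithin] with t ht k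
      have ht' : 0 < t := ht
      rw [Real.norm_of_nonneg (by positivity)]
      refine mul_le_of_le_one_left (by positivity) ?_
      have h1 : Real.exp (-(k : ℝ) ^ 2 * t) ≤ 1 := Real.exp_le_one_iff.mpr (by
        nlinarith [sq_nonneg (k : ℝ)])
      have h0 := Real.exp_pos (-(k : ℝ) ^ 2 * t)
      nlinarith
  rw [tsum_zero] at h
  have h2 : Tendsto (fun t => √((2 * π)⁻¹ * ∑' k : ℤ, (Real.exp (-(k : ℝ) ^ 2 * t) - 1) ^ 2 *
      (‖cosCoef k (toOne v)‖ ^ 2 + ‖sinCoef k (toOne v)‖ ^ 2))) (𝓝[>] 0) (𝓝 0) := by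
    simpa using (h.const_mul (2 * π)⁻¹).sqrt
  refine h2.congr' ?_
  filter_upwards [self_mem_nhdsWithin] with t ht
  rw [(hasSum_heatD_sub hv ht).tsum_eq, ← mul_assoc, inv_mul_cancel₀ (by positivity), one_mul,
    Real.sqrt_sq (norm_nonneg _)]

lemma continuousOn_heatFlow {v : LTwo} (hv : mean v = 0) : ContinuousOn (heatFlow v) (Ici 0) := by
  intro t ht
  rcases eq_or_lt_of_le (show (0 : ℝ) ≤ t from ht) with rfl | h
  · rw [← Ioi_insert, continuousWithinAt_insert_self, ContinuousWithinAt, heatFlow_zero]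
    refine (tendsto_heatD_zero hv).congr' ?_
    filter_upwards [self_mem_nhdsWithin] with s hs using (heatFlow_of_pos v hs).symm
  · refine ContinuousAt.continuousWithinAt ?_
    have hc : ContinuousAt (fun t => heatD t (antiOne v)) t :=
      (continuousOn_heatD.continuousAt (Ioi_mem_nhds h)).clm_apply continuousAt_const
    refine hc.congr ?_
    filter_upwards [Ioi_mem_nhds h] with s hs using (heatFlow_of_pos v hs).symm

lemma antideriv_heatFlow (v : LTwo) {t : ℝ} (ht : 0 ≤ t) (x : ℝ) :
    antideriv (heatFlow v t) x = heatSemigroup t (antideriv v) x := by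
  rcases eq_or_lt_of_le ht with rfl | h
  · rw [heatFlow_zero, heatSemigroup, if_pos rfl]
  · rw [heatFlow_of_pos v h, antideriv_heatD h, heatSemigroup_congr_ae (coeFn_antiOne v) h.ne',
      mean_congr_ae (coeFn_antiOne v), mean_antideriv, sub_zero]

lemma meanL_heatFlow {v : LTwo} (hv : mean v = 0) {t : ℝ} (ht : 0 ≤ t) :
    meanL (toOne (heatFlow v t)) = 0 := by
  rcases eq_or_lt_of_le ht with rfl | h
  · rw [heatFlow_zero, meanL_apply, mean_congr_ae (coeFn_toOne v), hv]
  · rw [heatFlow_of_pos v h, mean_heatD h]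

/-! ### Averages and fluctuations over arcs -/

section Arc

variable {u u₁ u₂ : ℝ → E3}

/-- The average of `u` over the arc from `x - z` to `x`. -/
def arcMean (u : ℝ → E3) (x z : ℝ) : E3 := ∫ σ in (0 : ℝ)..1, u (x - σ * z)

/-- `1` minus the variance of `u` over the arc from `x - z` to `x`. For unit fields this is the
squared quotient of chord length and arc length. -/
def chordRatio (u : ℝ → E3) (x z : ℝ) : ℝ :=
  1 - ∫ σ in (0 : ℝ)..1, ‖u (x - σ * z) - arcMean u x z‖ ^ 2

lemma continuous_arcMean (hu : Continuous u) : Continuous fun q : ℝ × ℝ => arcMean u q.1 q.2 := by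
  refine intervalIntegral.continuous_parametric_intervalIntegral_of_continuous'
    (f := fun (q : ℝ × ℝ) σ => u (q.1 - σ * q.2)) ?_ 0 1
  fun_prop

lemma continuous_chordRatio (hu : Continuous u) :
    Continuous fun q : ℝ × ℝ => chordRatio u q.1 q.2 := by
  refine continuous_const.sub
    (intervalIntegral.continuous_parametric_intervalIntegral_of_continuous'
      (f := fun (q : ℝ × ℝ) σ => ‖u (q.1 - σ * q.2) - arcMean u q.1 q.2‖ ^ 2) ?_ 0 1)
  have := (continuous_arcMean hu).comp (continuous_fst (X := ℝ × ℝ) (Y := ℝ))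
  have h2 : Continuous fun r : (ℝ × ℝ) × ℝ => arcMean u r.1.1 r.1.2 := this
  exact ((by fun_prop : Continuous fun r : (ℝ × ℝ) × ℝ => u (r.1.1 - r.2 * r.1.2)).sub h2).norm.pow 2

lemma continuous_arcMean_left (hu : Continuous u) (z : ℝ) : Continuous fun x => arcMean u x z :=
  (continuous_arcMean hu).comp (Continuous.prodMk_left z)

lemma continuous_arcMean_right (hu : Continuous u) (x : ℝ) : Continuous fun z => arcMean u x z :=
  (continuous_arcMean hu).comp (Continuous.prodMk_right x)

lemma continuous_chordRatio_left (hu : Continuous u) (z : ℝ) :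
    Continuous fun x => chordRatio u x z := by
  simpa only [Function.comp_def] using (continuous_chordRatio hu).comp (Continuous.prodMk_left z)

lemma continuous_chordRatio_right (hu : Continuous u) (x : ℝ) :
    Continuous fun z => chordRatio u x z := by
  simpa only [Function.comp_def] using (continuous_chordRatio hu).comp (Continuous.prodMk_right x)

lemma arcMean_sub (h₁ : Continuous u₁) (h₂ : Continuous u₂) (x z : ℝ) :
    arcMean (fun y => u₁ y - u₂ y) x z = arcMean u₁ x z - arcMean u₂ x z :=
  intervalIntegral.integral_sub (Continuous.intervalIntegrable (by fun_prop) _ _)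
    (Continuous.intervalIntegrable (by fun_prop) _ _)

lemma norm_arcMean_le {C : ℝ} (hC : ∀ y, ‖u y‖ ≤ C) (x z : ℝ) : ‖arcMean u x z‖ ≤ C := by
  have := intervalIntegral.norm_integral_le_of_norm_le_const (a := (0 : ℝ)) (b := 1)
    (f := fun σ => u (x - σ * z)) (C := C) fun σ _ => hC _
  simpa [arcMean] using this

lemma norm_sub_arcMean_le (hu : Continuous u) {N z : ℝ}
    (hN : ∀ x y, |x - y| ≤ |z| → ‖u x - u y‖ ≤ N) (x : ℝ) {σ : ℝ} (hσ : σ ∈ Icc (0 : ℝ) 1) :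
    ‖u (x - σ * z) - arcMean u x z‖ ≤ N := by
  have h : u (x - σ * z) - arcMean u x z
      = ∫ ρ in (0 : ℝ)..1, (u (x - σ * z) - u (x - ρ * z)) := by
    rw [intervalIntegral.integral_sub (by simp) (Continuous.intervalIntegrable (by fun_prop) _ _)]
    simp [arcMean]
  rw [h]
  have := intervalIntegral.norm_integral_le_of_norm_le_const (a := (0 : ℝ)) (b := 1)
    (f := fun ρ => u (x - σ * z) - u (x - ρ * z)) (C := N) fun ρ hρ => by
      rw [uIoc_of_le zero_le_one] at hρ
      refine hN _ _ ?_
      rw [show x - σ * z - (x - ρ * z) = (ρ - σ) * z by ring, abs_mul]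
      refine mul_le_of_le_one_left (abs_nonneg _) (abs_le.mpr ⟨?_, ?_⟩) <;>
        linarith [hσ.1, hσ.2, hρ.1, hρ.2]
  simpa using this

/-- Defining the ratio through a variance makes this true without unit length, so the force can be
extended to all fields. -/
lemma chordRatio_le_one (u : ℝ → E3) (x z : ℝ) : chordRatio u x z ≤ 1 := by
  rw [chordRatio, sub_le_self_iff]
  exact intervalIntegral.integral_nonneg zero_le_one fun σ _ => by positivity

/-- The variance is quadratic in the oscillation. With Hölder exponent 1/2 the defect is thus
O(|z|), a full power of the arc length. -/
lemma one_sub_chordRatio_le (hu : Continuous u) {N z : ℝ}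
    (hN : ∀ x y, |x - y| ≤ |z| → ‖u x - u y‖ ≤ N) (x : ℝ) : 1 - chordRatio u x z ≤ N ^ 2 := by
  rw [chordRatio, sub_sub_cancel]
  have h := intervalIntegral.integral_mono_on (a := 0) (b := 1) zero_le_one
    (f := fun σ => ‖u (x - σ * z) - arcMean u x z‖ ^ 2) (g := fun _ => N ^ 2)
    (Continuous.intervalIntegrable (by fun_prop) _ _)
    ((continuous_const (y := N ^ 2)).intervalIntegrable (μ := volume) 0 1)
    fun σ hσ => pow_le_pow_left₀ (norm_nonneg _) (norm_sub_arcMean_le hu hN x hσ) 2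
  simpa using h

/-- A difference of squares factors into the fluctuation of u₁ - u₂ and a sum of fluctuations, so
comparing two fields loses no power of |z|. -/
lemma abs_chordRatio_sub_le (h₁ : Continuous u₁) (h₂ : Continuous u₂) {N₁ N₂ N z : ℝ}
    (hN₁ : ∀ x y, |x - y| ≤ |z| → ‖u₁ x - u₁ y‖ ≤ N₁)
    (hN₂ : ∀ x y, |x - y| ≤ |z| → ‖u₂ x - u₂ y‖ ≤ N₂)
    (hN : ∀ x y, |x - y| ≤ |z| → ‖(u₁ x - u₂ x) - (u₁ y - u₂ y)‖ ≤ N) (x : ℝ) :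
    |chordRatio u₁ x z - chordRatio u₂ x z| ≤ N * (N₁ + N₂) := by
  have hi : ∀ {u : ℝ → E3}, Continuous u → IntervalIntegrable
      (fun σ => ‖u (x - σ * z) - arcMean u x z‖ ^ 2) volume 0 1 := fun hu =>
    Continuous.intervalIntegrable (by fun_prop) _ _
  rw [chordRatio, chordRatio, sub_sub_sub_cancel_left,
    ← intervalIntegral.integral_sub (hi h₂) (hi h₁)]
  have := intervalIntegral.norm_integral_le_of_norm_le_const (a := (0 : ℝ)) (b := 1)
    (f := fun σ => ‖u₂ (x - σ * z) - arcMean u₂ x z‖ ^ 2 - ‖u₁ (x - σ * z) - arcMean u₁ x z‖ ^ 2)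
    (C := N * (N₁ + N₂)) fun σ hσ => by
      rw [uIoc_of_le zero_le_one] at hσ
      have hσ' : σ ∈ Icc (0 : ℝ) 1 := ⟨hσ.1.le, hσ.2⟩
      have e₁ := norm_sub_arcMean_le h₁ hN₁ x hσ'
      have e₂ := norm_sub_arcMean_le h₂ hN₂ x hσ'
      have e := norm_sub_arcMean_le (u := fun y => u₁ y - u₂ y) (h₁.sub h₂) hN x hσ'
      rw [arcMean_sub h₁ h₂] at e
      set a := u₁ (x - σ * z) - arcMean u₁ x z
      set b := u₂ (x - σ * z) - arcMean u₂ x z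
      have hab : u₁ (x - σ * z) - u₂ (x - σ * z) - (arcMean u₁ x z - arcMean u₂ x z) = a - b := by
        simp only [a, b]; abel
      rw [hab] at e
      rw [sq_sub_sq, Real.norm_eq_abs, abs_mul, mul_comm]
      refine mul_le_mul ?_ ?_ (abs_nonneg _) ((norm_nonneg _).trans e)
      · refine (abs_norm_sub_norm_le _ _).trans ?_
        rwa [norm_sub_rev]
      · rw [abs_of_nonneg (by positivity)]
        linarith
  simpa using this

/-- For unit fields the chord ratio is the squared length of the mean. -/
lemma chordRatio_eq_norm_sq (hu : Continuous u) (h1 : ∀ x, ‖u x‖ = 1) (x z : ℝ) :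
    chordRatio u x z = ‖arcMean u x z‖ ^ 2 := by
  have h : ∀ σ, ‖u (x - σ * z) - arcMean u x z‖ ^ 2
      = (1 + ‖arcMean u x z‖ ^ 2) - 2 * inner ℝ (arcMean u x z) (u (x - σ * z)) := fun σ => by
    rw [norm_sub_sq_real, h1, real_inner_comm]; ring
  have h2 : ∫ σ in (0 : ℝ)..1, (inner ℝ (arcMean u x z) (u (x - σ * z)) : ℝ)
      = inner ℝ (arcMean u x z) (arcMean u x z) := by
    have := (innerSL ℝ (arcMean u x z)).intervalIntegral_comp_comm (μ := volume) (a := 0) (b := 1)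
      (f := fun σ => u (x - σ * z)) (Continuous.intervalIntegrable (by fun_prop) _ _)
    simpa [arcMean] using this
  rw [chordRatio]
  simp only [h]
  rw [intervalIntegral.integral_sub (by simp) (Continuous.intervalIntegrable (by fun_prop) _ _),
    intervalIntegral.integral_const_mul, h2, real_inner_self_eq_norm_sq]
  simp
  ring

end Arc

/-! ### The degenerate part of the force -/

/-- A profile vanishing to order `m + 1` at `1`. -/
structure IsProfile (q : ℝ → ℝ) (m : ℕ) (C : ℝ) : Prop where
  continuous : Continuous q
  map_one : q 1 = 0
  nonneg : 0 ≤ C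
  lipschitz : ∀ a b r, a ≤ 1 → b ≤ 1 → 1 - a ≤ r → 1 - b ≤ r → |q a - q b| ≤ C * r ^ m * |a - b|

/-- The integrand of the degenerate part of the force. -/
def nlIntegrand (q : ℝ → ℝ) (p : ℝ) (u : ℝ → E3) (x z : ℝ) : E3 :=
  (q (chordRatio u x z) * (|z| ^ (-(2 * p) - 2) * z)) • arcMean u x z

/-- The degenerate part of the force. -/
def nlForce (q : ℝ → ℝ) (p : ℝ) (u : ℝ → E3) (x : ℝ) : E3 :=
  ∫ z, nlIntegrand q p u x z ∂torusMeasure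

lemma ae_abs_le_pi : ∀ᵐ z ∂torusMeasure, |z| ≤ π := by
  filter_upwards [ae_mem_Ioc] with z hz using abs_le.mpr ⟨hz.1.le, hz.2⟩

lemma integrable_abs_rpow {r : ℝ} (hr : -1 < r) : Integrable (fun z : ℝ => |z| ^ r) torusMeasure := by
  have h1 : IntervalIntegrable (fun z : ℝ => |z| ^ r) volume 0 π := by
    refine (intervalIntegral.intervalIntegrable_rpow' hr).congr fun z hz => ?_
    rw [uIoc_of_le Real.pi_pos.le] at hz
    rw [abs_of_pos hz.1]
  have h2 : IntervalIntegrable (fun z : ℝ => |z| ^ r) volume (-π) 0 := by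
    have := (h1.comp_sub_left 0).symm
    simpa using this
  exact (intervalIntegrable_iff_integrableOn_Ioc_of_le neg_pi_le_pi).mp (h2.trans h1)

section Profile

variable {q : ℝ → ℝ} {m : ℕ} {C p : ℝ}

/-- Power counting: the profile gives |z|^(m+1), the kernel |z|^(-2p-2) and the chord |z|. The point
z = 0 is separate because `0 ^ 0 = 1` occurs on the right when m = 2p. -/
lemma abs_rpow_weight {z : ℝ} (p : ℝ) (m : ℕ) :
    |z| ^ (m + 1) * (|z| ^ (-(2 * p) - 2) * |z|) = if z = 0 then 0 else |z| ^ ((m : ℝ) - 2 * p) := by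
  split_ifs with h
  · simp [h]
  · have hz : 0 < |z| := abs_pos.mpr h
    rw [show (m : ℝ) - 2 * p = (m + 1 : ℕ) + (-(2 * p) - 2) + 1 by push_cast; ring,
      Real.rpow_add hz, Real.rpow_add hz, Real.rpow_natCast, Real.rpow_one, mul_assoc]

lemma abs_rpow_weight_le {z : ℝ} (p : ℝ) (m : ℕ) :
    |z| ^ (m + 1) * (|z| ^ (-(2 * p) - 2) * |z|) ≤ |z| ^ ((m : ℝ) - 2 * p) := by
  rw [abs_rpow_weight]
  split_ifs
  · positivity
  · exact le_rfl

lemma aestronglyMeasurable_nlIntegrand (hq : Continuous q) {u : ℝ → E3} (hu : Continuous u)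
    (x : ℝ) : AEStronglyMeasurable (nlIntegrand q p u x) torusMeasure := by
  have h1 : Continuous fun z => q (chordRatio u x z) :=
    hq.comp (continuous_chordRatio_right hu x)
  have h2 := continuous_arcMean_right hu x
  have h3 : Measurable fun z : ℝ => |z| ^ (-(2 * p) - 2) * z := by fun_prop
  exact AEStronglyMeasurable.smul (f := fun z => q (chordRatio u x z) * (|z| ^ (-(2 * p) - 2) * z))
    (h1.aestronglyMeasurable.mul h3.aestronglyMeasurable) h2.aestronglyMeasurable

lemma continuous_nlIntegrand_left (hq : Continuous q) {u : ℝ → E3} (hu : Continuous u) (z : ℝ) :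
    Continuous fun x => nlIntegrand q p u x z := by
  have h1 : Continuous fun x => q (chordRatio u x z) :=
    hq.comp (continuous_chordRatio_left hu z)
  have h2 := continuous_arcMean_left hu z
  have h3 : Continuous fun x => q (chordRatio u x z) * (|z| ^ (-(2 * p) - 2) * z) :=
    h1.mul continuous_const
  exact Continuous.smul h3 h2

lemma antideriv_osc (v : LTwo) {z : ℝ} (hz : |z| ≤ π) (x y : ℝ) (hxy : |x - y| ≤ |z|) :
    ‖antideriv v x - antideriv v y‖ ≤ holderConst * ‖v‖ * √|z| := by
  refine (norm_antideriv_sub_le v (by linarith [Real.pi_pos])).trans ?_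
  have := holderConst_nonneg
  gcongr

/-- The local Lipschitz estimate for the degenerate part of the force. -/
lemma exists_nlIntegrand_lipschitz (hq : IsProfile q m C) (p M : ℝ) :
    ∃ L, 0 ≤ L ∧ ∀ v w : LTwo, ‖v‖ ≤ M → ‖w‖ ≤ M → ∀ x z, |z| ≤ π →
      ‖nlIntegrand q p (antideriv v) x z - nlIntegrand q p (antideriv w) x z‖
        ≤ L * ‖v - w‖ * |z| ^ ((m : ℝ) - 2 * p) ∧
      ‖nlIntegrand q p (antideriv v) x z‖ ≤ L * |z| ^ ((m : ℝ) - 2 * p) := by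
  obtain ⟨B, hB0, hB⟩ := exists_norm_antideriv_le
  have hH := holderConst_nonneg
  have hC := hq.nonneg
  rcases lt_or_ge M 0 with hM | hM
  · exact ⟨0, le_rfl, fun v w hv => absurd ((norm_nonneg v).trans hv) (not_le.mpr hM)⟩
  set N := holderConst * M with hN
  have hN0 : 0 ≤ N := by positivity
  -- N √|z| bounds the oscillation over arcs of length |z|, so N²|z| bounds the chord defect. L₁
  -- belongs to differences of profile values, L₂ to their size.
  set L₁ := C * (N ^ 2) ^ m * (holderConst * (2 * N)) with hL₁
  set L₂ := C * (N ^ 2) ^ m * N ^ 2 with hL₂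
  have hL₁0 : 0 ≤ L₁ := by positivity
  have hL₂0 : 0 ≤ L₂ := by positivity
  refine ⟨L₁ * (B * M) + L₂ * B + L₂ * (B * M), by positivity, fun v w hv hw x z hz => ?_⟩
  set a := chordRatio (antideriv v) x z
  set b := chordRatio (antideriv w) x z
  have hsq : √|z| ^ 2 = |z| := Real.sq_sqrt (abs_nonneg z)
  have hosc : ∀ v : LTwo, ‖v‖ ≤ M → ∀ x y, |x - y| ≤ |z| →
      ‖antideriv v x - antideriv v y‖ ≤ N * √|z| := fun v hv x y hxy =>
    (antideriv_osc v hz x y hxy).trans (by rw [hN]; gcongr)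
  have hdefect : ∀ v : LTwo, ‖v‖ ≤ M → 1 - chordRatio (antideriv v) x z ≤ N ^ 2 * |z| :=
    fun v hv => (one_sub_chordRatio_le (continuous_antideriv v) (hosc v hv) x).trans
      (by rw [mul_pow, hsq])
  have hab : |a - b| ≤ holderConst * (2 * N) * ‖v - w‖ * |z| := by
    refine (abs_chordRatio_sub_le (continuous_antideriv v) (continuous_antideriv w)
      (hosc v hv) (hosc w hw) (N := holderConst * ‖v - w‖ * √|z|) (fun x y hxy => ?_) x).trans
      (le_of_eq ?_)
    · rw [← antideriv_sub, ← antideriv_sub]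
      exact antideriv_osc _ hz x y hxy
    · calc _ = holderConst * (2 * N) * ‖v - w‖ * √|z| ^ 2 := by ring
        _ = _ := by rw [hsq]
  have hqab : |q a - q b| ≤ L₁ * ‖v - w‖ * |z| ^ (m + 1) := by
    refine (hq.lipschitz a b (N ^ 2 * |z|) (chordRatio_le_one _ _ _) (chordRatio_le_one _ _ _)
      (hdefect v hv) (hdefect w hw)).trans ?_
    calc _ ≤ C * (N ^ 2 * |z|) ^ m * (holderConst * (2 * N) * ‖v - w‖ * |z|) := by gcongr
      _ = _ := by rw [hL₁, mul_pow]; ring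
  have hqv : ∀ v : LTwo, ‖v‖ ≤ M →
      |q (chordRatio (antideriv v) x z)| ≤ L₂ * |z| ^ (m + 1) := fun v hv => by
    have h := hq.lipschitz (chordRatio (antideriv v) x z) 1 (N ^ 2 * |z|)
      (chordRatio_le_one _ _ _) le_rfl (hdefect v hv) (by rw [sub_self]; positivity)
    rw [hq.map_one, sub_zero, abs_sub_comm, abs_of_nonneg
      (sub_nonneg.mpr (chordRatio_le_one _ _ _))] at h
    refine h.trans ?_
    calc _ ≤ C * (N ^ 2 * |z|) ^ m * (N ^ 2 * |z|) :=
          mul_le_mul_of_nonneg_left (hdefect v hv) (by positivity)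
      _ = _ := by rw [hL₂, mul_pow]; ring
  have hav : ∀ v : LTwo, ‖arcMean (antideriv v) x z‖ ≤ B * ‖v‖ := fun v =>
    norm_arcMean_le (hB v) x z
  have havw : ‖arcMean (antideriv v) x z - arcMean (antideriv w) x z‖ ≤ B * ‖v - w‖ := by
    rw [← arcMean_sub (continuous_antideriv v) (continuous_antideriv w)]
    refine norm_arcMean_le (fun y => ?_) x z
    rw [← antideriv_sub]
    exact hB _ y
  have hw0 : 0 ≤ |z| ^ (-(2 * p) - 2) * |z| := by positivity
  have hwt : |(|z| ^ (-(2 * p) - 2) * z)| = |z| ^ (-(2 * p) - 2) * |z| := by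
    rw [abs_mul, abs_of_nonneg (Real.rpow_nonneg (abs_nonneg z) _)]
  have hle := abs_rpow_weight_le (z := z) p m
  constructor
  -- Difference of products: the profile value is varied first, then the arc mean.
  · have heq : nlIntegrand q p (antideriv v) x z - nlIntegrand q p (antideriv w) x z
        = (|z| ^ (-(2 * p) - 2) * z) • ((q a - q b) • arcMean (antideriv v) x z
          + q b • (arcMean (antideriv v) x z - arcMean (antideriv w) x z)) := by
      simp only [nlIntegrand, smul_add, smul_sub, sub_smul, smul_smul, mul_comm (q _)]
      abel
    rw [heq, norm_smul, Real.norm_eq_abs, hwt]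
    have h1 : ‖(q a - q b) • arcMean (antideriv v) x z
          + q b • (arcMean (antideriv v) x z - arcMean (antideriv w) x z)‖
        ≤ (L₁ * (B * M) + L₂ * B) * ‖v - w‖ * |z| ^ (m + 1) := by
      refine (norm_add_le _ _).trans ?_
      rw [norm_smul, norm_smul, Real.norm_eq_abs, Real.norm_eq_abs]
      calc _ ≤ (L₁ * ‖v - w‖ * |z| ^ (m + 1)) * (B * M)
            + (L₂ * |z| ^ (m + 1)) * (B * ‖v - w‖) := by
            refine add_le_add (mul_le_mul hqab ((hav v).trans (by gcongr)) (norm_nonneg _)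
              (by positivity)) (mul_le_mul (hqv w hw) havw (norm_nonneg _) (by positivity))
        _ = _ := by ring
    calc _ ≤ (|z| ^ (-(2 * p) - 2) * |z|) *
          ((L₁ * (B * M) + L₂ * B) * ‖v - w‖ * |z| ^ (m + 1)) := mul_le_mul_of_nonneg_left h1 hw0
      _ = (L₁ * (B * M) + L₂ * B) * ‖v - w‖ *
          (|z| ^ (m + 1) * (|z| ^ (-(2 * p) - 2) * |z|)) := by ring
      _ ≤ (L₁ * (B * M) + L₂ * B) * ‖v - w‖ * |z| ^ ((m : ℝ) - 2 * p) := by gcongr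
      _ ≤ _ := mul_le_mul_of_nonneg_right (mul_le_mul_of_nonneg_right
          (le_add_of_nonneg_right (by positivity)) (norm_nonneg _)) (by positivity)
  · rw [nlIntegrand, norm_smul, Real.norm_eq_abs, abs_mul, hwt]
    calc _ ≤ (L₂ * |z| ^ (m + 1)) * (|z| ^ (-(2 * p) - 2) * |z|) * (B * M) :=
          mul_le_mul (mul_le_mul_of_nonneg_right (hqv v hv) hw0)
            ((hav v).trans (by gcongr)) (norm_nonneg _) (by positivity)
      _ = L₂ * (B * M) * (|z| ^ (m + 1) * (|z| ^ (-(2 * p) - 2) * |z|)) := by ring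
      _ ≤ L₂ * (B * M) * |z| ^ ((m : ℝ) - 2 * p) := by gcongr
      _ ≤ _ := mul_le_mul_of_nonneg_right
          (le_add_of_nonneg_left (by positivity)) (by positivity)

lemma integrable_nlIntegrand (hq : IsProfile q m C) (hm : -1 < (m : ℝ) - 2 * p) (v : LTwo)
    (x : ℝ) : Integrable (nlIntegrand q p (antideriv v) x) torusMeasure := by
  obtain ⟨L, -, hL⟩ := exists_nlIntegrand_lipschitz hq p ‖v‖
  refine ((integrable_abs_rpow hm).const_mul L).mono'
    (aestronglyMeasurable_nlIntegrand hq.continuous (continuous_antideriv v) x) ?_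
  filter_upwards [ae_abs_le_pi] with z hz using (hL v v le_rfl le_rfl x z hz).2

lemma continuous_nlForce (hq : IsProfile q m C) (hm : -1 < (m : ℝ) - 2 * p) (v : LTwo) :
    Continuous (nlForce q p (antideriv v)) := by
  obtain ⟨L, -, hL⟩ := exists_nlIntegrand_lipschitz hq p ‖v‖
  have hu := continuous_antideriv v
  refine continuous_of_dominated (bound := fun z => L * |z| ^ ((m : ℝ) - 2 * p))
    (fun x => aestronglyMeasurable_nlIntegrand hq.continuous hu x) (fun x => ?_)
    ((integrable_abs_rpow hm).const_mul L) (Eventually.of_forall fun z => ?_)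
  · filter_upwards [ae_abs_le_pi] with z hz using (hL v v le_rfl le_rfl x z hz).2
  · exact continuous_nlIntegrand_left hq.continuous hu z

end Profile

lemma memLp_of_continuous_periodic {f : ℝ → E3} (hf : Continuous f) (p : ℝ≥0∞) :
    MemLp f p torusMeasure := by
  obtain ⟨C, hC⟩ := (isCompact_Icc (a := -π) (b := π)).exists_bound_of_continuousOn hf.continuousOn
  refine MemLp.of_bound hf.aestronglyMeasurable C ?_
  filter_upwards [ae_mem_Ioc] with x hx using hC x (Ioc_subset_Icc_self hx)

section Profile

variable {q : ℝ → ℝ} {m : ℕ} {C p : ℝ}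

lemma tendsto_integral_abs_lt {r : ℝ} (hr : -1 < r) :
    Tendsto (fun ε : ℝ => ∫ z in {z | ε ≤ |z|}ᶜ, |z| ^ r ∂torusMeasure) (𝓝[>] 0) (𝓝 0) := by
  have hms : ∀ ε : ℝ, MeasurableSet {z : ℝ | ε ≤ |z|}ᶜ := fun ε =>
    (measurableSet_le measurable_const (by fun_prop)).compl
  simp_rw [← integral_indicator (hms _)]
  rw [show 𝓝 (0 : ℝ) = 𝓝 (∫ _, (0 : ℝ) ∂torusMeasure) by simp]
  refine tendsto_integral_filter_of_dominated_convergence (fun z => |z| ^ r)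
    (Eventually.of_forall fun ε => (integrable_abs_rpow hr).aestronglyMeasurable.indicator (hms ε))
    (Eventually.of_forall fun ε => Eventually.of_forall fun z => ?_) (integrable_abs_rpow hr) ?_
  · rw [norm_indicator_eq_indicator_norm]
    refine (indicator_le_self' (fun _ _ => norm_nonneg _) z).trans (le_of_eq ?_)
    rw [Real.norm_eq_abs, abs_of_nonneg (by positivity)]
  · have hne : ∀ᵐ z ∂torusMeasure, z ≠ 0 := ae_restrict_of_ae (by simp [ae_iff])
    filter_upwards [hne] with z hz
    refine tendsto_const_nhds.congr' ?_
    filter_upwards [nhdsWithin_le_nhds (Iio_mem_nhds (abs_pos.mpr hz))] with ε hε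
    rw [indicator_of_notMem]
    simpa using (le_of_lt hε)

/-- The degenerate part of the force as a locally Lipschitz map, and its approximation by
truncated integrals. -/
lemma exists_nlForce (hq : IsProfile q m C) (hm : -1 < (m : ℝ) - 2 * p) :
    ∃ f : LTwo → LTwo, (∀ M, ∃ L, ∀ v w, ‖v‖ ≤ M → ‖w‖ ≤ M → ‖f v - f w‖ ≤ L * ‖v - w‖) ∧
      ∀ v, Tendsto (fun ε : ℝ => eLpNorm (fun x =>
        (∫ z in {z | ε ≤ |z|}, nlIntegrand q p (antideriv v) x z ∂torusMeasure) - f v x) 2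
          torusMeasure) (𝓝[>] 0) (𝓝 0) := by
  have hmem := fun v => memLp_of_continuous_periodic (continuous_nlForce hq hm v) 2
  have hcoe : ∀ v, ((hmem v).toLp : LTwo) =ᵐ[torusMeasure] nlForce q p (antideriv v) :=
    fun v => MemLp.coeFn_toLp _
  refine ⟨fun v => (hmem v).toLp, fun M => ?_, fun v => ?_⟩
  · obtain ⟨L, hL0, hL⟩ := exists_nlIntegrand_lipschitz hq p M
    set I := ∫ z, |z| ^ ((m : ℝ) - 2 * p) ∂torusMeasure
    have hI : 0 ≤ I := integral_nonneg fun z => by positivity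
    refine ⟨torusMeasure.real univ ^ (2 : ℝ≥0∞).toReal⁻¹ * (L * I), fun v w hv hw => ?_⟩
    rw [mul_assoc]
    refine Lp.norm_le_of_ae_bound (by positivity) ?_
    filter_upwards [Lp.coeFn_sub ((hmem v).toLp : LTwo) (hmem w).toLp, hcoe v, hcoe w]
      with x h1 h2 h3
    rw [h1, Pi.sub_apply, h2, h3, nlForce, nlForce, ← integral_sub
      (integrable_nlIntegrand hq hm v x) (integrable_nlIntegrand hq hm w x)]
    refine (norm_integral_le_of_norm_le ((integrable_abs_rpow hm).const_mul (L * ‖v - w‖))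
      ?_).trans (le_of_eq ?_)
    · filter_upwards [ae_abs_le_pi] with z hz using (hL v w hv hw x z hz).1
    · rw [integral_const_mul]; ring
  · obtain ⟨L, hL0, hL⟩ := exists_nlIntegrand_lipschitz hq p ‖v‖
    -- The omitted part |z| < ε is bounded uniformly in x by the integrable majorant.
    have hbd : ∀ ε : ℝ, eLpNorm (fun x =>
        (∫ z in {z | ε ≤ |z|}, nlIntegrand q p (antideriv v) x z ∂torusMeasure)
          - ((hmem v).toLp : LTwo) x) 2 torusMeasure
        ≤ torusMeasure univ ^ (2 : ℝ≥0∞).toReal⁻¹ * ENNReal.ofReal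
          (L * ∫ z in {z | ε ≤ |z|}ᶜ, |z| ^ ((m : ℝ) - 2 * p) ∂torusMeasure) := fun ε => by
      refine eLpNorm_le_of_ae_bound ?_
      filter_upwards [hcoe v] with x hx
      have hms : MeasurableSet {z : ℝ | ε ≤ |z|} := measurableSet_le measurable_const (by fun_prop)
      rw [hx, nlForce, ← integral_add_compl hms (integrable_nlIntegrand hq hm v x),
        sub_add_cancel_left, norm_neg, ← integral_const_mul]
      refine norm_integral_le_of_norm_le ((integrable_abs_rpow hm).const_mul L).integrableOn
        (ae_restrict_of_ae ?_)
      filter_upwards [ae_abs_le_pi] with z hz using (hL v v le_rfl le_rfl x z hz).2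
    refine tendsto_of_tendsto_of_tendsto_of_le_of_le tendsto_const_nhds ?_
      (fun _ => zero_le) hbd
    have h1 := (tendsto_integral_abs_lt hm).const_mul L
    have h2 := ENNReal.Tendsto.const_mul (a := torusMeasure univ ^ (2 : ℝ≥0∞).toReal⁻¹)
      (ENNReal.tendsto_ofReal h1) (Or.inr (by
        refine ENNReal.rpow_ne_top_of_nonneg (by positivity) (measure_ne_top _ _)))
    simpa using h2

end Profile

/-! ### The linear part of the force -/

lemma sq_norm_intervalIntegral_le {f : ℝ → E3} {a b : ℝ} (hab : a ≤ b)
    (hf : MemLp f 2 (volume.restrict (Ioc a b))) :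
    ‖∫ x in a..b, f x‖ ^ 2 ≤ (b - a) * ∫ x in a..b, ‖f x‖ ^ 2 := by
  rw [intervalIntegral.integral_of_le hab, intervalIntegral.integral_of_le hab]
  refine (pow_le_pow_left₀ (norm_nonneg _) (norm_integral_le_integral_norm _) 2).trans ?_
  refine (sq_integral_le hf.norm).trans (le_of_eq ?_)
  rw [measureReal_restrict_apply_univ, Real.volume_real_Ioc_of_le hab]

/-- Weighted Cauchy-Schwarz inequality. -/
lemma sq_norm_integral_smul_le {f : ℝ → E3} {w : ℝ → ℝ} (hf : Continuous f) (hw : Continuous w)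
    (h0 : ∀ x, 0 ≤ w x) {a b : ℝ} (hab : a ≤ b) :
    ‖∫ x in a..b, w x • f x‖ ^ 2 ≤ (∫ x in a..b, w x) * ∫ x in a..b, w x * ‖f x‖ ^ 2 := by
  set A := ∫ x in a..b, w x
  set B := ∫ x in a..b, w x * ‖f x‖
  set S := ∫ x in a..b, w x * ‖f x‖ ^ 2
  have hA : 0 ≤ A := intervalIntegral.integral_nonneg hab fun x _ => h0 x
  have hS : 0 ≤ S := intervalIntegral.integral_nonneg hab fun x _ => mul_nonneg (h0 x) (sq_nonneg _)
  have hle : ‖∫ x in a..b, w x • f x‖ ≤ B := by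
    refine (intervalIntegral.norm_integral_le_integral_norm hab).trans (le_of_eq ?_)
    simp only [norm_smul, Real.norm_eq_abs, abs_of_nonneg (h0 _), B]
  have key : ∀ c : ℝ, 0 ≤ S - 2 * c * B + c ^ 2 * A := fun c => by
    have : ∫ x in a..b, w x * (‖f x‖ - c) ^ 2 = S - 2 * c * B + c ^ 2 * A := by
      have e : ∀ x, w x * (‖f x‖ - c) ^ 2
          = (w x * ‖f x‖ ^ 2 - 2 * c * (w x * ‖f x‖)) + c ^ 2 * w x := fun x => by ring
      simp only [e]
      rw [intervalIntegral.integral_add (Continuous.intervalIntegrable (by fun_prop) _ _)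
        (Continuous.intervalIntegrable (by fun_prop) _ _), intervalIntegral.integral_sub
        (Continuous.intervalIntegrable (by fun_prop) _ _)
        (Continuous.intervalIntegrable (by fun_prop) _ _), intervalIntegral.integral_const_mul,
        intervalIntegral.integral_const_mul]
    rw [← this]
    exact intervalIntegral.integral_nonneg hab fun x _ => mul_nonneg (h0 x) (sq_nonneg _)
  refine (pow_le_pow_left₀ (norm_nonneg _) hle 2).trans ?_
  -- The quadratic c ↦ A c² - 2B c + S is nonnegative, so B² ≤ AS.
  have := discrim_le_zero (a := A) (b := -(2 * B)) (c := S) fun c => by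
    have := key c
    nlinarith
  rw [discrim] at this
  nlinarith

lemma memLp_two_Ioc_of_continuous {f : ℝ → E3} (hf : Continuous f) (a b : ℝ) :
    MemLp f 2 (volume.restrict (Ioc a b)) := by
  obtain ⟨C, hC⟩ := (isCompact_Icc (a := a) (b := b)).exists_bound_of_continuousOn hf.continuousOn
  refine MemLp.of_bound hf.aestronglyMeasurable C ?_
  filter_upwards [ae_restrict_mem measurableSet_Ioc] with x hx using hC x (Ioc_subset_Icc_self hx)

/-- The `L²` bound for symmetric differences. -/
lemma integral_sq_symm_diff_le (v : LTwo) {a : ℝ} (ha : 0 ≤ a) :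
    ∫ x in (-π)..π, ‖antideriv v (x + a) - antideriv v (x - a)‖ ^ 2
      ≤ 4 * a ^ 2 * ‖centre v‖ ^ 2 := by
  set w := perExt (centre v)
  set N : ℝ → ℝ := fun y => ∫ s in (0 : ℝ)..y, ‖w s‖ ^ 2 with hN
  have hi : ∀ s t, IntervalIntegrable (fun s => ‖w s‖ ^ 2) volume s t :=
    integrable_sq_perExt (centre v)
  have hNc : Continuous N := intervalIntegral.continuous_primitive (fun s t => hi s t) 0
  have hNi : ∀ s t, IntervalIntegrable N volume s t := fun s t => hNc.intervalIntegrable s t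
  -- Cauchy-Schwarz over [x - a, x + a], written with a primitive N of |w|². Integrated over x the
  -- differences of N telescope, since N grows by ‖centre v‖² per period. Averaging in x thus gains
  -- one more power of a than the Hölder bound.
  have hpt : ∀ x, ‖antideriv v (x + a) - antideriv v (x - a)‖ ^ 2
      ≤ 2 * a * (N (x + a) - N (x - a)) := fun x => by
    rw [antideriv_sub_eq, hN]
    simp only
    rw [intervalIntegral.integral_interval_sub_left (hi _ _) (hi _ _)]
    refine (sq_norm_intervalIntegral_le (by linarith)
      (memLp_perExt (centre v) (by linarith))).trans (le_of_eq ?_)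
    ring_nf
    rfl
  have hcont := continuous_antideriv v
  refine (intervalIntegral.integral_mono_on neg_pi_le_pi
    (Continuous.intervalIntegrable (by fun_prop) _ _)
    (g := fun x => 2 * a * (N (x + a) - N (x - a)))
    (Continuous.intervalIntegrable (by fun_prop) _ _) fun x _ => hpt x).trans (le_of_eq ?_)
  rw [intervalIntegral.integral_const_mul, intervalIntegral.integral_sub
    (Continuous.intervalIntegrable (by fun_prop) _ _)
    (Continuous.intervalIntegrable (by fun_prop) _ _),
    intervalIntegral.integral_comp_add_right (f := N),
    intervalIntegral.integral_comp_sub_right (f := N),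
    intervalIntegral.integral_interval_sub_interval_comm' (hNi _ _) (hNi _ _) (hNi _ _)]
  have hshift : ∫ y in (π - a)..(π + a), N y = ∫ y in (-π - a)..(-π + a), N (y + 2 * π) := by
    rw [intervalIntegral.integral_comp_add_right (f := N)]
    congr 1 <;> ring
  rw [hshift, ← intervalIntegral.integral_sub (Continuous.intervalIntegrable (by fun_prop) _ _)
    (hNi _ _)]
  have hNd : ∀ y, N (y + 2 * π) - N y = ‖centre v‖ ^ 2 := fun y => by
    rw [hN]
    simp only
    rw [intervalIntegral.integral_interval_sub_left (hi _ _) (hi _ _), integral_sq_perExt]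
  simp only [hNd, intervalIntegral.integral_const, smul_eq_mul]
  ring

/-- The difference of the averages over the arcs of length `z` on both sides of `x`. -/
def arcDiff (v : LTwo) (x z : ℝ) : E3 := arcMean (antideriv v) x z - arcMean (antideriv v) x (-z)

lemma continuous_arcDiff (v : LTwo) : Continuous fun q : ℝ × ℝ => arcDiff v q.1 q.2 := by
  have h := continuous_arcMean (continuous_antideriv v)
  have h2 : Continuous fun q : ℝ × ℝ => arcMean (antideriv v) q.1 (-q.2) := by
    simpa only [Function.comp_def] using
      h.comp (by fun_prop : Continuous fun q : ℝ × ℝ => (q.1, -q.2))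
  exact h.sub h2

lemma arcDiff_sub (v w : LTwo) (x z : ℝ) : arcDiff (v - w) x z = arcDiff v x z - arcDiff w x z := by
  have e : antideriv (v - w) = fun y => antideriv v y - antideriv w y :=
    funext fun y => antideriv_sub v w y
  rw [arcDiff, e, arcMean_sub (continuous_antideriv v) (continuous_antideriv w),
    arcMean_sub (continuous_antideriv v) (continuous_antideriv w), arcDiff, arcDiff]
  abel

lemma intervalIntegral_swap_of_continuous {F : Type*} [NormedAddCommGroup F] [NormedSpace ℝ F]
    {f : ℝ → ℝ → F} (hf : Continuous fun q : ℝ × ℝ => f q.1 q.2) (a b c d : ℝ) :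
    ∫ x in a..b, ∫ y in c..d, f x y = ∫ y in c..d, ∫ x in a..b, f x y := by
  refine intervalIntegral_intervalIntegral_swap ?_
  refine IntegrableOn.mono_set ?_ (prod_mono uIoc_subset_uIcc uIoc_subset_uIcc)
  exact hf.continuousOn.integrableOn_compact (isCompact_uIcc.prod isCompact_uIcc)

/-- The two averages are paired as u(x + σz) - u(x - σz); Cauchy-Schwarz in σ reduces the claim to
symmetric differences with step σz ≤ z. -/
lemma integral_sq_arcDiff_le (v : LTwo) {z : ℝ} (hz : 0 ≤ z) :
    ∫ x in (-π)..π, ‖arcDiff v x z‖ ^ 2 ≤ 4 * z ^ 2 * ‖centre v‖ ^ 2 := by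
  have hcont := continuous_antideriv v
  have hpt : ∀ x, ‖arcDiff v x z‖ ^ 2
      ≤ ∫ σ in (0 : ℝ)..1, ‖antideriv v (x + σ * z) - antideriv v (x - σ * z)‖ ^ 2 := fun x => by
    have h := sq_norm_intervalIntegral_le (a := 0) (b := 1)
      (f := fun σ => antideriv v (x + σ * z) - antideriv v (x - σ * z)) zero_le_one
      (memLp_two_Ioc_of_continuous (by fun_prop) _ _)
    rw [intervalIntegral.integral_sub (Continuous.intervalIntegrable (by fun_prop) _ _)
      (Continuous.intervalIntegrable (by fun_prop) _ _)] at h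
    rw [norm_sub_rev] at h
    simpa [arcDiff, arcMean] using h
  have h2 : Continuous fun q : ℝ × ℝ =>
      ‖antideriv v (q.1 + q.2 * z) - antideriv v (q.1 - q.2 * z)‖ ^ 2 := by fun_prop
  have h3 : Continuous fun x => ‖arcDiff v x z‖ ^ 2 := by
    have : Continuous fun x => arcDiff v x z := by
      simpa only [Function.comp_def] using
        (continuous_arcDiff v).comp (Continuous.prodMk_left z)
    fun_prop
  refine (intervalIntegral.integral_mono_on neg_pi_le_pi (h3.intervalIntegrable _ _)
    (Continuous.intervalIntegrable
      (intervalIntegral.continuous_parametric_intervalIntegral_of_continuous' h2 0 1) _ _)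
    fun x _ => hpt x).trans ?_
  rw [intervalIntegral_swap_of_continuous h2]
  have := intervalIntegral.integral_mono_on (a := 0) (b := 1) zero_le_one
    (f := fun σ => ∫ x in (-π)..π, ‖antideriv v (x + σ * z) - antideriv v (x - σ * z)‖ ^ 2)
    (g := fun _ => 4 * z ^ 2 * ‖centre v‖ ^ 2)
    (Continuous.intervalIntegrable
      (intervalIntegral.continuous_parametric_intervalIntegral_of_continuous'
        (by fun_prop : Continuous fun q : ℝ × ℝ =>
          ‖antideriv v (q.2 + q.1 * z) - antideriv v (q.2 - q.1 * z)‖ ^ 2) _ _) _ _)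
    ((continuous_const (y := 4 * z ^ 2 * ‖centre v‖ ^ 2)).intervalIntegrable (μ := volume) 0 1)
    fun σ hσ => by
      refine (integral_sq_symm_diff_le v (mul_nonneg hσ.1 hz)).trans ?_
      have : σ * z ≤ z := mul_le_of_le_one_left hz hσ.2
      have := mul_nonneg hσ.1 hz
      gcongr
  simpa using this

/-- The truncated linear part of the force. -/
def linTrunc (p : ℝ) (v : LTwo) (ε x : ℝ) : E3 :=
  ∫ z in ε..π, z ^ (-(2 * p) - 1) • arcDiff v x z

section Linear

variable {p : ℝ}

/-- The maximum changes nothing on [a, b] but stays away from 0, which makes the integrand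
continuous on the whole plane, as parametric continuity and the exchange of integrals require. -/
lemma linTrunc_eq_max (v : LTwo) {a b : ℝ} (hab : a ≤ b) (x : ℝ) :
    ∫ z in a..b, z ^ (-(2 * p) - 1) • arcDiff v x z
      = ∫ z in a..b, (max a z) ^ (-(2 * p) - 1) • arcDiff v x z := by
  refine intervalIntegral.integral_congr fun z hz => ?_
  rw [uIcc_of_le hab] at hz
  simp only [max_eq_right hz.1]

lemma continuous_max_rpow {a : ℝ} (ha : 0 < a) (r : ℝ) : Continuous fun z => (max a z) ^ r :=
  (continuous_const.max continuous_id).rpow_const fun _ =>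
    Or.inl (ha.trans_le (le_max_left _ _)).ne'

lemma continuous_linTrunc_integrand (v : LTwo) {a : ℝ} (ha : 0 < a) (r : ℝ) :
    Continuous fun q : ℝ × ℝ => (max a q.2) ^ r • arcDiff v q.1 q.2 := by
  have h1 : Continuous fun q : ℝ × ℝ => (max a q.2) ^ r := by
    simpa only [Function.comp_def] using (continuous_max_rpow ha r).comp continuous_snd
  exact Continuous.smul h1 (continuous_arcDiff v)

lemma continuous_linTrunc (v : LTwo) {a : ℝ} (ha : 0 < a) (hpi : a ≤ π) :
    Continuous (linTrunc p v a) := by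
  have : linTrunc p v a = fun x => ∫ z in a..π, (max a z) ^ (-(2 * p) - 1) • arcDiff v x z :=
    funext fun x => linTrunc_eq_max v hpi x
  rw [this]
  exact intervalIntegral.continuous_parametric_intervalIntegral_of_continuous'
    (continuous_linTrunc_integrand v ha _) a π

lemma intervalIntegrable_linTrunc (v : LTwo) {a b : ℝ} (ha : 0 < a) (hab : a ≤ b) (x : ℝ) :
    IntervalIntegrable (fun z => z ^ (-(2 * p) - 1) • arcDiff v x z) volume a b := by
  have h : Continuous fun z => (max a z) ^ (-(2 * p) - 1) • arcDiff v x z := by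
    simpa only [Function.comp_def] using
      (continuous_linTrunc_integrand v ha (-(2 * p) - 1)).comp (Continuous.prodMk_right x)
  refine (h.intervalIntegrable a b).congr fun z hz => ?_
  rw [uIoc_of_le hab] at hz
  simp only [max_eq_right hz.1.le]

lemma linTrunc_sub (v w : LTwo) {a : ℝ} (ha : 0 < a) (hpi : a ≤ π) (x : ℝ) :
    linTrunc p (v - w) a x = linTrunc p v a x - linTrunc p w a x := by
  rw [linTrunc, linTrunc, linTrunc, ← intervalIntegral.integral_sub
    (intervalIntegrable_linTrunc v ha hpi x) (intervalIntegrable_linTrunc w ha hpi x)]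
  simp only [arcDiff_sub, smul_sub]

lemma linTrunc_sub_linTrunc (v : LTwo) {a b : ℝ} (ha : 0 < a) (hab : a ≤ b) (hb : b ≤ π) (x : ℝ) :
    linTrunc p v a x - linTrunc p v b x = ∫ z in a..b, z ^ (-(2 * p) - 1) • arcDiff v x z := by
  rw [linTrunc, linTrunc, ← intervalIntegral.integral_add_adjacent_intervals
    (intervalIntegrable_linTrunc v ha hab x) (intervalIntegrable_linTrunc v (ha.trans_le hab) hb x),
    add_sub_cancel_right]

/-- The basic `L²` estimate for the linear part of the force. -/
lemma integral_sq_linTrunc_le (v : LTwo) {a b : ℝ} (ha : 0 < a) (hab : a ≤ b) :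
    ∫ x in (-π)..π, ‖∫ z in a..b, z ^ (-(2 * p) - 1) • arcDiff v x z‖ ^ 2
      ≤ (2 * ‖centre v‖ * ∫ z in a..b, z ^ (-(2 * p))) ^ 2 := by
  set W := ∫ z in a..b, z ^ (-(2 * p)) with hW
  have hpos : ∀ z, 0 < max a z := fun z => ha.trans_le (le_max_left _ _)
  have hwc := continuous_max_rpow ha (-(2 * p))
  have hWe : W = ∫ z in a..b, (max a z) ^ (-(2 * p)) := by
    refine intervalIntegral.integral_congr fun z hz => ?_
    rw [uIcc_of_le hab] at hz
    simp only [max_eq_right hz.1]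
  have hW0 : 0 ≤ W := by
    rw [hWe]
    exact intervalIntegral.integral_nonneg hab fun z _ => Real.rpow_nonneg (hpos z).le _
  have hE := continuous_linTrunc_integrand v ha (-1)
  have hE' : ∀ x, Continuous fun z => (max a z) ^ (-1 : ℝ) • arcDiff v x z := fun x => by
    simpa only [Function.comp_def] using hE.comp (Continuous.prodMk_right x)
  -- The power is split into the weight z^(-2p) and z^(-1), the latter compensating the L² bound
  -- 2z‖centre v‖ of `arcDiff`. Weighted Cauchy-Schwarz and Fubini then act as Minkowski's integral
  -- inequality.
  have hsplit : ∀ x, ∫ z in a..b, z ^ (-(2 * p) - 1) • arcDiff v x z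
      = ∫ z in a..b, (max a z) ^ (-(2 * p)) • ((max a z) ^ (-1 : ℝ) • arcDiff v x z) := fun x => by
    rw [linTrunc_eq_max v hab x]
    simp only [smul_smul, ← Real.rpow_add (hpos _)]
    rfl
  have hwE : Continuous fun q : ℝ × ℝ =>
      (max a q.2) ^ (-(2 * p)) * ‖(max a q.2) ^ (-1 : ℝ) • arcDiff v q.1 q.2‖ ^ 2 := by
    have h1 : Continuous fun q : ℝ × ℝ => (max a q.2) ^ (-(2 * p)) := by
      simpa only [Function.comp_def] using hwc.comp continuous_snd
    exact h1.mul (hE.norm.pow 2)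
  have hleft : Continuous fun x => ∫ z in a..b, z ^ (-(2 * p) - 1) • arcDiff v x z := by
    simp only [linTrunc_eq_max v hab]
    exact intervalIntegral.continuous_parametric_intervalIntegral_of_continuous'
      (continuous_linTrunc_integrand v ha _) a b
  refine (intervalIntegral.integral_mono_on neg_pi_le_pi
    (g := fun x => W * ∫ z in a..b,
      (max a z) ^ (-(2 * p)) * ‖(max a z) ^ (-1 : ℝ) • arcDiff v x z‖ ^ 2)
    ((hleft.norm.pow 2).intervalIntegrable _ _)
    (Continuous.intervalIntegrable (continuous_const.mul
      (intervalIntegral.continuous_parametric_intervalIntegral_of_continuous' hwE a b)) _ _)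
    fun x _ => ?_).trans ?_
  · rw [Pi.pow_apply, hsplit, hWe]
    exact sq_norm_integral_smul_le (hE' x) hwc (fun z => Real.rpow_nonneg (hpos z).le _) hab
  · rw [intervalIntegral.integral_const_mul, intervalIntegral_swap_of_continuous hwE]
    have hin : ∀ z ∈ Icc a b, ∫ x in (-π)..π,
        (max a z) ^ (-(2 * p)) * ‖(max a z) ^ (-1 : ℝ) • arcDiff v x z‖ ^ 2
        ≤ (max a z) ^ (-(2 * p)) * (4 * ‖centre v‖ ^ 2) := fun z hz => by
      rw [intervalIntegral.integral_const_mul]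
      refine mul_le_mul_of_nonneg_left ?_ (Real.rpow_nonneg (hpos z).le _)
      have hz0 : 0 < z := ha.trans_le hz.1
      simp only [max_eq_right hz.1, norm_smul, mul_pow, intervalIntegral.integral_const_mul,
        Real.rpow_neg_one, norm_inv, Real.norm_eq_abs, abs_of_pos hz0]
      have := integral_sq_arcDiff_le v hz0.le
      rw [inv_pow, inv_mul_le_iff₀ (by positivity)]
      linarith
    have hmono := intervalIntegral.integral_mono_on hab
      (f := fun z => ∫ x in (-π)..π,
        (max a z) ^ (-(2 * p)) * ‖(max a z) ^ (-1 : ℝ) • arcDiff v x z‖ ^ 2)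
      (g := fun z => (max a z) ^ (-(2 * p)) * (4 * ‖centre v‖ ^ 2))
      (Continuous.intervalIntegrable
        (intervalIntegral.continuous_parametric_intervalIntegral_of_continuous'
          (f := fun z x => (max a z) ^ (-(2 * p)) * ‖(max a z) ^ (-1 : ℝ) • arcDiff v x z‖ ^ 2)
          (by simpa only [Function.comp_def, Function.uncurry_def, Prod.fst_swap, Prod.snd_swap] using
            hwE.comp continuous_swap) _ _) _ _)
      (Continuous.intervalIntegrable (μ := volume)
        (hwc.mul (continuous_const (y := 4 * ‖centre v‖ ^ 2))) a b) hin
    rw [intervalIntegral.integral_mul_const, ← hWe] at hmono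
    calc _ ≤ W * (W * (4 * ‖centre v‖ ^ 2)) := mul_le_mul_of_nonneg_left hmono hW0
      _ = _ := by ring

lemma integral_rpow_le (hp : p < 1 / 2) {a b : ℝ} (ha : 0 < a) :
    ∫ z in a..b, z ^ (-(2 * p)) ≤ b ^ (1 - 2 * p) / (1 - 2 * p) := by
  rw [integral_rpow (Or.inl (by linarith)), show -(2 * p) + 1 = 1 - 2 * p by ring]
  have h1 : 0 < 1 - 2 * p := by linarith
  gcongr
  linarith [Real.rpow_nonneg ha.le (1 - 2 * p)]

lemma norm_toLp_le_of_integral_sq {f : ℝ → E3} (hf : MemLp f 2 torusMeasure) {M : ℝ} (hM : 0 ≤ M)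
    (h : ∫ x in (-π)..π, ‖f x‖ ^ 2 ≤ M ^ 2) : ‖(hf.toLp : LTwo)‖ ≤ M := by
  refine abs_le_of_sq_le_sq' ?_ hM |>.2
  rw [LTwo.norm_sq_eq]
  refine (le_of_eq (integral_congr_ae ?_)).trans ((integral_torusMeasure _).le.trans h)
  filter_upwards [MemLp.coeFn_toLp hf] with x hx using by rw [hx]

/-- The truncations are linear in v and Cauchy as ε → 0: the pairing of z with -z lowers the
singularity from z^(-2p-1) to z^(-2p), which is integrable at 0 for p < 1/2. -/
lemma exists_linForce (hp : p < 1 / 2) :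
    ∃ f : LTwo → LTwo, (∃ L, ∀ v w, ‖f v - f w‖ ≤ L * ‖v - w‖) ∧
      ∀ v, Tendsto (fun ε : ℝ => eLpNorm (fun x => linTrunc p v ε x - f v x) 2 torusMeasure)
        (𝓝[>] 0) (𝓝 0) := by
  have hr : 0 < 1 - 2 * p := by linarith
  set r := 1 - 2 * p
  have hmem : ∀ v : LTwo, ∀ ε : Ioc 0 π, MemLp (linTrunc p v ε) 2 torusMeasure := fun v ε =>
    memLp_of_continuous_periodic (continuous_linTrunc v ε.2.1 ε.2.2) 2
  set T : Ioc 0 π → LTwo → LTwo := fun ε v => (hmem v ε).toLp with hT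
  have hTe : ∀ ε v, T ε v =ᵐ[torusMeasure] linTrunc p v ε := fun ε v => MemLp.coeFn_toLp _
  have hTsub : ∀ ε v w, T ε v - T ε w = T ε (v - w) := fun ε v w => by
    refine Lp.ext ?_
    filter_upwards [Lp.coeFn_sub (T ε v) (T ε w), hTe ε v, hTe ε w, hTe ε (v - w)]
      with x h1 h2 h3 h4
    rw [h1, h4, Pi.sub_apply, h2, h3, linTrunc_sub v w ε.2.1 ε.2.2]
  set c : ℝ := 2 * holderConst / r with hc
  have hc0 : 0 ≤ c := by have := holderConst_nonneg; positivity
  have hdiff : ∀ (ε ε' : Ioc 0 π) (v : LTwo), ε ≤ ε' → ‖T ε v - T ε' v‖ ≤ c * ‖v‖ * (ε' : ℝ) ^ r := by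
    intro ε ε' v h
    have e : T ε v - T ε' v = ((hmem v ε).sub (hmem v ε')).toLp := (MemLp.toLp_sub _ _).symm
    have hε' : (0 : ℝ) < ε' := ε'.2.1
    rw [e]
    refine norm_toLp_le_of_integral_sq _ (by positivity) ?_
    simp only [Pi.sub_apply, linTrunc_sub_linTrunc v ε.2.1 h ε'.2.2]
    refine (integral_sq_linTrunc_le v ε.2.1 h).trans (pow_le_pow_left₀ ?_ ?_ 2)
    · have := intervalIntegral.integral_nonneg (μ := volume) (f := fun z : ℝ => z ^ (-(2 * p)))
        (show (ε : ℝ) ≤ ε' from h) fun z hz => Real.rpow_nonneg (ε.2.1.le.trans hz.1) _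
      positivity
    · calc _ ≤ 2 * (holderConst * ‖v‖) * ((ε' : ℝ) ^ r / r) := by
            have := norm_centre_le v
            have h2 := integral_rpow_le (b := ε') hp ε.2.1
            have := holderConst_nonneg
            refine mul_le_mul (by rw [holderConst]; linarith) h2 ?_ (by positivity)
            exact intervalIntegral.integral_nonneg (show (ε : ℝ) ≤ ε' from h)
              fun z hz => Real.rpow_nonneg (ε.2.1.le.trans hz.1) _
        _ = _ := by rw [hc]; ring
  set e : ℕ → Ioc 0 π := fun n => ⟨π / (n + 1), by positivity,
    div_le_self Real.pi_pos.le (by linarith [(Nat.cast_nonneg n : (0 : ℝ) ≤ n)])⟩ with he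
  have he_anti : Antitone e := fun m n hmn => by
    rw [← Subtype.coe_le_coe, he]
    simp only
    gcongr
  have he_tend : Tendsto (fun n => (e n : ℝ)) atTop (𝓝 0) := by
    have := (tendsto_one_div_add_atTop_nhds_zero_nat (𝕜 := ℝ)).const_mul π
    simpa [he, div_eq_mul_inv] using this
  have hpow : Tendsto (fun n => (e n : ℝ) ^ r) atTop (𝓝 0) := by
    have := he_tend.rpow_const (p := r) (Or.inr hr.le)
    rwa [Real.zero_rpow hr.ne'] at this
  have hlim : ∀ v, ∃ f, Tendsto (fun n => T (e n) v) atTop (𝓝 f) := fun v => by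
    refine cauchySeq_tendsto_of_complete (cauchySeq_of_le_tendsto_0
      (fun n => 2 * (c * ‖v‖ * (e n : ℝ) ^ r)) (fun n m N hn hm => ?_) ?_)
    · rw [dist_eq_norm, ← sub_add_sub_cancel _ (T (e N) v) _]
      refine (norm_add_le _ _).trans ?_
      rw [norm_sub_rev (T (e N) v)] 
      linarith [hdiff (e n) (e N) v (he_anti hn), hdiff (e m) (e N) v (he_anti hm)]
    · simpa using (hpow.const_mul (c * ‖v‖)).const_mul 2
  choose f hf using hlim
  have hle : ∀ (ε : Ioc 0 π) v, ‖f v - T ε v‖ ≤ c * ‖v‖ * (ε : ℝ) ^ r := fun ε v => by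
    refine le_of_tendsto ((hf v).sub_const (T ε v)).norm ?_
    filter_upwards [he_tend.eventually (Iio_mem_nhds ε.2.1)] with n hn using
      hdiff (e n) ε v hn.le
  -- Truncation at π removes everything, so comparing the limit with it bounds ‖f v‖ by c π^r ‖v‖.
  -- By linearity this is the Lipschitz estimate.
  have hpi : ∀ v, T ⟨π, Real.pi_pos, le_rfl⟩ v = 0 := fun v => by
    refine Lp.ext ?_
    filter_upwards [hTe ⟨π, Real.pi_pos, le_rfl⟩ v, Lp.coeFn_zero E3 2 torusMeasure] with x h1 h2
    rw [h1, h2]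
    simp [linTrunc]
  have hfsub : ∀ v w, f v - f w = f (v - w) := fun v w => by
    refine tendsto_nhds_unique ((hf v).sub (hf w)) ?_
    simp only [hTsub]
    exact hf _
  refine ⟨f, ⟨c * π ^ r, fun v w => ?_⟩, fun v => ?_⟩
  · have := hle ⟨π, Real.pi_pos, le_rfl⟩ (v - w)
    rw [hpi, sub_zero] at this
    rw [hfsub]
    linarith
  · have h1 : Tendsto (fun ε : ℝ => ENNReal.ofReal (c * ‖v‖ * ε ^ r)) (𝓝[>] 0) (𝓝 0) := by
      have h2 : Tendsto (fun ε : ℝ => ε ^ r) (𝓝[>] 0) (𝓝 0) := by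
        have := ((continuous_id (X := ℝ)).tendsto 0).mono_left
          (nhdsWithin_le_nhds (s := Ioi (0 : ℝ))) |>.rpow_const (p := r) (Or.inr hr.le)
        simpa [Real.zero_rpow hr.ne'] using this
      simpa using ENNReal.tendsto_ofReal (h2.const_mul (c * ‖v‖))
    refine tendsto_of_tendsto_of_tendsto_of_le_of_le' tendsto_const_nhds h1
      (Eventually.of_forall fun _ => zero_le) ?_
    filter_upwards [Ioc_mem_nhdsGT Real.pi_pos] with ε hε
    have h3 : eLpNorm (fun x => linTrunc p v ε x - f v x) 2 torusMeasure
        = eLpNorm (f v - T ⟨ε, hε⟩ v : LTwo) 2 torusMeasure := by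
      rw [← eLpNorm_neg]
      refine eLpNorm_congr_ae ?_
      filter_upwards [Lp.coeFn_sub (f v) (T ⟨ε, hε⟩ v), hTe ⟨ε, hε⟩ v] with x h4 h5
      rw [h4, Pi.sub_apply, h5]
      simp
    rw [h3, ← Lp.enorm_def, ← ofReal_norm]
    exact ENNReal.ofReal_le_ofReal (hle ⟨ε, hε⟩ v)

end Linear

/-! ### Profiles of homogeneous kernels -/

section Kernel

variable {K : ℝ → ℝ → ℝ} {g h : ℝ → ℝ} {m : ℕ} {p R : ℝ}

/-- A function whose derivatives of order less than `n` vanish at `1` is `O((x - 1)^n)`. -/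
lemma exists_bound_of_iteratedDerivWithin_eq_zero (n : ℕ) : ∀ f : ℝ → ℝ,
    ContDiffOn ℝ (n : ℕ∞) f (Ici 1) → (∀ j < n, iteratedDerivWithin j f (Ici 1) 1 = 0) →
    ∀ R, ∃ C, 0 ≤ C ∧ ∀ x ∈ Icc 1 R, |f x| ≤ C * (x - 1) ^ n := by
  have huniq : UniqueDiffOn ℝ (Ici (1 : ℝ)) := uniqueDiffOn_Ici 1
  induction n with
  | zero =>
    intro f hf _ R
    obtain ⟨C, hC⟩ := (isCompact_Icc (a := 1) (b := R)).exists_bound_of_continuousOn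
      (hf.continuousOn.mono Icc_subset_Ici_self)
    exact ⟨max C 0, le_max_right _ _, fun x hx => by
      simpa using Or.inl (hC x hx)⟩
  | succ n ih =>
    intro f hf hz R
    -- The induction hypothesis is applied to the derivative; the mean value inequality on [1, x]
    -- then gains one power of x - 1.
    have hf' : ContDiffOn ℝ ((n : ℕ∞) : WithTop ℕ∞) (derivWithin f (Ici 1)) (Ici 1) :=
      hf.derivWithin huniq (by norm_cast)
    obtain ⟨C, hC0, hC⟩ := ih _ hf' (fun j hj => by
      rw [← iteratedDerivWithin_succ']
      exact hz (j + 1) (by omega)) R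
    refine ⟨C, hC0, fun x hx => ?_⟩
    have hd : DifferentiableOn ℝ f (Ici 1) := hf.differentiableOn (by norm_cast)
    have h1 : f 1 = 0 := by simpa using hz 0 (by omega)
    have := (convex_Icc 1 x).norm_image_sub_le_of_norm_hasDerivWithin_le (f := f)
      (f' := derivWithin f (Ici 1)) (C := C * (x - 1) ^ n)
      (fun y hy => ((hd y hy.1).hasDerivWithinAt).mono Icc_subset_Ici_self)
      (fun y hy => (hC y ⟨hy.1, hy.2.trans hx.2⟩).trans (by
        have : 0 ≤ y - 1 := by linarith [hy.1]
        have : y - 1 ≤ x - 1 := by linarith [hy.2]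
        gcongr)) (left_mem_Icc.mpr hx.1) (right_mem_Icc.mpr hx.1)
    rw [h1, sub_zero, Real.norm_eq_abs, Real.norm_eq_abs, abs_of_nonneg (sub_nonneg.mpr hx.1)] at this
    rw [pow_succ, ← mul_assoc]
    exact this

/-- The derivative of g vanishes to order m at 1, hence is O(r^m) within distance r of 1, and the
mean value inequality applies. The value g(1) plays no role. -/
lemma exists_degenerate_lipschitz (hg : ContDiffOn ℝ ((m + 1 : ℕ) : ℕ∞) g (Ici 1))
    (hz : ∀ j, 1 ≤ j → j ≤ m → iteratedDerivWithin j g (Ici 1) 1 = 0) (R : ℝ) :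
    ∃ C, 0 ≤ C ∧ ∀ a ∈ Icc 1 R, ∀ b ∈ Icc 1 R, ∀ r, a - 1 ≤ r → b - 1 ≤ r →
      |g a - g b| ≤ C * r ^ m * |a - b| := by
  have huniq : UniqueDiffOn ℝ (Ici (1 : ℝ)) := uniqueDiffOn_Ici 1
  obtain ⟨C, hC0, hC⟩ := exists_bound_of_iteratedDerivWithin_eq_zero m (derivWithin g (Ici 1))
    (hg.derivWithin huniq (by norm_cast)) (fun j hj => by
      rw [← iteratedDerivWithin_succ']
      exact hz (j + 1) (by omega) (by omega)) R
  have hd : DifferentiableOn ℝ g (Ici 1) := hg.differentiableOn (by norm_cast)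
  refine ⟨C, hC0, fun a ha b hb r har hbr => ?_⟩
  have := (convex_Icc 1 (max a b)).norm_image_sub_le_of_norm_hasDerivWithin_le (f := g)
    (f' := derivWithin g (Ici 1)) (C := C * r ^ m)
    (fun y hy => ((hd y hy.1).hasDerivWithinAt).mono Icc_subset_Ici_self)
    (fun y hy => (hC y ⟨hy.1, hy.2.trans (max_le ha.2 hb.2)⟩).trans (by
      have : 0 ≤ y - 1 := by linarith [hy.1]
      have : y - 1 ≤ r := by
        rcases le_max_iff.mp hy.2 with h | h <;> linarith
      gcongr)) ⟨hb.1, le_max_right _ _⟩ ⟨ha.1, le_max_left _ _⟩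
  simpa [Real.norm_eq_abs] using this

/-- The profile `s ↦ g(1/s) - g(1)`, with `s` restricted to `[1/R, 1]`. -/
def kernelProfile (g : ℝ → ℝ) (R s : ℝ) : ℝ := g (max (min s 1) R⁻¹)⁻¹ - g 1

/-- Clamping to [1/R, 1] makes s ↦ 1/s Lipschitz with constant R², and 1/s - 1 ≤ R(1 - s) carries
smallness of 1 - s over to the argument of g. -/
lemma isProfile_kernelProfile (hR : 1 ≤ R) (hg : ContDiffOn ℝ ((m + 1 : ℕ) : ℕ∞) g (Ici 1))
    (hz : ∀ j, 1 ≤ j → j ≤ m → iteratedDerivWithin j g (Ici 1) 1 = 0) :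
    ∃ C, IsProfile (kernelProfile g R) m C := by
  obtain ⟨C, hC0, hC⟩ := exists_degenerate_lipschitz hg hz R
  have hR0 : 0 < R := by linarith
  have hRi : 0 < R⁻¹ := by positivity
  have hR1 : R⁻¹ ≤ 1 := inv_le_one_of_one_le₀ hR
  set α : ℝ → ℝ := fun s => (max (min s 1) R⁻¹)⁻¹ with hα
  have hpos : ∀ s, 0 < max (min s 1) R⁻¹ := fun s => hRi.trans_le (le_max_right _ _)
  have hle1 : ∀ s, max (min s 1) R⁻¹ ≤ 1 := fun s => max_le (min_le_right _ _) hR1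
  have hα1 : ∀ s, α s ∈ Icc 1 R := fun s =>
    ⟨(one_le_inv₀ (hpos s)).mpr (hle1 s), inv_le_of_inv_le₀ hR0 (le_max_right _ _)⟩
  have hαc : Continuous α := Continuous.inv₀ (by fun_prop) fun s => (hpos s).ne'
  have hαsub : ∀ a b, α a - α b
      = α a * α b * (max (min b 1) R⁻¹ - max (min a 1) R⁻¹) := fun a b => by
    have h1 := (hpos a).ne'
    have h2 := (hpos b).ne'
    simp only [hα]
    field_simp
  have hαpos : ∀ s, 0 ≤ α s := fun s => zero_le_one.trans (hα1 s).1
  have hαlip : ∀ a b, |α a - α b| ≤ R ^ 2 * |a - b| := fun a b => by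
    rw [hαsub, abs_mul, abs_mul, abs_of_nonneg (hαpos a), abs_of_nonneg (hαpos b), sq]
    have h1 : |max (min b 1) R⁻¹ - max (min a 1) R⁻¹| ≤ |a - b| := by
      refine (abs_max_sub_max_le_abs _ _ _).trans ((abs_min_sub_min_le_max _ _ _ _).trans ?_)
      simp [abs_sub_comm]
    exact mul_le_mul (mul_le_mul (hα1 a).2 (hα1 b).2 (hαpos b) hR0.le) h1 (abs_nonneg _)
      (by positivity)
  refine ⟨C * R ^ m * R ^ 2, ⟨?_, ?_, by positivity, fun a b r ha hb har hbr => ?_⟩⟩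
  · refine (hg.continuousOn.comp_continuous hαc fun s => (hα1 s).1).sub continuous_const
  · simp [kernelProfile, hR1]
  · have hdef : ∀ s, s ≤ 1 → α s - 1 ≤ R * (1 - s) := fun s hs => by
      have h := hαsub s 1
      have h1 : α 1 = 1 := by simp [hα, hR1]
      rw [h1] at h
      rw [h, mul_one]
      refine mul_le_mul (hα1 s).2 ?_ ?_ hR0.le
      · rw [min_self, max_eq_left hR1, min_eq_left hs]
        linarith [le_max_left s R⁻¹]
      · rw [min_self, max_eq_left hR1]
        linarith [hle1 s]
    rw [kernelProfile, kernelProfile, sub_sub_sub_cancel_right]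
    have hr : 0 ≤ r := by linarith
    refine (hC (α a) (hα1 a) (α b) (hα1 b) (R * r) ((hdef a ha).trans (by gcongr))
      ((hdef b hb).trans (by gcongr))).trans ?_
    calc _ ≤ C * (R * r) ^ m * (R ^ 2 * |a - b|) :=
          mul_le_mul_of_nonneg_left (hαlip a b) (by positivity)
      _ = _ := by rw [mul_pow]; ring

/-- Chain rule for h(v/w) v^(-p): the factor -v/w² equals -(v/w)²/v, which explains the α² in
`degeneracyFun`. The one-sided derivatives match since w ↦ v/w maps (0, v] into [1, ∞). -/
lemma IsHomogeneous.kernelDeriv_eq (hK : IsHomogeneous K h p) {u v : ℝ} (hu : 0 < u)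
    (huv : u ≤ v) : kernelDeriv K u v = degeneracyFun h (v / u) * v ^ (-p - 1) := by
  have hv : 0 < v := hu.trans_le huv
  have hmem : u ∈ Ioc 0 v := ⟨hu, huv⟩
  have hmaps : MapsTo (fun w => v / w) (Ioc 0 v) (Ici 1) := fun w hw =>
    (one_le_div hw.1).mpr hw.2
  have hd1 : HasDerivWithinAt h (derivWithin h (Ici 1) (v / u)) (Ici 1) (v / u) :=
    (hK.contDiffOn.differentiableOn one_ne_zero _ (hmaps hmem)).hasDerivWithinAt
  have hd2 : HasDerivWithinAt (fun w => v / w) (-v / u ^ 2) (Ioc 0 v) u := by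
    have := ((hasDerivAt_inv hu.ne').const_mul v).hasDerivWithinAt (s := Ioc 0 v)
    simpa [div_eq_mul_inv] using this
  have hd3 := (hd1.comp u hd2 hmaps).mul_const (v ^ (-p))
  have hd4 : HasDerivWithinAt (fun w => K w v)
      (derivWithin h (Ici 1) (v / u) * (-v / u ^ 2) * v ^ (-p)) (Ioc 0 v) u := by
    refine hd3.congr (fun w hw => ?_) ?_
    · have := hK.eq v (v / w) hv (hmaps hw)
      rwa [div_div_cancel₀ hv.ne'] at this
    · have := hK.eq v (v / u) hv (hmaps hmem)
      rwa [div_div_cancel₀ hv.ne'] at this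
  rw [kernelDeriv, hd4.derivWithin (uniqueDiffOn_Ioc 0 v u hmem), degeneracyFun,
    Real.rpow_sub_one hv.ne']
  field_simp

/-! ### The force as a principal value -/

/-- Expresses chords through arc means, which are defined and well behaved for all v, also at z = 0.
-/
lemma inducedCurve_sub (v : LTwo) (x z : ℝ) :
    inducedCurve (antideriv v) x - inducedCurve (antideriv v) (x - z)
      = z • arcMean (antideriv v) x z := by
  have hc := continuous_antideriv v
  rw [inducedCurve, primitive_sub (hc.intervalIntegrable _ _) (hc.intervalIntegrable _ _), arcMean]
  have := intervalIntegral.smul_integral_comp_sub_mul (a := 0) (b := 1) (antideriv v) z x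
  simp only [mul_comm _ z]
  rw [this]
  simp

lemma integral_antideriv_period (v : LTwo) (a : ℝ) : ∫ x in a..a + 2 * π, antideriv v x = 0 := by
  rw [(antideriv_periodic v).integral_period, integral_torusMeasure]
  have := mean_antideriv v
  rw [mean, smul_eq_zero] at this
  exact this.resolve_left (by positivity)

lemma inducedCurve_periodic (v : LTwo) :
    Function.Periodic (inducedCurve (antideriv v)) (2 * π) := fun x => by
  have hc := continuous_antideriv v
  rw [← sub_eq_zero, inducedCurve,
    primitive_sub (hc.intervalIntegrable _ _) (hc.intervalIntegrable _ _),
    integral_antideriv_period]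

lemma theta_periodic : Function.Periodic theta (2 * π) := fun z => by
  simp [theta]

lemma theta_eq_abs {z : ℝ} (hz : |z| ≤ π) : theta z = |z| := by
  rw [theta_eq_min hz, min_eq_left]
  linarith

/-- By periodicity the substitution y = x - z centres the domain at x, where the geodesic distance
is |z|. -/
lemma truncatedForce_eq (K : ℝ → ℝ → ℝ) {γ : ℝ → E3} (hγ : Function.Periodic γ (2 * π))
    (ε x : ℝ) : truncatedForce K γ ε x = ∫ z in {z | ε ≤ |z|},
      kernelDeriv K (‖γ x - γ (x - z)‖ ^ 2) (|z| ^ 2) • (γ x - γ (x - z)) ∂torusMeasure := by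
  set Ψ : ℝ → E3 := fun y => {y | ε ≤ theta (x - y)}.indicator (fun y =>
    kernelDeriv K (‖γ x - γ y‖ ^ 2) (theta (x - y) ^ 2) • (γ x - γ y)) y with hΨ
  have hmeas : Measurable theta := by
    unfold theta
    exact (continuous_norm.comp (AddCircle.continuous_mk' (2 * π))).measurable
  have hθ : ∀ y, theta (x - (y + 2 * π)) = theta (x - y) := fun y => by
    rw [← theta_periodic (x - (y + 2 * π))]
    congr 1; ring
  have hper : Function.Periodic Ψ (2 * π) := fun y => by
    simp only [hΨ, indicator_apply, mem_ofPred_eq, hθ, hγ y]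
  have h1 : truncatedForce K γ ε x = ∫ y in (-π)..π, Ψ y := by
    rw [truncatedForce, inter_comm, ← Measure.restrict_restrict
      (measurableSet_le measurable_const (by fun_prop)), ← integral_indicator
      (measurableSet_le measurable_const (by fun_prop)), ← integral_torusMeasure]
    rfl
  have h2 : ∫ y in (-π)..π, Ψ y = ∫ z in (-π)..π, Ψ (x - z) := by
    rw [intervalIntegral.integral_comp_sub_left]
    have := hper.intervalIntegral_add_eq (-π) (x - π)
    rw [show -π + 2 * π = π by ring, show x - π + 2 * π = x - -π by ring] at this
    exact this
  rw [h1, h2, ← integral_torusMeasure, ← integral_indicator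
    (measurableSet_le measurable_const (by fun_prop))]
  refine integral_congr_ae ?_
  filter_upwards [ae_abs_le_pi] with z hz
  simp only [hΨ, indicator_apply, mem_ofPred_eq, sub_sub_cancel, theta_eq_abs hz]

/-- The region is folded onto [ε, π], which pairs z with -z and exposes the cancellation in the
linear part. -/
lemma setIntegral_torus_abs_ge {F : ℝ → E3} (hF : Continuous F) {ε : ℝ} (hε : 0 < ε)
    (hpi : ε ≤ π) : ∫ z in {z | ε ≤ |z|}, F z ∂torusMeasure = ∫ z in ε..π, (F z + F (-z)) := by
  have hset : {z : ℝ | ε ≤ |z|} ∩ Ioc (-π) π = Icc ε π ∪ Ioc (-π) (-ε) := by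
    ext z
    simp only [mem_inter_iff, mem_ofPred_eq, mem_Ioc, mem_union, mem_Icc, le_abs]
    constructor
    · rintro ⟨h1 | h1, h2, h3⟩
      · exact Or.inl ⟨h1, h3⟩
      · exact Or.inr ⟨h2, by linarith⟩
    · rintro (⟨h1, h2⟩ | ⟨h1, h2⟩)
      · exact ⟨Or.inl h1, by linarith [Real.pi_pos], h2⟩
      · exact ⟨Or.inr (by linarith), h1, by linarith⟩
  have hdisj : Disjoint (Icc ε π) (Ioc (-π) (-ε)) := by
    rw [Set.disjoint_left]
    intro z h1 h2
    linarith [h1.1, h2.2]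
  have hFn : Continuous fun z => F (-z) := by fun_prop
  rw [torusMeasure, Measure.restrict_restrict (measurableSet_le measurable_const (by fun_prop)),
    hset, setIntegral_union hdisj measurableSet_Ioc hF.continuousOn.integrableOn_Icc
      (hF.continuousOn.integrableOn_Icc.mono_set Ioc_subset_Icc_self),
    integral_Icc_eq_integral_Ioc, ← intervalIntegral.integral_of_le hpi,
    ← intervalIntegral.integral_of_le (by linarith),
    intervalIntegral.integral_add (hF.intervalIntegrable _ _) (hFn.intervalIntegrable _ _),
    intervalIntegral.integral_comp_neg]

/-- The integrand of the linear part. -/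
lemma setIntegral_linIntegrand (v : LTwo) (x : ℝ) {ε : ℝ} (hε : 0 < ε) (hpi : ε ≤ π) :
    IntegrableOn (fun z => (|z| ^ (-(2 * p) - 2) * z) • arcMean (antideriv v) x z) {z | ε ≤ |z|}
      torusMeasure ∧
    ∫ z in {z | ε ≤ |z|}, (|z| ^ (-(2 * p) - 2) * z) • arcMean (antideriv v) x z ∂torusMeasure
      = linTrunc p v ε x := by
  have hms : MeasurableSet {z : ℝ | ε ≤ |z|} := measurableSet_le measurable_const (by fun_prop)
  have hc : Continuous fun z => ((max ε |z|) ^ (-(2 * p) - 2) * z) • arcMean (antideriv v) x z := by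
    have h1 : Continuous fun z : ℝ => (max ε |z|) ^ (-(2 * p) - 2) :=
      (by fun_prop : Continuous fun z : ℝ => max ε |z|).rpow_const fun z =>
        Or.inl (hε.trans_le (le_max_left _ _)).ne'
    have h2 := continuous_arcMean_right (continuous_antideriv v) x
    exact Continuous.smul (h1.mul continuous_id) h2
  have heq : EqOn (fun z => ((max ε |z|) ^ (-(2 * p) - 2) * z) • arcMean (antideriv v) x z)
      (fun z => (|z| ^ (-(2 * p) - 2) * z) • arcMean (antideriv v) x z) {z | ε ≤ |z|} :=
    fun z hz => by simp only [max_eq_right (show ε ≤ |z| from hz)]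
  refine ⟨IntegrableOn.congr_fun (integrable_of_continuous_torus hc).integrableOn heq hms, ?_⟩
  rw [← setIntegral_congr_fun hms heq, setIntegral_torus_abs_ge hc hε hpi, linTrunc]
  refine intervalIntegral.integral_congr fun z hz => ?_
  rw [uIcc_of_le hpi] at hz
  have hz0 : 0 < z := hε.trans_le hz.1
  simp only [abs_neg, abs_of_pos hz0, max_eq_right hz.1, mul_neg, neg_smul, arcDiff, smul_sub]
  rw [← Real.rpow_add_one hz0.ne', show -(2 * p) - 2 + 1 = -(2 * p) - 1 by ring]
  exact (sub_eq_add_neg _ _).symm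

/-- For unit fields the squared chord is |z|² s with s the chord ratio, so K_u contributes
g(1/s)|z|^(-2p-2). Writing g(1/s) = g(1) + (g(1/s) - g(1)) separates the linear part from the
absolutely convergent one; the bound s ≥ 1/R makes the clamp in the profile inactive. -/
lemma IsHomogeneous.truncatedForce_eq (hK : IsHomogeneous K h p) (hR : 1 ≤ R) {v : LTwo}
    (h1 : ∀ x, ‖antideriv v x‖ = 1)
    (hchord : ∀ x z, |z| ≤ π → R⁻¹ ≤ chordRatio (antideriv v) x z)
    {C : ℝ} (hq : IsProfile (kernelProfile (degeneracyFun h) R) m C) (hm : -1 < (m : ℝ) - 2 * p)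
    {ε : ℝ} (hε : 0 < ε) (hpi : ε ≤ π) (x : ℝ) :
    truncatedForce K (inducedCurve (antideriv v)) ε x = degeneracyFun h 1 • linTrunc p v ε x
      + ∫ z in {z | ε ≤ |z|},
        nlIntegrand (kernelProfile (degeneracyFun h) R) p (antideriv v) x z ∂torusMeasure := by
  have hms : MeasurableSet {z : ℝ | ε ≤ |z|} := measurableSet_le measurable_const (by fun_prop)
  obtain ⟨hli, hle⟩ := setIntegral_linIntegrand (p := p) v x hε hpi
  have hli' : IntegrableOn (fun z => degeneracyFun h 1 • (|z| ^ (-(2 * p) - 2) * z) •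
      arcMean (antideriv v) x z) {z | ε ≤ |z|} torusMeasure := hli.smul (degeneracyFun h 1)
  rw [CurveFlow.truncatedForce_eq K (inducedCurve_periodic v), ← hle, ← integral_smul,
    ← integral_add hli' (integrable_nlIntegrand hq hm v x).integrableOn]
  refine setIntegral_congr_ae₀ hms.nullMeasurableSet ?_
  filter_upwards [ae_abs_le_pi] with z hz hεz
  have hz0 : 0 < |z| := hε.trans_le hεz
  set s := chordRatio (antideriv v) x z with hs
  have hs0 : 0 < s := lt_of_lt_of_le (by positivity) (hchord x z hz)
  have hs1 : s ≤ 1 := chordRatio_le_one _ _ _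
  have hsq : ‖inducedCurve (antideriv v) x - inducedCurve (antideriv v) (x - z)‖ ^ 2
      = |z| ^ 2 * s := by
    rw [inducedCurve_sub, norm_smul, mul_pow, hs,
      chordRatio_eq_norm_sq (continuous_antideriv v) h1, Real.norm_eq_abs]
  rw [hsq, hK.kernelDeriv_eq (by positivity) (mul_le_of_le_one_right (by positivity) hs1),
    inducedCurve_sub, nlIntegrand, ← hs, kernelProfile, min_eq_left hs1,
    max_eq_left (hchord x z hz), div_mul_cancel_left₀ (by positivity)]
  have hpow : (|z| ^ 2) ^ (-p - 1) = |z| ^ (-(2 * p) - 2) := by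
    rw [← Real.rpow_natCast, ← Real.rpow_mul hz0.le]
    congr 1; push_cast; ring
  simp only [hpow, smul_smul, ← add_smul]
  congr 1
  ring

/-- The principal value defining the force extends to a locally Lipschitz map on `L²`. -/
theorem IsHomogeneous.exists_force_extension (hK : IsHomogeneous K h p)
    (hdeg : IsZeroDegenerate h p ∨ ∃ m : ℕ, IsDegenerate h p m) (hR : 1 ≤ R) :
    ∃ f : LTwo → LTwo, (∀ M, ∃ L, ∀ v w, ‖v‖ ≤ M → ‖w‖ ≤ M → ‖f v - f w‖ ≤ L * ‖v - w‖) ∧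
      ∀ v, (∀ x, ‖antideriv v x‖ = 1) →
        (∀ x z, |z| ≤ π → R⁻¹ ≤ chordRatio (antideriv v) x z) →
        IsPrincipalValue K (inducedCurve (antideriv v)) (f v) ∧
        ∀ᶠ ε in 𝓝[>] (0 : ℝ), AEStronglyMeasurable
          (truncatedForce K (inducedCurve (antideriv v)) ε) torusMeasure := by
  set g := degeneracyFun h
  -- Integrability of |z|^(m-2p) needs m > 2p - 1. For m = 0 this is p < 1/2; otherwise it follows
  -- from m > 4p - 2 and m ≥ 0.
  obtain ⟨m, hm, C, hq⟩ : ∃ m : ℕ, -1 < (m : ℝ) - 2 * p ∧ ∃ C, IsProfile (kernelProfile g R) m C := by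
    rcases hdeg with ⟨hg, hp⟩ | ⟨m, hm, hg, hz⟩
    · refine ⟨0, by push_cast; linarith, isProfile_kernelProfile hR (by simpa using hg)
        fun j h1 h2 => by omega⟩
    · refine ⟨m, ?_, isProfile_kernelProfile hR hg fun j _ h2 => hz j h2⟩
      have : (0 : ℝ) ≤ m := Nat.cast_nonneg m
      linarith
  obtain ⟨fl, ⟨Ll, hLl⟩, hfl⟩ : ∃ f : LTwo → LTwo, (∃ L, ∀ v w, ‖f v - f w‖ ≤ L * ‖v - w‖) ∧
      ∀ v, Tendsto (fun ε : ℝ => eLpNorm (fun x => g 1 • linTrunc p v ε x - f v x) 2 torusMeasure)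
        (𝓝[>] 0) (𝓝 0) := by
    by_cases hp : p < 1 / 2
    · obtain ⟨f, ⟨L, hL⟩, hf⟩ := exists_linForce hp
      refine ⟨fun v => g 1 • f v, ⟨|g 1| * L, fun v w => ?_⟩, fun v => ?_⟩
      · rw [← smul_sub, norm_smul, Real.norm_eq_abs, mul_assoc]
        exact mul_le_mul_of_nonneg_left (hL v w) (abs_nonneg _)
      · have h1 : ∀ ε, eLpNorm (fun x => g 1 • linTrunc p v ε x - (g 1 • f v : LTwo) x) 2 torusMeasure
            = ‖g 1‖ₑ * eLpNorm (fun x => linTrunc p v ε x - f v x) 2 torusMeasure := fun ε => by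
          rw [← eLpNorm_const_smul]
          refine eLpNorm_congr_ae ?_
          filter_upwards [Lp.coeFn_smul (g 1) (f v)] with x hx
          rw [hx, Pi.smul_apply, Pi.smul_apply, smul_sub]
        simp only [h1]
        simpa using ENNReal.Tendsto.const_mul (hf v) (Or.inr enorm_ne_top)
    -- For p ≥ 1/2 the linear part lies outside the estimate, but degeneracy at order 0 makes its
    -- coefficient vanish.
    · have h0 : g 1 = 0 := by
        rcases hdeg with ⟨-, hp'⟩ | ⟨m, -, -, hz⟩
        · exact absurd hp' hp
        · simpa using hz 0 (Nat.zero_le _)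
      refine ⟨fun _ => 0, ⟨0, fun v w => by simp⟩, fun v => ?_⟩
      have h1 : ∀ ε, eLpNorm (fun x => g 1 • linTrunc p v ε x - (0 : LTwo) x) 2 torusMeasure = 0 :=
        fun ε => by
          rw [h0, eLpNorm_congr_ae (g := 0), eLpNorm_zero]
          filter_upwards [Lp.coeFn_zero E3 2 torusMeasure] with x hx
          rw [hx]
          simp
      simp only [h1]
      exact tendsto_const_nhds
  obtain ⟨fn, hLn, hfn⟩ := exists_nlForce hq hm
  refine ⟨fun v => fl v + fn v, fun M => ?_, fun v h1 hchord => ?_⟩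
  · obtain ⟨L, hL⟩ := hLn M
    refine ⟨Ll + L, fun v w hv hw => ?_⟩
    rw [add_sub_add_comm, add_mul]
    exact (norm_add_le _ _).trans (add_le_add (hLl v w) (hL v w hv hw))
  have hcn : ∀ ε : ℝ, AEStronglyMeasurable (fun x => ∫ z in {z | ε ≤ |z|},
      nlIntegrand (kernelProfile g R) p (antideriv v) x z ∂torusMeasure) torusMeasure := fun ε => by
    obtain ⟨L, -, hL⟩ := exists_nlIntegrand_lipschitz hq p ‖v‖
    refine (continuous_of_dominated (bound := fun z => L * |z| ^ ((m : ℝ) - 2 * p))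
      (fun x => (aestronglyMeasurable_nlIntegrand hq.continuous (continuous_antideriv v) x).restrict)
      (fun x => ae_restrict_of_ae ?_) ((integrable_abs_rpow hm).const_mul L).integrableOn
      (Eventually.of_forall fun z => ?_)).aestronglyMeasurable
    · filter_upwards [ae_abs_le_pi] with z hz using (hL v v le_rfl le_rfl x z hz).2
    · exact continuous_nlIntegrand_left hq.continuous (continuous_antideriv v) z
  have heq : ∀ ε ∈ Ioc 0 π, truncatedForce K (inducedCurve (antideriv v)) ε =
      fun x => g 1 • linTrunc p v ε x + ∫ z in {z | ε ≤ |z|},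
        nlIntegrand (kernelProfile g R) p (antideriv v) x z ∂torusMeasure := fun ε hε =>
    funext fun x => hK.truncatedForce_eq hR h1 hchord hq hm hε.1 hε.2 x
  have hcl : ∀ ε ∈ Ioc 0 π, AEStronglyMeasurable (fun x => g 1 • linTrunc p v ε x) torusMeasure :=
    fun ε hε => ((continuous_linTrunc v hε.1 hε.2).const_smul (g 1)).aestronglyMeasurable
  refine ⟨⟨Lp.memLp _, ?_⟩, ?_⟩
  · have hsum := (hfl v).add (hfn v)
    rw [add_zero] at hsum
    refine tendsto_of_tendsto_of_tendsto_of_le_of_le' tendsto_const_nhds hsum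
      (Eventually.of_forall fun _ => zero_le) ?_
    filter_upwards [Ioc_mem_nhdsGT Real.pi_pos] with ε hε
    refine (le_of_eq (eLpNorm_congr_ae ?_)).trans (eLpNorm_add_le
      ((hcl ε hε).sub (Lp.aestronglyMeasurable _)) ((hcn ε).sub (Lp.aestronglyMeasurable _))
      (by norm_num))
    filter_upwards [Lp.coeFn_add (fl v) (fn v)] with x hx
    rw [Pi.sub_apply, hx, heq ε hε]
    simp only [Pi.add_apply]
    abel
  · filter_upwards [Ioc_mem_nhdsGT Real.pi_pos] with ε hε
    rw [heq ε hε]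
    exact (hcl ε hε).add (hcn ε)

/-- Uniqueness of L² limits, where measurability of the truncations is needed for the triangle
inequality. It allows the chosen representative in `pvForce` to be replaced by the constructed
force. -/
lemma IsPrincipalValue.ae_eq {γ f f' : ℝ → E3} (hf : IsPrincipalValue K γ f)
    (hf' : IsPrincipalValue K γ f')
    (hT : ∀ᶠ ε in 𝓝[>] (0 : ℝ), AEStronglyMeasurable (truncatedForce K γ ε) torusMeasure) :
    f =ᵐ[torusMeasure] f' := by
  have h0 : eLpNorm (f - f') 2 torusMeasure ≤ 0 := by
    have hsum := hf.2.add hf'.2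
    rw [add_zero] at hsum
    refine ge_of_tendsto hsum ?_
    filter_upwards [hT] with ε hε
    rw [add_comm, ← sub_sub_sub_cancel_left f' f (truncatedForce K γ ε)]
    exact eLpNorm_sub_le (hε.sub hf'.1.1) (hε.sub hf.1.1) (by norm_num)
  have h1 := (eLpNorm_eq_zero_iff (hf.1.1.sub hf'.1.1) (by norm_num)).mp (le_antisymm h0 zero_le)
  filter_upwards [h1] with x hx
  simpa [sub_eq_zero] using hx

lemma IsPrincipalValue.pvForce_ae_eq {γ f : ℝ → E3} (hf : IsPrincipalValue K γ f)
    (hT : ∀ᶠ ε in 𝓝[>] (0 : ℝ), AEStronglyMeasurable (truncatedForce K γ ε) torusMeasure) :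
    pvForce K γ =ᵐ[torusMeasure] f := by
  have hex : ∃ f, IsPrincipalValue K γ f := ⟨f, hf⟩
  rw [pvForce, dif_pos hex]
  exact hex.choose_spec.ae_eq hf hT

end Kernel

/-! ### Products of `Lᵖ` functions -/

/-- Pointwise inner product `L² × L² → L¹`. -/
def innerTwo : LTwo →L[ℝ] LTwo →L[ℝ] Lp ℝ 1 torusMeasure :=
  (innerSL ℝ : E3 →L[ℝ] E3 →L[ℝ] ℝ).holderL torusMeasure 2 2 1

/-- Pointwise inner product `L^∞ × L^∞ → L^∞`. -/
def innerInf : LInf →L[ℝ] LInf →L[ℝ] Lp ℝ ∞ torusMeasure :=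
  (innerSL ℝ : E3 →L[ℝ] E3 →L[ℝ] ℝ).holderL torusMeasure ∞ ∞ ∞

/-- Pointwise inner product `L^∞ × L² → L²`. -/
def innerInfTwo : LInf →L[ℝ] LTwo →L[ℝ] Lp ℝ 2 torusMeasure :=
  (innerSL ℝ : E3 →L[ℝ] E3 →L[ℝ] ℝ).holderL torusMeasure ∞ 2 2

/-- Pointwise product `L¹ × L^∞ → L¹`. -/
def smulOneInf : Lp ℝ 1 torusMeasure →L[ℝ] LInf →L[ℝ] LOne :=
  (ContinuousLinearMap.lsmul ℝ ℝ : ℝ →L[ℝ] E3 →L[ℝ] E3).holderL torusMeasure 1 ∞ 1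

/-- Pointwise product `L^∞ × L^∞ → L^∞`. -/
def smulInfInf : Lp ℝ ∞ torusMeasure →L[ℝ] LInf →L[ℝ] LInf :=
  (ContinuousLinearMap.lsmul ℝ ℝ : ℝ →L[ℝ] E3 →L[ℝ] E3).holderL torusMeasure ∞ ∞ ∞

/-- Pointwise product `L^∞ × L² → L²`. -/
def smulInfTwo : Lp ℝ ∞ torusMeasure →L[ℝ] LTwo →L[ℝ] LTwo :=
  (ContinuousLinearMap.lsmul ℝ ℝ : ℝ →L[ℝ] E3 →L[ℝ] E3).holderL torusMeasure ∞ 2 2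

/-- Pointwise product `L² × L^∞ → L²`. -/
def smulTwoInf : Lp ℝ 2 torusMeasure →L[ℝ] LInf →L[ℝ] LTwo :=
  (ContinuousLinearMap.lsmul ℝ ℝ : ℝ →L[ℝ] E3 →L[ℝ] E3).holderL torusMeasure 2 ∞ 2

lemma coeFn_innerTwo (f g : LTwo) :
    innerTwo f g =ᵐ[torusMeasure] fun x => inner ℝ (f x) (g x) :=
  ContinuousLinearMap.coeFn_holder (r := 1) _ f g

lemma coeFn_innerInf (f g : LInf) :
    innerInf f g =ᵐ[torusMeasure] fun x => inner ℝ (f x) (g x) :=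
  ContinuousLinearMap.coeFn_holder (r := ∞) _ f g

lemma coeFn_innerInfTwo (f : LInf) (g : LTwo) :
    innerInfTwo f g =ᵐ[torusMeasure] fun x => inner ℝ (f x) (g x) :=
  ContinuousLinearMap.coeFn_holder (r := 2) _ f g

lemma coeFn_smulOneInf (f : Lp ℝ 1 torusMeasure) (g : LInf) :
    smulOneInf f g =ᵐ[torusMeasure] fun x => f x • g x :=
  ContinuousLinearMap.coeFn_holder (r := 1) _ f g

lemma coeFn_smulInfInf (f : Lp ℝ ∞ torusMeasure) (g : LInf) :
    smulInfInf f g =ᵐ[torusMeasure] fun x => f x • g x :=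
  ContinuousLinearMap.coeFn_holder (r := ∞) _ f g

lemma coeFn_smulInfTwo (f : Lp ℝ ∞ torusMeasure) (g : LTwo) :
    smulInfTwo f g =ᵐ[torusMeasure] fun x => f x • g x :=
  ContinuousLinearMap.coeFn_holder (r := 2) _ f g

lemma coeFn_smulTwoInf (f : Lp ℝ 2 torusMeasure) (g : LInf) :
    smulTwoInf f g =ᵐ[torusMeasure] fun x => f x • g x :=
  ContinuousLinearMap.coeFn_holder (r := 2) _ f g

/-- Constants as elements of `L^∞`. -/
def constInf : E3 →L[ℝ] LInf := Lp.constL ∞ torusMeasure ℝ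

lemma coeFn_constInf (c : E3) : constInf c =ᵐ[torusMeasure] fun _ => c :=
  Lp.coeFn_const (p := ∞) (μ := torusMeasure) c

/-! ### Maps that are Lipschitz on balls -/

/-- Lipschitz on bounded sets. -/
def LipOnBalls {X Y : Type*} [NormedAddCommGroup X] [NormedAddCommGroup Y] (f : X → Y) : Prop :=
  ∀ M : ℝ, ∃ L : ℝ, ∀ v w, ‖v‖ ≤ M → ‖w‖ ≤ M → ‖f v - f w‖ ≤ L * ‖v - w‖

section LipOnBalls

set_option linter.unusedSectionVars false

variable {X Y Z W : Type*} [NormedAddCommGroup X] [NormedSpace ℝ X] [NormedAddCommGroup Y]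
  [NormedSpace ℝ Y] [NormedAddCommGroup Z] [NormedSpace ℝ Z] [NormedAddCommGroup W]
  [NormedSpace ℝ W] {f g : X → Y}

lemma LipOnBalls.exists_nonneg (hf : LipOnBalls f) (M : ℝ) :
    ∃ L : ℝ, 0 ≤ L ∧ ∀ v w, ‖v‖ ≤ M → ‖w‖ ≤ M → ‖f v - f w‖ ≤ L * ‖v - w‖ := by
  obtain ⟨L, hL⟩ := hf M
  exact ⟨max L 0, le_max_right _ _, fun v w hv hw => (hL v w hv hw).trans
    (mul_le_mul_of_nonneg_right (le_max_left _ _) (norm_nonneg _))⟩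

lemma LipOnBalls.exists_bound (hf : LipOnBalls f) (M : ℝ) :
    ∃ C : ℝ, 0 ≤ C ∧ ∀ v, ‖v‖ ≤ M → ‖f v‖ ≤ C := by
  rcases lt_or_ge M 0 with hM | hM
  · exact ⟨0, le_rfl, fun v hv => absurd ((norm_nonneg v).trans hv) (not_le.mpr hM)⟩
  obtain ⟨L, hL0, hL⟩ := hf.exists_nonneg M
  refine ⟨‖f 0‖ + L * M, by positivity, fun v hv => ?_⟩
  have h1 := hL v 0 hv (by simpa using hM)
  rw [sub_zero] at h1
  have h2 : ‖f v‖ ≤ ‖f v - f 0‖ + ‖f 0‖ := by simpa using norm_add_le (f v - f 0) (f 0)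
  have h3 : L * ‖v‖ ≤ L * M := by gcongr
  linarith

lemma _root_.ContinuousLinearMap.lipOnBalls (ℓ : X →L[ℝ] Y) : LipOnBalls ℓ := fun _ =>
  ⟨‖ℓ‖, fun v w _ _ => by rw [← map_sub]; exact ℓ.le_opNorm _⟩

lemma LipOnBalls.clm_comp (hf : LipOnBalls f) (ℓ : Y →L[ℝ] Z) : LipOnBalls fun v => ℓ (f v) :=
  fun M => by
    obtain ⟨L, hL⟩ := hf M
    refine ⟨‖ℓ‖ * L, fun v w hv hw => ?_⟩
    rw [← map_sub, mul_assoc]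
    exact (ℓ.le_opNorm _).trans (mul_le_mul_of_nonneg_left (hL v w hv hw) (norm_nonneg _))

lemma LipOnBalls.add (hf : LipOnBalls f) (hg : LipOnBalls g) : LipOnBalls fun v => f v + g v :=
  fun M => by
    obtain ⟨L₁, h₁⟩ := hf M
    obtain ⟨L₂, h₂⟩ := hg M
    refine ⟨L₁ + L₂, fun v w hv hw => ?_⟩
    rw [add_sub_add_comm, add_mul]
    exact (norm_add_le _ _).trans (add_le_add (h₁ v w hv hw) (h₂ v w hv hw))

lemma LipOnBalls.sub (hf : LipOnBalls f) (hg : LipOnBalls g) : LipOnBalls fun v => f v - g v := by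
  have h := hf.add (hg.clm_comp (-ContinuousLinearMap.id ℝ Y))
  simpa only [sub_eq_add_neg, _root_.neg_apply, ContinuousLinearMap.id_apply] using h

/-- Every product in the lower order terms is a bounded bilinear map between Lebesgue spaces, by
Hölder's inequality, so this one product rule covers them all. -/
lemma LipOnBalls.bilin {g : X → Z} (hf : LipOnBalls f) (hg : LipOnBalls g)
    (B : Y →L[ℝ] Z →L[ℝ] W) : LipOnBalls fun v => B (f v) (g v) := fun M => by
  obtain ⟨L₁, hL₁, h₁⟩ := hf.exists_nonneg M
  obtain ⟨L₂, hL₂, h₂⟩ := hg.exists_nonneg M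
  obtain ⟨C₁, hC₁, hb₁⟩ := hf.exists_bound M
  obtain ⟨C₂, hC₂, hb₂⟩ := hg.exists_bound M
  refine ⟨‖B‖ * L₁ * C₂ + ‖B‖ * C₁ * L₂, fun v w hv hw => ?_⟩
  have e : B (f v) (g v) - B (f w) (g w) = B (f v - f w) (g v) + B (f w) (g v - g w) := by
    simp only [map_sub, _root_.sub_apply]
    abel
  rw [e]
  calc _ ≤ ‖B‖ * ‖f v - f w‖ * ‖g v‖ + ‖B‖ * ‖f w‖ * ‖g v - g w‖ :=
        (norm_add_le _ _).trans (add_le_add (B.le_opNorm₂ _ _) (B.le_opNorm₂ _ _))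
    _ ≤ ‖B‖ * (L₁ * ‖v - w‖) * C₂ + ‖B‖ * C₁ * (L₂ * ‖v - w‖) := by
        have := h₁ v w hv hw
        have := h₂ v w hv hw
        have := hb₁ w hw
        have := hb₂ v hv
        gcongr
    _ = _ := by ring

/-- The radial retraction onto the ball of radius `R`. -/
def radial (R : ℝ) (v : X) : X := (R / max R ‖v‖) • v

lemma radial_of_le {R : ℝ} (hR : 0 < R) {v : X} (hv : ‖v‖ ≤ R) : radial R v = v := by
  rw [radial, max_eq_left hv, div_self hR.ne', one_smul]

lemma norm_radial_le {R : ℝ} (hR : 0 < R) (v : X) : ‖radial R v‖ ≤ R := by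
  have hm : 0 < max R ‖v‖ := hR.trans_le (le_max_left _ _)
  rw [radial, norm_smul, Real.norm_eq_abs, abs_of_nonneg (by positivity), div_mul_eq_mul_div,
    div_le_iff₀ hm]
  exact mul_le_mul_of_nonneg_left (le_max_right _ _) hR.le

lemma norm_radial_sub_le {R : ℝ} (hR : 0 < R) (v w : X) :
    ‖radial R v - radial R w‖ ≤ 2 * ‖v - w‖ := by
  have hm : ∀ v : X, 0 < max R ‖v‖ := fun v => hR.trans_le (le_max_left _ _)
  have e : radial R v - radial R w
      = (R / max R ‖v‖) • (v - w) + ((max R ‖w‖ - max R ‖v‖) / max R ‖v‖) • radial R w := by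
    have h1 := (hm v).ne'
    have h2 := (hm w).ne'
    have h3 : (max R ‖w‖ - max R ‖v‖) / max R ‖v‖ * (R / max R ‖w‖)
        = R / max R ‖v‖ - R / max R ‖w‖ := by field_simp
    rw [radial, radial, smul_smul, h3, smul_sub, sub_smul]
    abel
  have h1 : |max R ‖w‖ - max R ‖v‖| ≤ ‖v - w‖ := by
    refine (abs_max_sub_max_le_max R ‖w‖ R ‖v‖).trans ?_
    rw [sub_self, abs_zero, norm_sub_rev]
    exact max_le (norm_nonneg _) (abs_norm_sub_norm_le _ _)
  rw [e]
  refine (norm_add_le _ _).trans ?_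
  rw [norm_smul, norm_smul, Real.norm_eq_abs, Real.norm_eq_abs, abs_div, abs_div,
    abs_of_pos (hm v), abs_of_pos hR]
  have h2 : R / max R ‖v‖ * ‖v - w‖ ≤ ‖v - w‖ :=
    mul_le_of_le_one_left (norm_nonneg _) ((div_le_one (hm v)).mpr (le_max_left _ _))
  have h3 : |max R ‖w‖ - max R ‖v‖| / max R ‖v‖ * ‖radial R w‖ ≤ ‖v - w‖ := by
    rw [div_mul_eq_mul_div, div_le_iff₀ (hm v)]
    exact mul_le_mul h1 ((norm_radial_le hR w).trans (le_max_left _ _)) (norm_nonneg _)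
      (norm_nonneg _)
  linarith

/-- Precomposition with the retraction gives a global Lipschitz constant and leaves the map
unchanged on the ball. -/
lemma LipOnBalls.exists_lipschitz_radial (hf : LipOnBalls f) {R : ℝ} (hR : 0 < R) :
    ∃ L, LipschitzWith L fun v => f (radial R v) := by
  obtain ⟨L, hL0, hL⟩ := hf.exists_nonneg R
  refine ⟨(L * 2).toNNReal, LipschitzWith.of_dist_le_mul fun v w => ?_⟩
  rw [dist_eq_norm, dist_eq_norm, Real.coe_toNNReal _ (by positivity), mul_assoc]
  exact (hL _ _ (norm_radial_le hR v) (norm_radial_le hR w)).trans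
    (mul_le_mul_of_nonneg_left (norm_radial_sub_le hR v w) hL0)

end LipOnBalls

/-! ### The Lagrange multiplier equation -/

lemma mean_eq_torus {F : Type*} [NormedAddCommGroup F] [NormedSpace ℝ F] (f : ℝ → F) :
    mean f = (2 * π)⁻¹ • ∫ x, f x ∂torusMeasure := by rw [mean, integral_torusMeasure]

lemma mean_clm_comp {F F' : Type*} [NormedAddCommGroup F] [NormedSpace ℝ F] [CompleteSpace F]
    [NormedAddCommGroup F'] [NormedSpace ℝ F'] [CompleteSpace F'] (ℓ : F →L[ℝ] F') {f : ℝ → F}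
    (hf : Integrable f torusMeasure) : mean (fun x => ℓ (f x)) = ℓ (mean f) := by
  rw [mean_eq_torus, mean_eq_torus, ℓ.integral_comp_comm hf, map_smul]

lemma mean_add {F : Type*} [NormedAddCommGroup F] [NormedSpace ℝ F] {f g : ℝ → F}
    (hf : Integrable f torusMeasure) (hg : Integrable g torusMeasure) :
    mean (fun x => f x + g x) = mean f + mean g := by
  rw [mean_eq_torus, mean_eq_torus, mean_eq_torus, integral_add hf hg, smul_add]

lemma mean_sub {F : Type*} [NormedAddCommGroup F] [NormedSpace ℝ F] {f g : ℝ → F}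
    (hf : Integrable f torusMeasure) (hg : Integrable g torusMeasure) :
    mean (fun x => f x - g x) = mean f - mean g := by
  rw [mean_eq_torus, mean_eq_torus, mean_eq_torus, integral_sub hf hg, smul_sub]

lemma mean_const {F : Type*} [NormedAddCommGroup F] [NormedSpace ℝ F] [CompleteSpace F] (c : F) :
    mean (fun _ : ℝ => c) = c := by
  rw [mean_eq_torus, integral_const, torusMeasure_real_univ, inv_smul_smul₀ (by positivity)]

lemma norm_mean_le {F : Type*} [NormedAddCommGroup F] [NormedSpace ℝ F] {f : ℝ → F} {C : ℝ}
    (hf : ∀ x, ‖f x‖ ≤ C) : ‖mean f‖ ≤ C := by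
  have := intervalIntegral.norm_integral_le_of_norm_le_const (a := -π) (b := π) (f := f) (C := C)
    fun x _ => hf x
  rw [show π - -π = 2 * π by ring, abs_of_pos Real.two_pi_pos] at this
  rw [mean, norm_smul, norm_inv, Real.norm_eq_abs, abs_of_pos Real.two_pi_pos,
    inv_mul_le_iff₀ Real.two_pi_pos]
  linarith

/-- The linear map `w ↦ mean (⟨u, w⟩ u)`. -/
def gram (u : ℝ → E3) (w : E3) : E3 := mean fun x => (inner ℝ (u x) w : ℝ) • u x

section Gram

variable {u u' : ℝ → E3}

lemma integrable_gram (hu : Continuous u) (w : E3) :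
    Integrable (fun x => (inner ℝ (u x) w : ℝ) • u x) torusMeasure :=
  integrable_of_continuous_torus (by fun_prop)

lemma gram_sub (hu : Continuous u) (w w' : E3) : gram u (w - w') = gram u w - gram u w' := by
  rw [gram, gram, gram, ← mean_sub (integrable_gram hu w) (integrable_gram hu w')]
  simp only [inner_sub_right, sub_smul]

lemma gram_add (hu : Continuous u) (w w' : E3) : gram u (w + w') = gram u w + gram u w' := by
  rw [gram, gram, gram, ← mean_add (integrable_gram hu w) (integrable_gram hu w')]
  simp only [inner_add_right, add_smul]

lemma gram_smul (u : ℝ → E3) (c : ℝ) (w : E3) : gram u (c • w) = c • gram u w := by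
  simp only [gram, mean, inner_smul_right, mul_smul, intervalIntegral.integral_smul]
  rw [smul_comm]

lemma inner_gram (hu : Continuous u) (w : E3) :
    inner ℝ w (gram u w) = mean fun x => (inner ℝ (u x) w : ℝ) ^ 2 := by
  have := mean_clm_comp (innerSL ℝ w) (integrable_gram hu w)
  simp only [innerSL_apply_apply, inner_smul_right] at this
  rw [gram, ← this]
  congr 1
  ext x
  rw [real_inner_comm, sq]

lemma norm_gram_sub_le (hu : Continuous u) (hu' : Continuous u') {C D : ℝ}
    (h : ∀ x, ‖u x‖ ≤ C) (h' : ∀ x, ‖u' x‖ ≤ C) (hD : ∀ x, ‖u x - u' x‖ ≤ D) (w : E3) :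
    ‖gram u w - gram u' w‖ ≤ 2 * C * D * ‖w‖ := by
  have hC : 0 ≤ C := (norm_nonneg _).trans (h 0)
  rw [gram, gram, ← mean_sub (integrable_gram hu w) (integrable_gram hu' w)]
  refine norm_mean_le fun x => ?_
  have e : (inner ℝ (u x) w : ℝ) • u x - (inner ℝ (u' x) w : ℝ) • u' x
      = (inner ℝ (u x - u' x) w : ℝ) • u x + (inner ℝ (u' x) w : ℝ) • (u x - u' x) := by
    rw [inner_sub_left, sub_smul, smul_sub]
    abel
  rw [e]
  refine (norm_add_le _ _).trans ?_
  rw [norm_smul, norm_smul]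
  have h1 : ‖(inner ℝ (u x - u' x) w : ℝ)‖ ≤ D * ‖w‖ :=
    (norm_inner_le_norm _ _).trans (mul_le_mul_of_nonneg_right (hD x) (norm_nonneg _))
  have h2 : ‖(inner ℝ (u' x) w : ℝ)‖ ≤ C * ‖w‖ :=
    (norm_inner_le_norm _ _).trans (mul_le_mul_of_nonneg_right (h' x) (norm_nonneg _))
  have hD0 : 0 ≤ D := (norm_nonneg _).trans (hD x)
  calc _ ≤ D * ‖w‖ * C + C * ‖w‖ * D := by
        have := h x
        have := hD x
        gcongr
    _ = _ := by ring

/-- `Id - mean (u ⊗ u)` is bounded below by `c`. -/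
def IsGramCoercive (c : ℝ) (u : ℝ → E3) : Prop :=
  ∀ w : E3, c * ‖w‖ ^ 2 ≤ ‖w‖ ^ 2 - mean fun x => (inner ℝ (u x) w : ℝ) ^ 2

/-- Coercivity reads c‖w‖² ≤ ⟨w, w - gram u w⟩; Cauchy-Schwarz removes one factor ‖w‖. -/
lemma IsGramCoercive.norm_le {c : ℝ} (hc : IsGramCoercive c u) (hu : Continuous u) (w : E3) :
    c * ‖w‖ ≤ ‖w - gram u w‖ := by
  rcases eq_or_ne w 0 with rfl | hw
  · simp
  have h := hc w
  rw [← inner_gram hu, ← real_inner_self_eq_norm_sq, ← inner_sub_right,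
    real_inner_self_eq_norm_sq] at h
  have h2 := h.trans (real_inner_le_norm _ _)
  have hw0 : 0 < ‖w‖ := norm_pos_iff.mpr hw
  nlinarith

lemma IsGramCoercive.exists_solution {c : ℝ} (hc0 : 0 < c) (hc : IsGramCoercive c u) (hu : Continuous u)
    (b : E3) : ∃ l, l - gram u l = b := by
  let A : E3 →ₗ[ℝ] E3 :=
    { toFun := fun w => w - gram u w
      map_add' := fun w w' => by rw [gram_add hu]; abel
      map_smul' := fun a w => by rw [gram_smul, RingHom.id_apply, smul_sub] }
  have hinj : Function.Injective A := by
    rw [← LinearMap.ker_eq_bot, LinearMap.ker_eq_bot']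
    intro w hw
    have := hc.norm_le hu w
    rw [show w - gram u w = 0 from hw, norm_zero] at this
    exact norm_eq_zero.mp (le_antisymm (nonpos_of_mul_nonpos_right this hc0) (norm_nonneg _))
  exact (LinearMap.injective_iff_surjective.mp hinj) b

/-- The matrix inverse is a total function, so det ≠ 0 has to be derived, here from coercivity. Unit
length removes the denominators in `multiplierMatrix`. -/
lemma IsGramCoercive.toEuclideanLin_inv {c : ℝ} (hc0 : 0 < c) (hc : IsGramCoercive c u)
    (hu : Continuous u) (h1 : ∀ x, ‖u x‖ = 1) (l : E3) :
    Matrix.toEuclideanLin (multiplierMatrix u)⁻¹ (l - gram u l) = l := by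
  set M := multiplierMatrix u with hM
  have hMw : ∀ w : E3, WithLp.toLp 2 (M.mulVec w.ofLp) = w - gram u w := fun w => by
    ext i
    have h2 : gram u w i = mean fun x => (inner ℝ (u x) w : ℝ) * u x i := by
      have := mean_clm_comp (EuclideanSpace.proj (𝕜 := ℝ) i) (integrable_gram hu w)
      simpa [gram] using this.symm
    have h3 : (fun x => (inner ℝ (u x) w : ℝ) * u x i)
        = fun x => ∑ j, (u x i * u x j) * w j := by
      ext x
      rw [PiLp.inner_apply, Finset.sum_mul]
      refine Finset.sum_congr rfl fun j _ => ?_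
      simp only [RCLike.inner_apply, conj_trivial]
      ring
    have h4 : mean (fun x => ∑ j, (u x i * u x j) * w j)
        = ∑ j, mean (fun x => u x i * u x j) * w j := by
      simp only [mean, smul_eq_mul]
      rw [intervalIntegral.integral_finsetSum fun j _ =>
        Continuous.intervalIntegrable (by fun_prop) _ _, Finset.mul_sum]
      refine Finset.sum_congr rfl fun j _ => ?_
      rw [intervalIntegral.integral_mul_const, mul_assoc]
    rw [PiLp.sub_apply, h2, h3, h4]
    simp only [hM, multiplierMatrix, Matrix.sub_mulVec, Matrix.one_mulVec, h1, one_pow, div_one]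
    rfl
  have hdet : M.det ≠ 0 := fun h0 => by
    obtain ⟨w, hw, hMw0⟩ := Matrix.exists_mulVec_eq_zero_iff.mpr h0
    have h5 := hc.norm_le hu (WithLp.toLp 2 w)
    rw [← hMw, hMw0] at h5
    simp only [WithLp.toLp_zero, norm_zero] at h5
    have := norm_eq_zero.mp (le_antisymm (nonpos_of_mul_nonpos_right h5 hc0) (norm_nonneg _))
    exact hw (by simpa using this)
  rw [← hMw, Matrix.toLpLin_apply, Matrix.mulVec_mulVec,
    Matrix.nonsing_inv_mul _ (isUnit_iff_ne_zero.mpr hdet), Matrix.one_mulVec]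

end Gram

/-! ### The nonlinearity -/

/-- Quantitative bounds on a tangent field with derivative `v`. -/
structure Regular (R : ℝ) (v : LTwo) : Prop where
  norm_le : ‖v‖ ≤ R
  chord : ∀ x z, |z| ≤ π → R⁻¹ ≤ chordRatio (antideriv v) x z
  coercive : IsGramCoercive R⁻¹ (antideriv v)

lemma lipOnBalls_antiInf : LipOnBalls antiInf := antiInf.lipOnBalls

lemma memLp_top_antideriv (v : LTwo) : MemLp (antideriv v) ∞ torusMeasure :=
  memLp_of_continuous_periodic (continuous_antideriv v) ∞

lemma coeFn_product_one (v : LTwo) (b : LInf) :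
    infToOne (smulInfInf (innerInf b (antiInf v)) (antiInf v)) =ᵐ[torusMeasure]
      fun x => (inner ℝ (b x) (antideriv v x) : ℝ) • antideriv v x := by
  filter_upwards [coeFn_infToOne (smulInfInf (innerInf b (antiInf v)) (antiInf v)),
    coeFn_smulInfInf (innerInf b (antiInf v)) (antiInf v), coeFn_innerInf b (antiInf v),
    coeFn_antiInf v] with x h1 h2 h3 h4
  rw [h1, h2, h3, h4]

lemma coeFn_sq_smul (v : LTwo) : smulOneInf (innerTwo v v) (antiInf v) =ᵐ[torusMeasure]
    fun x => (‖v x‖ ^ 2) • antideriv v x := by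
  filter_upwards [coeFn_smulOneInf (innerTwo v v) (antiInf v), coeFn_innerTwo v v,
    coeFn_antiInf v] with x h1 h2 h3
  rw [h1, h2, h3, real_inner_self_eq_norm_sq]

/-- The right-hand side of the multiplier equation. -/
def multiplierRhs (F : LInf) (v : LTwo) : E3 :=
  meanL (infToOne (smulInfInf (innerInf F (antiInf v)) (antiInf v))
    - smulOneInf (innerTwo v v) (antiInf v))

/-- `a + (|v|² - ⟨a, u⟩) u`, where `u` is the primitive of `v`. -/
def projected (a : LInf) (v : LTwo) : LOne :=
  infToOne a + smulOneInf (innerTwo v v) (antiInf v)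
    - infToOne (smulInfInf (innerInf a (antiInf v)) (antiInf v))

lemma coeFn_projected (a : LInf) (v : LTwo) : projected a v =ᵐ[torusMeasure]
    fun x => a x + (‖v x‖ ^ 2 - inner ℝ (a x) (antideriv v x)) • antideriv v x := by
  filter_upwards [coeFn_product_one v a, coeFn_sq_smul v, coeFn_infToOne a,
    Lp.coeFn_sub (infToOne a + smulOneInf (innerTwo v v) (antiInf v))
      (infToOne (smulInfInf (innerInf a (antiInf v)) (antiInf v))),
    Lp.coeFn_add (infToOne a) (smulOneInf (innerTwo v v) (antiInf v))] with x h1 h2 h3 h4 h5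
  rw [projected, h4, Pi.sub_apply, h5, Pi.add_apply, h1, h2, h3, sub_smul]
  abel

lemma coeFn_multiplierRhs (F : LInf) (v : LTwo) :
    multiplierRhs F v = mean fun x =>
      ((inner ℝ (F x) (antideriv v x) - ‖v x‖ ^ 2 : ℝ)) • antideriv v x := by
  rw [multiplierRhs, meanL_apply]
  refine mean_congr_ae ?_
  filter_upwards [Lp.coeFn_sub (infToOne (smulInfInf (innerInf F (antiInf v)) (antiInf v)))
    (smulOneInf (innerTwo v v) (antiInf v)), coeFn_product_one v F, coeFn_sq_smul v]
    with x h1 h2 h3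
  rw [h1, Pi.sub_apply, h2, h3, sub_smul]

lemma meanL_product_const (v : LTwo) (l : E3) :
    meanL (infToOne (smulInfInf (innerInf (constInf l) (antiInf v)) (antiInf v)))
      = gram (antideriv v) l := by
  rw [meanL_apply, gram]
  refine mean_congr_ae ?_
  filter_upwards [coeFn_product_one v (constInf l), coeFn_constInf l] with x h1 h2
  rw [h1, h2, real_inner_comm]

lemma meanL_constInf (l : E3) : meanL (infToOne (constInf l)) = l := by
  rw [meanL_apply]
  refine (mean_congr_ae (g := fun _ => l) ?_).trans (mean_const l)
  filter_upwards [coeFn_infToOne (constInf l), coeFn_constInf l] with x h1 h2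
  rw [h1, h2]

lemma meanL_primInf (f : LOne) : meanL (infToOne (primInf f)) = 0 := by
  rw [meanL_apply, ← mean_primitive f.integrable]
  refine mean_congr_ae ?_
  filter_upwards [coeFn_infToOne (primInf f), coeFn_primInf f] with x h1 h2
  rw [h1, h2]

/-- The multiplier equation says exactly that this mean is zero, which is why the flow preserves
mean zero and curves stay closed. -/
lemma meanL_projected (F : LInf) (l : E3) (v : LTwo) (hF : meanL (infToOne F) = 0) :
    meanL (projected (F + constInf l) v) = l - gram (antideriv v) l - multiplierRhs F v := by
  simp only [projected, multiplierRhs, map_add, map_sub, _root_.add_apply, hF, meanL_constInf,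
    meanL_product_const]
  abel

lemma LipOnBalls.multiplierRhs {F : LTwo → LInf} (hF : LipOnBalls F) :
    LipOnBalls fun v => multiplierRhs (F v) v :=
  LipOnBalls.clm_comp ((((hF.bilin lipOnBalls_antiInf innerInf).bilin lipOnBalls_antiInf
    smulInfInf).clm_comp infToOne).sub
    (((ContinuousLinearMap.id ℝ LTwo).lipOnBalls.bilin
      (ContinuousLinearMap.id ℝ LTwo).lipOnBalls innerTwo).bilin lipOnBalls_antiInf smulOneInf))
    meanL

lemma LipOnBalls.projected {a : LTwo → LInf} (ha : LipOnBalls a) :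
    LipOnBalls fun v => projected (a v) v :=
  ((ha.clm_comp infToOne).add
    (((ContinuousLinearMap.id ℝ LTwo).lipOnBalls.bilin
      (ContinuousLinearMap.id ℝ LTwo).lipOnBalls innerTwo).bilin lipOnBalls_antiInf smulOneInf)).sub
    (((ha.bilin lipOnBalls_antiInf innerInf).bilin lipOnBalls_antiInf smulInfInf).clm_comp infToOne)

/-- The solution of the multiplier equation extends to a globally Lipschitz map. -/
lemma exists_multiplier {R : ℝ} (hR : 0 < R) {b : LTwo → E3} (hb : LipOnBalls b) :
    ∃ l : LTwo → E3, (∃ L, LipschitzWith L l) ∧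
      ∀ v, Regular R v → l v - gram (antideriv v) (l v) = b v := by
  have hex : ∀ v, Regular R v → ∃ l, l - gram (antideriv v) l = b v := fun v hv =>
    hv.coercive.exists_solution (by positivity) (continuous_antideriv v) _
  choose! l hl using hex
  obtain ⟨L, hL0, hL⟩ := hb.exists_nonneg R
  obtain ⟨C, hC0, hC⟩ := hb.exists_bound R
  obtain ⟨B, hB0, hB⟩ := exists_norm_antideriv_le
  have hlb : ∀ v, Regular R v → ‖l v‖ ≤ R * C := fun v hv => by
    have h := hv.coercive.norm_le (continuous_antideriv v) (l v)
    rw [hl v hv, inv_mul_le_iff₀ hR] at h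
    exact h.trans (mul_le_mul_of_nonneg_left (hC v hv.norm_le) hR.le)
  -- The two multiplier equations are subtracted, and coercivity at v controls `l v - l w` by the
  -- changes of right-hand side and Gram map.
  have hlip : LipschitzOnWith (R * (L + 2 * (B * R) * B * (R * C))).toNNReal l {v | Regular R v} := by
    refine LipschitzOnWith.of_dist_le_mul fun v hv w hw => ?_
    replace hv : Regular R v := hv
    replace hw : Regular R w := hw
    rw [dist_eq_norm, dist_eq_norm, Real.coe_toNNReal _ (by positivity)]
    have h := hv.coercive.norm_le (continuous_antideriv v) (l v - l w)
    rw [inv_mul_le_iff₀ hR] at h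
    refine h.trans ?_
    rw [mul_assoc]
    refine mul_le_mul_of_nonneg_left ?_ hR.le
    have e : l v - l w - gram (antideriv v) (l v - l w)
        = (b v - b w) + (gram (antideriv v) (l w) - gram (antideriv w) (l w)) := by
      rw [gram_sub (continuous_antideriv v), ← hl v hv, ← hl w hw]
      abel
    have hbd : ∀ v : LTwo, ‖v‖ ≤ R → ∀ x, ‖antideriv v x‖ ≤ B * R := fun v hv x =>
      (hB v x).trans (mul_le_mul_of_nonneg_left hv hB0)
    have hg := norm_gram_sub_le (continuous_antideriv v) (continuous_antideriv w)
      (hbd v hv.norm_le) (hbd w hw.norm_le) (D := B * ‖v - w‖)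
      (fun x => by rw [← antideriv_sub]; exact hB _ x) (l w)
    rw [e]
    calc _ ≤ L * ‖v - w‖ + 2 * (B * R) * (B * ‖v - w‖) * (R * C) := by
          refine (norm_add_le _ _).trans (add_le_add (hL v w hv.norm_le hw.norm_le) (hg.trans ?_))
          have := hlb w hw
          gcongr
      _ = _ := by ring
  -- Coercivity may fail off the regular set, so the equation cannot be solved there. Since the
  -- target is finite dimensional, a Lipschitz map extends from any subset.
  obtain ⟨l', hl', heq⟩ := hlip.extend_finite_dimension
  refine ⟨l', ⟨_, hl'⟩, fun v hv => ?_⟩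
  rw [← heq hv]
  exact hl v hv

lemma _root_.LipschitzWith.lipOnBalls {X Y : Type*} [NormedAddCommGroup X] [NormedAddCommGroup Y]
    {f : X → Y} {L : NNReal} (hf : LipschitzWith L f) : LipOnBalls f := fun _ =>
  ⟨L, fun v w _ _ => by simpa [dist_eq_norm] using hf.dist_le_mul v w⟩

/-- A globally Lipschitz extension of the lower order terms, as a function of `v = τ_x`. -/
theorem IsHomogeneous.exists_nonlinearity {K : ℝ → ℝ → ℝ} {h : ℝ → ℝ} {p R : ℝ}
    (hK : IsHomogeneous K h p) (hdeg : IsZeroDegenerate h p ∨ ∃ m : ℕ, IsDegenerate h p m)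
    (hR : 1 ≤ R) :
    ∃ G : LTwo → LOne, (∃ L, LipschitzWith L G) ∧ ∃ C : ℝ, ∀ v, Regular R v → mean v = 0 →
      meanL (G v) = 0 ∧
      (∃ a : LInf, ‖a‖ ≤ C ∧ G v =ᵐ[torusMeasure] fun x =>
        a x + (‖v x‖ ^ 2 - inner ℝ (a x) (antideriv v x)) • antideriv v x) ∧
      ((∀ x, ‖antideriv v x‖ = 1) → G v =ᵐ[torusMeasure] lowerOrder K (antideriv v)) := by
  have hR0 : 0 < R := by linarith
  obtain ⟨f, hf, hpv⟩ := hK.exists_force_extension hdeg hR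
  have hfl : LipOnBalls f := hf
  set F : LTwo → LInf := fun v => primInf (toOne (f v)) with hF
  have hFl : LipOnBalls F := (hfl.clm_comp toOne).clm_comp primInf
  obtain ⟨l, ⟨L, hL⟩, hl⟩ := exists_multiplier hR0 hFl.multiplierRhs
  set a : LTwo → LInf := fun v => F v + constInf (l v) with ha
  have hal : LipOnBalls a := hFl.add (hL.lipOnBalls.clm_comp constInf)
  obtain ⟨C, -, hC⟩ := hal.exists_bound R
  -- The radial retraction is inactive on regular fields, whose norm is at most R.
  refine ⟨fun v => projected (a (radial R v)) (radial R v),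
    hal.projected.exists_lipschitz_radial hR0, C, fun v hv hm => ?_⟩
  simp only [radial_of_le hR0 hv.norm_le]
  refine ⟨?_, ⟨a v, hC v hv.norm_le, coeFn_projected _ _⟩, fun h1 => ?_⟩
  · rw [ha, meanL_projected _ _ _ (meanL_primInf _), hl v hv, sub_self]
  · obtain ⟨hpv1, hpv2⟩ := hpv v h1 hv.chord
    -- `pvForce` is determined only up to null sets, to which its primitive is insensitive.
    have hforce : ∀ᵐ x ∂torusMeasure, forcing K (antideriv v) x = F v x := by
      filter_upwards [coeFn_primInf (toOne (f v)), ae_mem_Ioc] with x h2 h3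
      rw [hF, h2, forcing]
      exact primitive_congr_ae ((hpv1.pvForce_ae_eq hpv2).trans (coeFn_toOne (f v)).symm)
        (Ioc_subset_Icc_self h3)
    have hderiv : ∀ᵐ x ∂torusMeasure, deriv (antideriv v) x = v x := by
      filter_upwards [ae_hasDerivAt_antideriv v] with x h2
      rw [h2.deriv, centre_eq_self hm]
    have hlam : lagrangeLambda K (antideriv v) = l v := by
      rw [← hv.coercive.toEuclideanLin_inv (by positivity) (continuous_antideriv v) h1 (l v),
        hl v hv, coeFn_multiplierRhs, lagrangeLambda]
      congr 1
      refine mean_congr_ae ?_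
      filter_upwards [hforce, hderiv] with x h2 h3
      rw [h2, h3, h1, one_pow, div_one]
    filter_upwards [coeFn_projected (a v) v, hforce, hderiv, Lp.coeFn_add (F v) (constInf (l v)),
      coeFn_constInf (l v)] with x h2 h3 h4 h5 h6
    have h7 : a v x = F v x + l v := by rw [ha]; rw [h5, Pi.add_apply, h6]
    rw [h2, lowerOrder, lagrangeMu, hlam, h3, h4, h1, h7, inner_add_left, one_pow, div_one,
      sub_sub]

/-! ### The evolution of the primitive of the tangent field -/

/-- The inclusion of `L^∞` in `L²`. -/
def infToTwo : LInf →L[ℝ] LTwo := smulTwoInf (Lp.const 2 torusMeasure (1 : ℝ))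

lemma coeFn_infToTwo (f : LInf) : infToTwo f =ᵐ[torusMeasure] f := by
  filter_upwards [coeFn_smulTwoInf (Lp.const 2 torusMeasure (1 : ℝ)) f,
    Lp.coeFn_const (p := 2) (μ := torusMeasure) (1 : ℝ)] with x h1 h2
  rw [infToTwo, h1, h2]
  simp

/-- The mean zero primitive, as an operator `L¹ → L²`. -/
def primTwo : LOne →L[ℝ] LTwo := infToTwo.comp primInf

lemma coeFn_primTwo (f : LOne) : primTwo f =ᵐ[torusMeasure] primitive f :=
  (coeFn_infToTwo _).trans (coeFn_primInf f)

lemma integral_eq_zero_of_meanL {f : LOne} (hf : meanL f = 0) : ∫ x, f x ∂torusMeasure = 0 := by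
  rw [meanL_apply, mean_eq_torus, smul_eq_zero] at hf
  exact hf.resolve_left (by positivity)

lemma primitive_pi_eq {f : LOne} (hf : meanL f = 0) : primitive f π = primitive f (-π) := by
  have := (hasPrim_primitive f.integrable).integral_eq
  rw [integral_eq_zero_of_meanL hf] at this
  exact (sub_eq_zero.mp this.symm)

lemma integral_trig_primitive {φ φ' : ℝ → ℝ} (hφ : ∀ x, HasDerivAt φ (φ' x) x)
    (hφ' : Continuous φ') (hper : φ π = φ (-π)) {f : LOne} (hf : meanL f = 0) :
    ∫ x, φ x • f x ∂torusMeasure = -∫ x, φ' x • primitive f x ∂torusMeasure := by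
  have h1 := HasPrim.of_hasDerivAt hφ hφ'
  have h2 := hasPrim_primitive f.integrable
  have h := (h1.smul h2).integral_eq
  have hB : Integrable (fun x => φ' x • primitive f x) torusMeasure :=
    h1.integrable.smul_of_top_left h2.memLp_top
  have hC : Integrable (fun x => φ x • f x) torusMeasure :=
    f.integrable.smul_of_top_right h1.memLp_top
  rw [hper, primitive_pi_eq hf, sub_self, integral_add hB hC] at h
  exact (neg_eq_of_add_eq_zero_right h).symm

lemma cosCoef_of_primTwo {f : LOne} (hf : meanL f = 0) (k : ℤ) :
    cosCoef k f = (k : ℝ) • sinCoef k (toOne (primTwo f)) := by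
  rw [cosCoef_apply, sinCoef_apply, ← integral_smul, integral_trig_primitive
    (φ := fun x => Real.cos (k * x)) (φ' := fun x => -Real.sin (k * x) * k) (fun x => by
      simpa using ((hasDerivAt_id x).const_mul (k : ℝ)).cos) (by fun_prop) (by simp) hf,
    ← integral_neg]
  refine integral_congr_ae ?_
  filter_upwards [coeFn_toOne (primTwo f), coeFn_primTwo f] with x h1 h2
  rw [h1, h2, smul_smul, ← neg_smul]
  congr 1; ring

lemma sinCoef_of_primTwo {f : LOne} (hf : meanL f = 0) (k : ℤ) :
    sinCoef k f = -((k : ℝ) • cosCoef k (toOne (primTwo f))) := by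
  rw [cosCoef_apply, sinCoef_apply, ← integral_smul, integral_trig_primitive
    (φ := fun x => Real.sin (k * x)) (φ' := fun x => Real.cos (k * x) * k) (fun x => by
      simpa using ((hasDerivAt_id x).const_mul (k : ℝ)).sin) (by fun_prop)
      (by simp [Real.sin_int_mul_pi]) hf]
  congr 1
  refine integral_congr_ae ?_
  filter_upwards [coeFn_toOne (primTwo f), coeFn_primTwo f] with x h1 h2
  rw [h1, h2, smul_smul]
  congr 1; ring

lemma cosCoef_zero_of_meanL {f : LOne} (hf : meanL f = 0) : cosCoef 0 f = 0 := by
  rw [meanL, _root_.smul_apply, smul_eq_zero] at hf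
  exact hf.resolve_left (by positivity)

lemma sinCoef_zero (f : LOne) : sinCoef 0 f = 0 := by
  simp [sinCoef_apply]

lemma meanL_primTwo (f : LOne) : meanL (toOne (primTwo f)) = 0 := by
  rw [meanL_apply, ← mean_primitive f.integrable]
  exact mean_congr_ae ((coeFn_toOne _).trans (coeFn_primTwo f))

lemma meanL_antiOne (v : LTwo) : meanL (antiOne v) = 0 := by
  rw [meanL_apply, ← mean_antideriv v]
  exact mean_congr_ae (coeFn_antiOne v)

lemma LTwo.ext_coef {v w : LTwo} (hc : ∀ k, cosCoef k (toOne v) = cosCoef k (toOne w))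
    (hs : ∀ k, sinCoef k (toOne v) = sinCoef k (toOne w)) : v = w := by
  have h := hasSum_sq_coef (v - w)
  simp only [map_sub, hc, hs, sub_self, norm_zero, ne_eq, OfNat.ofNat_ne_zero, not_false_eq_true,
    zero_pow, add_zero] at h
  have h0 := h.unique hasSum_zero
  rw [mul_eq_zero, or_iff_right (by positivity), sq_eq_zero_iff, norm_eq_zero, sub_eq_zero] at h0
  exact h0

section Duhamel

lemma exists_continuous_extension {E : Type*} [NormedAddCommGroup E] {T : ℝ} (hT : 0 ≤ T) {q : ℝ → E} (hq : ContinuousOn q (Icc 0 T)) :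
    ∃ q' : ℝ → E, Continuous q' ∧ EqOn q' q (Icc 0 T) :=
  ⟨IccExtend hT ((Icc 0 T).domRestrict q), hq.domRestrict.Icc_extend', fun t ht => by
    rw [IccExtend_of_mem hT _ ht, domRestrict_apply]⟩

variable {E : Type*} [NormedAddCommGroup E] [NormedSpace ℝ E] [CompleteSpace E] {T : ℝ}

/-- The Duhamel formula for a scalar linear equation in integrated form. -/
lemma duhamel_integral (hT : 0 ≤ T) {y q : ℝ → E} {κ c : ℝ} (hq : ContinuousOn q (Icc 0 T))
    (hy : ∀ t ∈ Icc 0 T, y t = Real.exp (-κ * t) • y 0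
      + ∫ s in (0 : ℝ)..t, (c * Real.exp (-κ * (t - s))) • q s) :
    ∀ t ∈ Icc 0 T, y t - y 0 = ∫ s in (0 : ℝ)..t, (-κ • y s + c • q s) := by
  -- A continuous extension to the line makes the integrals differentiable at the endpoints 0 and T
  -- as well.
  obtain ⟨q', hq', heq⟩ := exists_continuous_extension hT hq
  set N : ℝ → E := fun t => ∫ s in (0 : ℝ)..t, (c * Real.exp (κ * s)) • q' s with hN
  set Y : ℝ → E := fun t => Real.exp (-κ * t) • (y 0 + N t) with hY
  have hNd : ∀ t, HasDerivAt N ((c * Real.exp (κ * t)) • q' t) t := fun t =>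
    (by fun_prop : Continuous fun s => (c * Real.exp (κ * s)) • q' s).integral_hasStrictDerivAt
      0 t |>.hasDerivAt
  have hYd : ∀ t, HasDerivAt Y (-κ • Y t + c • q' t) t := fun t => by
    have h1 : HasDerivAt (fun t => Real.exp (-κ * t)) (Real.exp (-κ * t) * -κ) t := by
      simpa using ((hasDerivAt_id t).const_mul (-κ)).exp
    have h2 := h1.fun_smul ((hNd t).const_add (y 0))
    refine h2.congr_deriv ?_
    rw [smul_smul, show Real.exp (-κ * t) * (c * Real.exp (κ * t)) = c by
      rw [mul_left_comm, ← Real.exp_add]; simp, add_comm, hY]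
    simp only [smul_smul, mul_comm]
  have hYc : Continuous Y := continuous_iff_continuousAt.mpr fun t => (hYd t).continuousAt
  have hyY : EqOn y Y (Icc 0 T) := fun t ht => by
    rw [hy t ht]
    simp only [hY, hN, smul_add]
    congr 1
    rw [← intervalIntegral.integral_smul]
    refine intervalIntegral.integral_congr fun s hs => ?_
    rw [uIcc_of_le ht.1] at hs
    simp only [heq ⟨hs.1, hs.2.trans ht.2⟩, smul_smul]
    rw [mul_left_comm, ← Real.exp_add]
    ring_nf
  intro t ht
  rw [hyY ht, hyY (left_mem_Icc.mpr hT), ← intervalIntegral.integral_eq_sub_of_hasDerivAt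
    (fun s _ => hYd s) (Continuous.intervalIntegrable (by fun_prop) _ _)]
  refine intervalIntegral.integral_congr fun s hs => ?_
  rw [uIcc_of_le ht.1] at hs
  have hs' : s ∈ Icc 0 T := ⟨hs.1, hs.2.trans ht.2⟩
  simp only [heq hs', hyY hs']

end Duhamel

lemma cosCoef_heatFlow {v : LTwo} (hv : mean v = 0) {t : ℝ} (ht : 0 ≤ t) (k : ℤ) :
    cosCoef k (toOne (heatFlow v t)) = Real.exp (-(k : ℝ) ^ 2 * t) • cosCoef k (toOne v) := by
  rcases eq_or_lt_of_le ht with rfl | h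
  · simp [heatFlow_zero]
  · rw [heatFlow_of_pos v h, cosCoef_heatD h, cosCoef_of_antideriv hv, smul_smul, heatWeight,
      mul_comm]

lemma sinCoef_heatFlow {v : LTwo} (hv : mean v = 0) {t : ℝ} (ht : 0 ≤ t) (k : ℤ) :
    sinCoef k (toOne (heatFlow v t)) = Real.exp (-(k : ℝ) ^ 2 * t) • sinCoef k (toOne v) := by
  rcases eq_or_lt_of_le ht with rfl | h
  · simp [heatFlow_zero]
  · rw [heatFlow_of_pos v h, sinCoef_heatD h, sinCoef_of_antideriv hv, smul_neg, smul_smul,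
      heatWeight, mul_comm]

section Solution

variable {T : ℝ} {v : ℝ → LTwo} {g : ℝ → LOne}

lemma clm_volterra_heatD {F : Type*} [NormedAddCommGroup F] [NormedSpace ℝ F] [CompleteSpace F]
    (Φ : LTwo →L[ℝ] F) (hg : ContinuousOn g (Icc 0 T)) {t : ℝ} (ht : t ∈ Icc 0 T) :
    Φ (volterra heatD g t) = ∫ s in (0 : ℝ)..t, Φ (heatD (t - s) (g s)) :=
  (Φ.intervalIntegral_comp_comm (isSingularKernel_heatD.intervalIntegrable_comp ht.1
    (hg.mono (Icc_subset_Icc_right ht.2)))).symm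

/-- The endpoint s = t is left out because the identities for the heat operators need t - s > 0. -/
lemma intervalIntegral_congr_Ico {F : Type*} [NormedAddCommGroup F] [NormedSpace ℝ F]
    {f₁ f₂ : ℝ → F} {t : ℝ} (ht : 0 ≤ t) (h : ∀ s ∈ Ico 0 t, f₁ s = f₂ s) :
    ∫ s in (0 : ℝ)..t, f₁ s = ∫ s in (0 : ℝ)..t, f₂ s := by
  rw [intervalIntegral.integral_of_le ht, intervalIntegral.integral_of_le ht,
    ← integral_Ico_eq_integral_Ioc, ← integral_Ico_eq_integral_Ioc]
  exact setIntegral_congr_fun measurableSet_Ico h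

lemma meanL_volterra_heatD (hg : ContinuousOn g (Icc 0 T)) {t : ℝ} (ht : t ∈ Icc 0 T) :
    meanL (toOne (volterra heatD g t)) = 0 := by
  have := clm_volterra_heatD (meanL.comp toOne) hg ht
  simp only [ContinuousLinearMap.comp_apply] at this
  rw [this, intervalIntegral_congr_Ico ht.1 (f₂ := fun _ => 0) fun s hs =>
    mean_heatD (sub_pos.mpr hs.2) _]
  simp

/-- `v` solves the integral equation with inhomogeneity `g`. -/
structure IsIntegralSolution (T : ℝ) (v : ℝ → LTwo) (g : ℝ → LOne) : Prop where
  nonneg : 0 ≤ T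
  mean_zero : mean (v 0) = 0
  continuousOn : ContinuousOn v (Icc 0 T)
  continuousOn_rhs : ContinuousOn g (Icc 0 T)
  eq : ∀ t ∈ Icc 0 T, v t = heatFlow (v 0) t + volterra heatD g t
  mean_rhs : ∀ t ∈ Icc 0 T, meanL (g t) = 0

lemma IsIntegralSolution.mean_eq (h : IsIntegralSolution T v g) {t : ℝ} (ht : t ∈ Icc 0 T) :
    mean (v t) = 0 := by
  rw [← mean_congr_ae (coeFn_toOne (v t)), ← meanL_apply, h.eq t ht, map_add, map_add,
    meanL_heatFlow h.mean_zero ht.1, meanL_volterra_heatD h.continuousOn_rhs ht, add_zero]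

lemma IsIntegralSolution.cosCoef_eq (h : IsIntegralSolution T v g) (k : ℤ) :
    ∀ t ∈ Icc 0 T, cosCoef k (toOne (v t)) - cosCoef k (toOne (v 0)) = ∫ s in (0 : ℝ)..t,
      (-(k : ℝ) ^ 2 • cosCoef k (toOne (v s)) + (k : ℝ) • sinCoef k (g s)) := by
  refine duhamel_integral (y := fun t => cosCoef k (toOne (v t))) (q := fun s => sinCoef k (g s))
    h.nonneg ((sinCoef k).continuous.comp_continuousOn h.continuousOn_rhs) fun t ht => ?_
  have h1 := clm_volterra_heatD ((cosCoef k).comp toOne) h.continuousOn_rhs ht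
  simp only [ContinuousLinearMap.comp_apply] at h1
  rw [h.eq t ht, map_add, map_add, cosCoef_heatFlow h.mean_zero ht.1, h1]
  congr 1
  exact intervalIntegral_congr_Ico ht.1 fun s hs => cosCoef_heatD (sub_pos.mpr hs.2) _ _

lemma IsIntegralSolution.sinCoef_eq (h : IsIntegralSolution T v g) (k : ℤ) :
    ∀ t ∈ Icc 0 T, sinCoef k (toOne (v t)) - sinCoef k (toOne (v 0)) = ∫ s in (0 : ℝ)..t,
      (-(k : ℝ) ^ 2 • sinCoef k (toOne (v s)) + (k : ℝ) • -cosCoef k (g s)) := by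
  refine duhamel_integral (y := fun t => sinCoef k (toOne (v t))) (q := fun s => -cosCoef k (g s))
    h.nonneg ((cosCoef k).continuous.comp_continuousOn h.continuousOn_rhs).neg fun t ht => ?_
  have h1 := clm_volterra_heatD ((sinCoef k).comp toOne) h.continuousOn_rhs ht
  simp only [ContinuousLinearMap.comp_apply] at h1
  rw [h.eq t ht, map_add, map_add, sinCoef_heatFlow h.mean_zero ht.1, h1]
  congr 1
  refine intervalIntegral_congr_Ico ht.1 fun s hs => ?_
  rw [sinCoef_heatD (sub_pos.mpr hs.2), smul_neg]
  rfl

/-- The curve `primTwo (antiOne (v t))` is a primitive in time of `v + primTwo g`. -/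
lemma IsIntegralSolution.primTwo_sub_eq (h : IsIntegralSolution T v g) :
    ∀ t ∈ Icc 0 T, primTwo (antiOne (v t)) - primTwo (antiOne (v 0))
      = ∫ s in (0 : ℝ)..t, (v s + primTwo (g s)) := by
  intro t ht
  have hsub : Icc 0 t ⊆ Icc 0 T := Icc_subset_Icc_right ht.2
  have hec : ContinuousOn (fun s => v s + primTwo (g s)) (Icc 0 t) :=
    (h.continuousOn.add (primTwo.continuous.comp_continuousOn h.continuousOn_rhs)).mono hsub
  have hei : IntervalIntegrable (fun s => v s + primTwo (g s)) volume 0 t := by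
    refine ContinuousOn.intervalIntegrable ?_
    rwa [uIcc_of_le ht.1]
  have hcomm : ∀ Φ : LOne →L[ℝ] E3, Φ (toOne (∫ s in (0 : ℝ)..t, (v s + primTwo (g s))))
      = ∫ s in (0 : ℝ)..t, Φ (toOne (v s + primTwo (g s))) := fun Φ =>
    ((Φ.comp toOne).intervalIntegral_comp_comm hei).symm
  -- The identity is checked mode by mode. For k ≠ 0 the two primitives divide the k-th mode by -k²,
  -- cancelling the factor k² in the scalar equation; the zero modes vanish since all means do.
  refine LTwo.ext_coef (fun k => ?_) fun k => ?_
  · rw [hcomm, map_sub, map_sub]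
    rcases eq_or_ne k 0 with rfl | hk
    · rw [cosCoef_zero_of_meanL (meanL_primTwo _), cosCoef_zero_of_meanL (meanL_primTwo _), sub_zero,
        intervalIntegral_congr_Ico ht.1 (f₂ := fun _ => 0) fun s hs => ?_]
      · simp
      · have hs' := hsub (Ico_subset_Icc_self hs)
        refine cosCoef_zero_of_meanL ?_
        rw [map_add, map_add, meanL_primTwo, add_zero, meanL_apply, mean_congr_ae (coeFn_toOne _),
          h.mean_eq hs']
    · have hk2 : (k : ℝ) ^ 2 ≠ 0 := pow_ne_zero 2 (Int.cast_ne_zero.mpr hk)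
      have hU : ∀ s ∈ Icc 0 T, (k : ℝ) ^ 2 • cosCoef k (toOne (primTwo (antiOne (v s))))
          = -cosCoef k (toOne (v s)) := fun s hs => by
        rw [cosCoef_of_antideriv (h.mean_eq hs), sinCoef_of_primTwo (meanL_antiOne _), smul_neg,
          neg_neg, smul_smul, sq]
      refine (smul_right_injective E3 hk2) ?_
      simp only
      rw [smul_sub, hU t ht, hU 0 (left_mem_Icc.mpr h.nonneg), ← neg_sub',
        h.cosCoef_eq k t ht, ← intervalIntegral.integral_smul,
        ← intervalIntegral.integral_neg]
      refine intervalIntegral_congr_Ico ht.1 fun s hs => ?_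
      have hs' := hsub (Ico_subset_Icc_self hs)
      rw [map_add, map_add, smul_add, sinCoef_of_primTwo (h.mean_rhs s hs'), smul_neg, smul_smul,
        ← sq, neg_add, neg_smul, neg_neg, neg_neg]
  · rw [hcomm, map_sub, map_sub]
    rcases eq_or_ne k 0 with rfl | hk
    · simp [sinCoef_zero]
    · have hk2 : (k : ℝ) ^ 2 ≠ 0 := pow_ne_zero 2 (Int.cast_ne_zero.mpr hk)
      have hU : ∀ s ∈ Icc 0 T, (k : ℝ) ^ 2 • sinCoef k (toOne (primTwo (antiOne (v s))))
          = -sinCoef k (toOne (v s)) := fun s hs => by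
        rw [sinCoef_of_antideriv (h.mean_eq hs), cosCoef_of_primTwo (meanL_antiOne _),
          neg_neg, smul_smul, sq]
      refine (smul_right_injective E3 hk2) ?_
      simp only
      rw [smul_sub, hU t ht, hU 0 (left_mem_Icc.mpr h.nonneg), ← neg_sub',
        h.sinCoef_eq k t ht, ← intervalIntegral.integral_smul,
        ← intervalIntegral.integral_neg]
      refine intervalIntegral_congr_Ico ht.1 fun s hs => ?_
      have hs' := hsub (Ico_subset_Icc_self hs)
      rw [map_add, map_add, smul_add, cosCoef_of_primTwo (h.mean_rhs s hs'), smul_neg, smul_smul,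
        ← sq, neg_add, neg_smul, neg_neg, neg_neg]

/-- The solution v is only mild, and no time derivative of v in L² is available. Two spatial
primitives gain enough for a genuine one. -/
lemma IsIntegralSolution.hasDerivWithinAt_primTwo (h : IsIntegralSolution T v g) {t : ℝ}
    (ht : t ∈ Icc 0 T) :
    HasDerivWithinAt (fun s => primTwo (antiOne (v s))) (v t + primTwo (g t)) (Icc 0 T) t := by
  obtain ⟨e, hec, heq⟩ := exists_continuous_extension h.nonneg
    (h.continuousOn.add (primTwo.continuous.comp_continuousOn h.continuousOn_rhs))
  have h1 : HasDerivAt (fun t => primTwo (antiOne (v 0)) + ∫ s in (0 : ℝ)..t, e s) (e t) t :=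
    (hec.integral_hasStrictDerivAt 0 t).hasDerivAt.const_add _
  have h2 : ∀ t ∈ Icc 0 T, primTwo (antiOne (v t))
      = primTwo (antiOne (v 0)) + ∫ s in (0 : ℝ)..t, e s := fun t ht => by
    rw [← sub_eq_iff_eq_add', h.primTwo_sub_eq t ht]
    refine intervalIntegral.integral_congr fun s hs => ?_
    rw [uIcc_of_le ht.1] at hs
    exact (heq ⟨hs.1, hs.2.trans ht.2⟩).symm
  have h3 := h1.hasDerivWithinAt (s := Icc 0 T) |>.congr h2 (h2 t ht)
  rwa [heq ht] at h3

end Solution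

/-! ### Preservation of unit length -/

lemma HasPrim.intervalIntegral_eq {V : Type*} [NormedAddCommGroup V] [NormedSpace ℝ V]
    {F f : ℝ → V} (h : HasPrim F f) {x y : ℝ} (hx : x ∈ Icc (-π) π) (hy : y ∈ Icc (-π) π) :
    F x - F y = ∫ z in y..x, f z := by
  rw [h.eq x hx, h.eq y hy, add_sub_add_left_eq_sub, intervalIntegral.integral_interval_sub_left
    (h.intervalIntegrable neg_pi_mem hx) (h.intervalIntegrable neg_pi_mem hy)]

/-- An interpolation inequality. -/
lemma sq_le_of_hasPrim {w w' : ℝ → ℝ} (h : HasPrim w w') (h2 : MemLp w' 2 torusMeasure) {η : ℝ}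
    (hη : 0 < η) {x : ℝ} (hx : x ∈ Icc (-π) π) :
    w x ^ 2 ≤ (2 * π)⁻¹ * (∫ y, w y ^ 2 ∂torusMeasure)
      + (η * (∫ y, w' y ^ 2 ∂torusMeasure) + η⁻¹ * ∫ y, w y ^ 2 ∂torusMeasure) := by
  set Q := ∫ y, w y ^ 2 ∂torusMeasure
  set D := ∫ y, w' y ^ 2 ∂torusMeasure
  have hw2 : Integrable (fun y => w y ^ 2) torusMeasure :=
    (h.memLp_top.mono_exponent (p := 2) le_top).integrable_sq
  have hw2' : Integrable (fun y => w' y ^ 2) torusMeasure := h2.integrable_sq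
  have hb : Integrable (fun y => η * w' y ^ 2 + η⁻¹ * w y ^ 2) torusMeasure :=
    (hw2'.const_mul η).add (hw2.const_mul η⁻¹)
  have hbE : ∫ y, (η * w' y ^ 2 + η⁻¹ * w y ^ 2) ∂torusMeasure = η * D + η⁻¹ * Q := by
    rw [integral_add (hw2'.const_mul η) (hw2.const_mul η⁻¹), integral_const_mul, integral_const_mul]
  have hp := h.mul h
  -- w(x)² - w(y)² is the integral of 2ww', estimated by Young's inequality with parameter η;
  -- averaging over y then gives the claim.
  have hdiff : ∀ y ∈ Icc (-π) π, w x ^ 2 - (η * D + η⁻¹ * Q) ≤ w y ^ 2 := fun y hy => by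
    have h3 : w x * w x - w y * w y ≤ η * D + η⁻¹ * Q := by
      rw [hp.intervalIntegral_eq hx hy, ← hbE]
      refine (le_abs_self _).trans ((Real.norm_eq_abs _).symm.le.trans <| (intervalIntegral.norm_integral_le_integral_norm_uIoc).trans ?_)
      refine (setIntegral_mono_set (t := Ioc (-π) π) hp.integrable.norm
        (Eventually.of_forall fun z => norm_nonneg _) (LE.le.eventuallyLE ?_)).trans ?_
      · exact fun z hz => ⟨(le_min hy.1 hx.1).trans_lt hz.1, hz.2.trans (max_le hy.2 hx.2)⟩
      · refine integral_mono hp.integrable.norm hb fun z => ?_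
        simp only [Real.norm_eq_abs]
        rw [mul_comm (w z), ← two_mul, abs_mul, abs_two, abs_mul, ← sq_abs (w' z), ← sq_abs (w z)]
        have := sq_nonneg (η * |w' z| - |w z|)
        have h4 : η * (2 * (|w' z| * |w z|)) ≤ η * (η * |w' z| ^ 2 + η⁻¹ * |w z| ^ 2) := by
          rw [mul_add, mul_inv_cancel_left₀ hη.ne']
          nlinarith
        exact le_of_mul_le_mul_left h4 hη
    linarith [sq (w x), sq (w y)]
  have hint : ∫ _, (w x ^ 2 - (η * D + η⁻¹ * Q)) ∂torusMeasure ≤ Q := by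
    refine integral_mono_ae (integrable_const _) hw2 ?_
    filter_upwards [ae_mem_Ioc] with y hy using hdiff y (Ioc_subset_Icc_self hy)
  rw [integral_const, torusMeasure_real_univ, smul_eq_mul, ← le_inv_mul_iff₀ Real.two_pi_pos] at hint
  linarith

/-- The defect `|u|² - 1` of unit length. -/
def unitDefect (v : LTwo) (x : ℝ) : ℝ := ‖antideriv v x‖ ^ 2 - 1

/-- The defect of unit length as an element of `L^∞`. -/
def defectInf (v : LTwo) : Lp ℝ ∞ torusMeasure :=
  innerInf (antiInf v) (antiInf v) - Lp.const ∞ torusMeasure (1 : ℝ)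

/-- The derivative of the defect of unit length. -/
def defectDeriv (v : LTwo) : Lp ℝ 2 torusMeasure := (2 : ℝ) • innerInfTwo (antiInf v) (centre v)

lemma coeFn_defectInf (v : LTwo) : defectInf v =ᵐ[torusMeasure] unitDefect v := by
  filter_upwards [Lp.coeFn_sub (innerInf (antiInf v) (antiInf v)) (Lp.const ∞ torusMeasure (1 : ℝ)),
    coeFn_innerInf (antiInf v) (antiInf v), coeFn_antiInf v,
    Lp.coeFn_const (p := ∞) (μ := torusMeasure) (1 : ℝ)] with x h1 h2 h3 h4
  rw [defectInf, h1, Pi.sub_apply, h2, h3, h4, real_inner_self_eq_norm_sq, unitDefect]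
  rfl

lemma coeFn_defectDeriv (v : LTwo) : defectDeriv v =ᵐ[torusMeasure]
    fun x => 2 * inner ℝ (antideriv v x) (centre v x) := by
  filter_upwards [Lp.coeFn_smul (2 : ℝ) (innerInfTwo (antiInf v) (centre v)),
    coeFn_innerInfTwo (antiInf v) (centre v), coeFn_antiInf v] with x h1 h2 h3
  rw [defectDeriv, h1, Pi.smul_apply, h2, h3, smul_eq_mul]

lemma hasPrim_unitDefect (v : LTwo) : HasPrim (unitDefect v) (defectDeriv v) := by
  have h := ((hasPrim_antideriv v).inner (hasPrim_antideriv v)).add (HasPrim.const (-1 : ℝ))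
  refine (h.congr fun x _ => ?_).congr_ae ?_
  · rw [unitDefect, real_inner_self_eq_norm_sq, sub_eq_add_neg]
  · filter_upwards [coeFn_defectDeriv v] with x hx
    rw [hx, real_inner_comm]
    ring

lemma continuous_unitDefect (v : LTwo) : Continuous (unitDefect v) :=
  ((continuous_antideriv v).norm.pow 2).sub continuous_const

/-- The test field `(w₁ + w₂) (u₁ + u₂)`. -/
def testField (v₁ v₂ : LTwo) (x : ℝ) : E3 :=
  (unitDefect v₁ x + unitDefect v₂ x) • (antideriv v₁ x + antideriv v₂ x)

/-- The derivative of the test field. -/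
def testDeriv (v₁ v₂ : LTwo) : LTwo :=
  smulTwoInf (defectDeriv v₁ + defectDeriv v₂) (antiInf v₁ + antiInf v₂)
    + smulInfTwo (defectInf v₁ + defectInf v₂) (centre v₁ + centre v₂)

lemma coeFn_testDeriv (v₁ v₂ : LTwo) : testDeriv v₁ v₂ =ᵐ[torusMeasure] fun x =>
    (defectDeriv v₁ x + defectDeriv v₂ x) • (antideriv v₁ x + antideriv v₂ x)
      + (unitDefect v₁ x + unitDefect v₂ x) • (centre v₁ x + centre v₂ x) := by
  filter_upwards [Lp.coeFn_add (smulTwoInf (defectDeriv v₁ + defectDeriv v₂) (antiInf v₁ + antiInf v₂))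
    (smulInfTwo (defectInf v₁ + defectInf v₂) (centre v₁ + centre v₂)),
    coeFn_smulTwoInf (defectDeriv v₁ + defectDeriv v₂) (antiInf v₁ + antiInf v₂),
    coeFn_smulInfTwo (defectInf v₁ + defectInf v₂) (centre v₁ + centre v₂),
    Lp.coeFn_add (defectDeriv v₁) (defectDeriv v₂), Lp.coeFn_add (antiInf v₁) (antiInf v₂),
    Lp.coeFn_add (defectInf v₁) (defectInf v₂), Lp.coeFn_add (centre v₁) (centre v₂),
    coeFn_antiInf v₁, coeFn_antiInf v₂, coeFn_defectInf v₁, coeFn_defectInf v₂]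
    with x h1 h2 h3 h4 h5 h6 h7 h8 h9 h10 h11
  rw [testDeriv, h1, Pi.add_apply, h2, h3, h4, h5, h6, h7]
  simp only [Pi.add_apply, h8, h9, h10, h11]

lemma hasPrim_testField (v₁ v₂ : LTwo) : HasPrim (testField v₁ v₂) (testDeriv v₁ v₂) := by
  refine HasPrim.congr_ae (((hasPrim_unitDefect v₁).add (hasPrim_unitDefect v₂)).smul
    ((hasPrim_antideriv v₁).add (hasPrim_antideriv v₂))) ?_
  filter_upwards [coeFn_testDeriv v₁ v₂] with x hx
  rw [hx]

lemma testField_pi_eq (v₁ v₂ : LTwo) : testField v₁ v₂ π = testField v₁ v₂ (-π) := by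
  have h : ∀ v, antideriv v π = antideriv v (-π) := fun v => by
    rw [← antideriv_periodic v (-π)]; congr 1; ring
  simp only [testField, unitDefect, h]

lemma continuous_testDeriv : Continuous fun q : LTwo × LTwo => testDeriv q.1 q.2 := by
  have h1 : Continuous defectInf := by
    unfold defectInf
    exact (Continuous.clm_apply (innerInf.continuous.comp antiInf.continuous)
      antiInf.continuous).sub continuous_const
  have h2 : Continuous defectDeriv := by
    unfold defectDeriv
    exact (Continuous.clm_apply (innerInfTwo.continuous.comp antiInf.continuous)
      centre.continuous).const_smul (2 : ℝ)
  have h3 : ∀ {Y : Type} [TopologicalSpace Y] [Add Y] [ContinuousAdd Y] {f : LTwo → Y},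
      Continuous f → Continuous fun q : LTwo × LTwo => f q.1 + f q.2 := fun hf =>
    (hf.comp continuous_fst).add (hf.comp continuous_snd)
  exact (Continuous.clm_apply (smulTwoInf.continuous.comp (h3 h2)) (h3 antiInf.continuous)).add
    (Continuous.clm_apply (smulInfTwo.continuous.comp (h3 h1)) (h3 centre.continuous))

/-- Moving one derivative onto the test field leaves `primTwo f`, the quantity that is
differentiable in time along solutions. -/
lemma integral_inner_testField {f : LOne} (hf : meanL f = 0) (v₁ v₂ : LTwo) :
    ∫ x, (inner ℝ (f x) (testField v₁ v₂ x) : ℝ) ∂torusMeasure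
      = -inner ℝ (primTwo f) (testDeriv v₁ v₂) := by
  have hp := hasPrim_primitive f.integrable
  have hΦ := hasPrim_testField v₁ v₂
  have h := (hp.inner hΦ).integral_eq
  have hA : Integrable (fun x => (inner ℝ (f x) (testField v₁ v₂ x) : ℝ)) torusMeasure := by
    have := (innerSL ℝ : E3 →L[ℝ] E3 →L[ℝ] ℝ).memLp_of_bilin (r := 1)
      (memLp_one_iff_integrable.mpr f.integrable) hΦ.memLp_top
    exact memLp_one_iff_integrable.mp this
  have hB : Integrable (fun x => (inner ℝ (primitive f x) (testDeriv v₁ v₂ x) : ℝ)) torusMeasure := by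
    have := (innerSL ℝ : E3 →L[ℝ] E3 →L[ℝ] ℝ).memLp_of_bilin (r := 1)
      hp.memLp_top (memLp_one_iff_integrable.mpr (LTwo.integrable (testDeriv v₁ v₂)))
    exact memLp_one_iff_integrable.mp this
  rw [testField_pi_eq, primitive_pi_eq hf, sub_self, integral_add hA hB] at h
  rw [L2.inner_def, eq_neg_iff_add_eq_zero]
  convert h using 2
  refine integral_congr_ae ?_
  filter_upwards [coeFn_primTwo f] with x hx
  rw [hx]

/-- The squared `L²` norm of the defect of unit length. -/
def energy (v : LTwo) : ℝ := ∫ x, unitDefect v x ^ 2 ∂torusMeasure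

/-- Here w₂² - w₁² = (w₂ - w₁)(w₁ + w₂) and w₂ - w₁ = ⟨u₂ - u₁, u₁ + u₂⟩, which together pair u₂ -
u₁ with the test field. The formula is exact, so difference quotients pass to the limit without a
chain rule. -/
lemma energy_sub (v₁ v₂ : LTwo) : energy v₂ - energy v₁
    = -inner ℝ (primTwo (antiOne v₂) - primTwo (antiOne v₁)) (testDeriv v₁ v₂) := by
  have hi : ∀ v, Integrable (fun x => unitDefect v x ^ 2) torusMeasure := fun v =>
    integrable_of_continuous_torus ((continuous_unitDefect v).pow 2)
  rw [← map_sub, ← map_sub, ← integral_inner_testField (meanL_antiOne _), energy, energy,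
    ← integral_sub (hi v₂) (hi v₁)]
  refine integral_congr_ae ?_
  filter_upwards [coeFn_antiOne (v₂ - v₁)] with x hx
  rw [hx, antideriv_sub, testField, inner_smul_right, inner_sub_left, inner_add_right,
    inner_add_right, real_inner_comm (antideriv v₁ x) (antideriv v₂ x), real_inner_self_eq_norm_sq,
    real_inner_self_eq_norm_sq, unitDefect, unitDefect]
  ring

variable {T : ℝ} {v : ℝ → LTwo} {g : ℝ → LOne}

lemma IsIntegralSolution.hasDerivWithinAt_energy (h : IsIntegralSolution T v g) {t : ℝ}
    (ht : t ∈ Icc 0 T) :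
    HasDerivWithinAt (fun s => energy (v s))
      (-inner ℝ (v t + primTwo (g t)) (testDeriv (v t) (v t))) (Icc 0 T) t := by
  rw [hasDerivWithinAt_iff_tendsto_slope]
  have hU := hasDerivWithinAt_iff_tendsto_slope.mp (h.hasDerivWithinAt_primTwo ht)
  have hv : Tendsto v (𝓝[Icc 0 T \ {t}] t) (𝓝 (v t)) :=
    (h.continuousOn t ht).mono_left (nhdsWithin_mono _ sdiff_subset)
  have hΨ : Tendsto (fun s => testDeriv (v t) (v s)) (𝓝[Icc 0 T \ {t}] t)
      (𝓝 (testDeriv (v t) (v t))) := by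
    have h1 : Tendsto (fun s => (v t, v s)) (𝓝[Icc 0 T \ {t}] t) (𝓝 (v t, v t)) :=
      tendsto_const_nhds.prodMk_nhds hv
    simpa only [Function.comp_def] using (continuous_testDeriv.tendsto (v t, v t)).comp h1
  have hin : Tendsto (fun s => -inner ℝ (slope (fun s => primTwo (antiOne (v s))) t s)
      (testDeriv (v t) (v s))) (𝓝[Icc 0 T \ {t}] t)
      (𝓝 (-inner ℝ (v t + primTwo (g t)) (testDeriv (v t) (v t)))) :=
    (Tendsto.inner (𝕜 := ℝ) hU hΨ).neg
  refine hin.congr fun s => ?_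
  rw [slope_def_module, slope_def_module, energy_sub, real_inner_smul_left, smul_eq_mul, mul_neg]

/-- The energy inequality. -/
lemma exists_energy_bound (M C : ℝ) : ∃ κ : ℝ, ∀ (v : LTwo) (g : LOne) (a : LInf), ‖v‖ ≤ M →
    mean v = 0 → ‖a‖ ≤ C → meanL g = 0 →
    (g =ᵐ[torusMeasure] fun x =>
      a x + (‖v x‖ ^ 2 - inner ℝ (a x) (antideriv v x)) • antideriv v x) →
    -inner ℝ (v + primTwo g) (testDeriv v v) ≤ κ * energy v := by
  obtain ⟨B, hB0, hB⟩ := exists_norm_antideriv_le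
  set A := |C| * (B * |M|)
  set N := M ^ 2 + A * (2 * π) with hN
  have hA0 : 0 ≤ A := by positivity
  have hN0 : 0 ≤ N := by positivity
  -- Chosen so that 4Nη ≤ 2: the gradient term from interpolation is absorbed by the dissipation
  -- -2D.
  set η := (2 * N + 1)⁻¹ with hη
  have hη0 : 0 < η := by positivity
  refine ⟨4 * N * ((2 * π)⁻¹ + η⁻¹), fun v g a hv hm ha hg hga => ?_⟩
  set w := unitDefect v
  set w' := defectDeriv v
  set D := ∫ x, w' x ^ 2 ∂torusMeasure
  have hw' : MemLp w' 2 torusMeasure := Lp.memLp _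
  have hu := continuous_antideriv v
  have hwc : Continuous w := continuous_unitDefect v
  have hvsq : Integrable (fun x => ‖v x‖ ^ 2) torusMeasure :=
    (memLp_two_iff_integrable_sq_norm (Lp.aestronglyMeasurable v)).mp (Lp.memLp v)
  have hai : Integrable (fun x => (inner ℝ (a x) (antideriv v x) : ℝ)) torusMeasure := by
    have := (innerSL ℝ : E3 →L[ℝ] E3 →L[ℝ] ℝ).memLp_of_bilin (r := 1)
      (memLp_one_iff_integrable.mpr (infToOne a).integrable) (memLp_top_antideriv v)
    refine (memLp_one_iff_integrable.mp this).congr ?_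
    filter_upwards [coeFn_infToOne a] with x hx
    rw [hx, innerSL_apply_apply]
  set μ : ℝ → ℝ := fun x => ‖v x‖ ^ 2 - inner ℝ (a x) (antideriv v x) with hμ
  have hμi : Integrable μ torusMeasure := hvsq.sub hai
  have hwtop : MemLp (fun x => w x ^ 2) ∞ torusMeasure := by
    have h := (hasPrim_unitDefect v).mul (hasPrim_unitDefect v)
    simpa only [← sq] using h.memLp_top
  have hμw : Integrable (fun x => μ x * w x ^ 2) torusMeasure := hμi.mul_of_top_left hwtop
  -- The weak form of w_t = w_xx + 2μw tested with 2w. The form a + (|v|² - ⟨a, u⟩)u of the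
  -- right-hand side cancels every term that lacks the factor w.
  have hid : -inner ℝ (v + primTwo g) (testDeriv v v)
      = -(2 * D) + 4 * ∫ x, μ x * w x ^ 2 ∂torusMeasure := by
    have h1 : inner ℝ (v + primTwo g) (testDeriv v v)
        = inner ℝ v (testDeriv v v) - ∫ x, (inner ℝ (g x) (testField v v x) : ℝ) ∂torusMeasure := by
      rw [integral_inner_testField hg, inner_add_left, sub_neg_eq_add]
    have h2 : ∫ x, (inner ℝ (v x) (testDeriv v v x) : ℝ) ∂torusMeasure
        - ∫ x, (inner ℝ (g x) (testField v v x) : ℝ) ∂torusMeasure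
        = 2 * D - 4 * ∫ x, μ x * w x ^ 2 ∂torusMeasure := by
      have i1 : Integrable (fun x => (inner ℝ (v x) (testDeriv v v x) : ℝ)) torusMeasure :=
        L2.integrable_inner v (testDeriv v v)
      have i2 : Integrable (fun x => (inner ℝ (g x) (testField v v x) : ℝ)) torusMeasure := by
        have := (innerSL ℝ : E3 →L[ℝ] E3 →L[ℝ] ℝ).memLp_of_bilin (r := 1)
          (memLp_one_iff_integrable.mpr g.integrable) (hasPrim_testField v v).memLp_top
        exact memLp_one_iff_integrable.mp this
      rw [← integral_sub i1 i2, ← integral_const_mul, ← integral_const_mul,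
        ← integral_sub (hw'.integrable_sq.const_mul 2) (hμw.const_mul 4)]
      refine integral_congr_ae ?_
      filter_upwards [coeFn_testDeriv v v, hga, coeFn_defectDeriv v] with x h3 h4 h5
      have h6 : w x = ‖antideriv v x‖ ^ 2 - 1 := rfl
      rw [centre_eq_self hm] at h3 h5
      have h7 : (inner ℝ (v x) (antideriv v x) : ℝ) = w' x / 2 := by
        rw [h5, real_inner_comm]; ring
      rw [h3, h4, testField]
      simp only [inner_add_left, inner_add_right, inner_smul_left, inner_smul_right,
        real_inner_self_eq_norm_sq, h7, conj_trivial]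
      have h8 : ‖antideriv v x‖ ^ 2 = w x + 1 := by rw [h6]; ring
      rw [h8, hμ]
      simp only
      simp only [show unitDefect v x = w x from rfl, show defectDeriv v x = w' x from rfl]
      ring
    rw [h1, L2.inner_def, h2]
    ring
  rw [hid]
  set S := (2 * π)⁻¹ * energy v + (η * D + η⁻¹ * energy v) with hS
  have hsup : ∀ x ∈ Icc (-π) π, w x ^ 2 ≤ S := fun x hx =>
    sq_le_of_hasPrim (hasPrim_unitDefect v) hw' hη0 hx
  have hS0 : 0 ≤ S := (sq_nonneg _).trans (hsup π pi_mem)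
  have hD0 : 0 ≤ D := integral_nonneg fun x => sq_nonneg _
  -- The coefficient μ is merely integrable, so w² is taken out in the supremum norm, which the
  -- interpolation inequality controls.
  have hμb : ∀ᵐ x ∂torusMeasure, μ x * w x ^ 2 ≤ (‖v x‖ ^ 2 + A) * S := by
    have han : ∀ᵐ x ∂torusMeasure, ‖a x‖ ≤ ‖a‖ := by
      filter_upwards [ae_le_eLpNormEssSup (f := a) (μ := torusMeasure)] with x hx
      rw [Lp.norm_def, eLpNorm_exponent_top]
      have := ENNReal.toReal_mono (by
        have := Lp.eLpNorm_ne_top a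
        rwa [eLpNorm_exponent_top] at this) hx
      simpa using this
    filter_upwards [ae_mem_Ioc, han] with x hx hax
    have h1 : μ x ≤ ‖v x‖ ^ 2 + A := by
      have h2 : |(inner ℝ (a x) (antideriv v x) : ℝ)| ≤ A := by
        refine (abs_real_inner_le_norm _ _).trans (mul_le_mul ?_ ?_ (norm_nonneg _) (abs_nonneg _))
        · exact hax.trans (ha.trans (le_abs_self C))
        · exact (hB v x).trans (mul_le_mul_of_nonneg_left (hv.trans (le_abs_self M)) hB0)
      simp only [hμ]
      linarith [neg_abs_le (inner ℝ (a x) (antideriv v x) : ℝ)]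
    exact mul_le_mul h1 (hsup x (Ioc_subset_Icc_self hx)) (sq_nonneg _) (by positivity)
  have hμI : ∫ x, μ x * w x ^ 2 ∂torusMeasure ≤ N * S := by
    have hi : Integrable (fun x => (‖v x‖ ^ 2 + A) * S) torusMeasure :=
      (hvsq.add (integrable_const A)).mul_const S
    refine (integral_mono_ae hμw hi hμb).trans ?_
    rw [integral_mul_const, integral_add hvsq (integrable_const A), ← LTwo.norm_sq_eq,
      integral_const, torusMeasure_real_univ, smul_eq_mul]
    have : ‖v‖ ^ 2 ≤ M ^ 2 := pow_le_pow_left₀ (norm_nonneg _) hv 2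
    refine mul_le_mul_of_nonneg_right ?_ hS0
    rw [hN]
    linarith
  have hηN : 4 * N * (η * D) ≤ 2 * D := by
    have : N * η * 2 ≤ 1 := by
      rw [hη, mul_assoc, mul_comm, mul_assoc, inv_mul_le_iff₀ (by positivity)]
      linarith
    nlinarith
  calc _ ≤ -(2 * D) + 4 * (N * S) := by linarith
    _ = -(2 * D) + 4 * N * (η * D) + 4 * N * ((2 * π)⁻¹ + η⁻¹) * energy v := by rw [hS]; ring
    _ ≤ _ := by linarith

/-- Letting η → 0 in the interpolation inequality turns vanishing in L² into vanishing at every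
point. -/
lemma unitDefect_eq_zero {v : LTwo} (h : energy v = 0) (x : ℝ) : unitDefect v x = 0 := by
  have h1 : ∀ x ∈ Icc (-π) π, unitDefect v x = 0 := fun x hx => by
    have h2 : ∀ η > 0, unitDefect v x ^ 2
        ≤ η * ∫ y, defectDeriv v y ^ 2 ∂torusMeasure := fun η hη => by
      have h3 := sq_le_of_hasPrim (hasPrim_unitDefect v) (Lp.memLp _) hη hx
      rw [energy] at h
      rw [h] at h3
      simpa using h3
    have h4 : Tendsto (fun η : ℝ => η * ∫ y, defectDeriv v y ^ 2 ∂torusMeasure) (𝓝[>] 0)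
        (𝓝 (0 * ∫ y, defectDeriv v y ^ 2 ∂torusMeasure)) :=
      (tendsto_id.mono_left nhdsWithin_le_nhds).mul_const _
    rw [zero_mul] at h4
    have h5 : unitDefect v x ^ 2 ≤ 0 := ge_of_tendsto h4 (by
      filter_upwards [self_mem_nhdsWithin] with η hη using h2 η hη)
    exact pow_eq_zero_iff two_ne_zero |>.mp (le_antisymm h5 (sq_nonneg _))
  have h6 := h1 _ (Ioc_subset_Icc_self (toIocMod_mem_torus x))
  rw [unitDefect, (antideriv_periodic v).apply_toIocMod] at h6
  exact h6

/-- Solutions of the projected equation with unit initial datum remain unit. -/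
theorem IsIntegralSolution.norm_eq_one (h : IsIntegralSolution T v g) {M C : ℝ}
    (hM : ∀ t ∈ Icc 0 T, ‖v t‖ ≤ M)
    (hg : ∀ t ∈ Icc 0 T, ∃ a : LInf, ‖a‖ ≤ C ∧ g t =ᵐ[torusMeasure] fun x =>
      a x + (‖v t x‖ ^ 2 - inner ℝ (a x) (antideriv (v t) x)) • antideriv (v t) x)
    (h1 : ∀ x, ‖antideriv (v 0) x‖ = 1) : ∀ t ∈ Icc 0 T, ∀ x, ‖antideriv (v t) x‖ = 1 := by
  obtain ⟨κ, hκ⟩ := exists_energy_bound M C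
  have hd := fun t (ht : t ∈ Icc 0 T) => h.hasDerivWithinAt_energy ht
  -- Gronwall's inequality from zero initial energy; only right derivatives are needed.
  have hgron := le_gronwallBound_of_liminf_deriv_right_le (f := fun t => energy (v t))
    (f' := fun t => -inner ℝ (v t + primTwo (g t)) (testDeriv (v t) (v t))) (δ := 0) (K := κ)
    (ε := 0) (a := 0) (b := T) (fun t ht => (hd t ht).continuousWithinAt) (fun t ht r hr => by
      have h2 := (hd t (Ico_subset_Icc_self ht)).mono_of_mem_nhdsWithin
        (Icc_mem_nhdsGE_of_mem ⟨ht.1, ht.2⟩)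
      have h3 := (hasDerivWithinAt_iff_tendsto_slope' self_notMem_Ioi).mp (h2.Ioi_of_Ici)
      refine (h3.eventually (gt_mem_nhds hr)).frequently.mono fun z hz => ?_
      simpa [slope_def_module] using hz) (by
      simp [energy, unitDefect, h1]) (fun t ht => by
      have ht' := Ico_subset_Icc_self ht
      obtain ⟨a, ha, hga⟩ := hg t ht'
      simpa using hκ (v t) (g t) a (hM t ht') (h.mean_eq ht') ha (h.mean_rhs t ht') hga)
  intro t ht x
  have h4 := hgron t ht
  rw [gronwallBound_ε0, zero_mul] at h4
  have h5 := unitDefect_eq_zero (le_antisymm h4 (integral_nonneg fun x => sq_nonneg _)) x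
  rw [unitDefect, sub_eq_zero] at h5
  exact (pow_eq_one_iff_of_nonneg (norm_nonneg _) two_ne_zero).mp h5

/-! ### The sets of regular tangent fields -/

lemma LipOnBalls.continuous {X Y : Type*} [NormedAddCommGroup X] [NormedAddCommGroup Y]
    {f : X → Y} (hf : LipOnBalls f) : Continuous f := by
  refine continuous_iff_continuousAt.mpr fun v => ?_
  obtain ⟨L, hL⟩ := hf (‖v‖ + 1)
  refine tendsto_iff_norm_sub_tendsto_zero.mpr ?_
  have h1 : Tendsto (fun w => L * ‖w - v‖) (𝓝 v) (𝓝 0) := by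
    have : Continuous fun w => L * ‖w - v‖ := by fun_prop
    simpa using this.tendsto v
  refine squeeze_zero' (Eventually.of_forall fun w => norm_nonneg _) ?_ h1
  filter_upwards [Metric.ball_mem_nhds v one_pos] with w hw
  refine hL w v ?_ (by linarith)
  have h2 : ‖w - v‖ < 1 := by simpa [dist_eq_norm] using hw
  have h3 := norm_add_le (w - v) v
  rw [sub_add_cancel] at h3
  linarith

/-- No power of |z| is wanted here, so sup norm bounds on the oscillation suffice and z is
unrestricted. -/
lemma exists_chordRatio_lipschitz (M : ℝ) : ∃ L, 0 ≤ L ∧ ∀ v w : LTwo, ‖v‖ ≤ M → ‖w‖ ≤ M →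
    ∀ x z, |chordRatio (antideriv v) x z - chordRatio (antideriv w) x z| ≤ L * ‖v - w‖ := by
  obtain ⟨B, hB0, hB⟩ := exists_norm_antideriv_le
  refine ⟨2 * B * (4 * B * |M|), by positivity, fun v w hv hw x z => ?_⟩
  have hosc : ∀ v x y, ‖antideriv v x - antideriv v y‖ ≤ 2 * B * ‖v‖ := fun v x y =>
    (norm_sub_le _ _).trans (by linarith [hB v x, hB v y])
  refine (abs_chordRatio_sub_le (continuous_antideriv v) (continuous_antideriv w)
    (fun x y _ => hosc v x y) (fun x y _ => hosc w x y) (N := 2 * B * ‖v - w‖) (fun x y _ => ?_)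
    x).trans ?_
  · rw [← antideriv_sub, ← antideriv_sub]
    exact hosc _ _ _
  · have h1 : 2 * B * ‖v‖ + 2 * B * ‖w‖ ≤ 4 * B * |M| := by
      have := mul_le_mul_of_nonneg_left (hv.trans (le_abs_self M)) hB0
      have := mul_le_mul_of_nonneg_left (hw.trans (le_abs_self M)) hB0
      linarith
    calc _ ≤ 2 * B * ‖v - w‖ * (4 * B * |M|) := by gcongr
      _ = _ := by ring

lemma exists_form_lipschitz (M : ℝ) : ∃ L, 0 ≤ L ∧ ∀ v w : LTwo, ‖v‖ ≤ M → ‖w‖ ≤ M →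
    ∀ y : E3, |(mean fun x => (inner ℝ (antideriv v x) y : ℝ) ^ 2)
      - mean fun x => (inner ℝ (antideriv w x) y : ℝ) ^ 2| ≤ L * ‖v - w‖ * ‖y‖ ^ 2 := by
  obtain ⟨B, hB0, hB⟩ := exists_norm_antideriv_le
  refine ⟨2 * (B * |M|) * B, by positivity, fun v w hv hw y => ?_⟩
  have hbd : ∀ v : LTwo, ‖v‖ ≤ M → ∀ x, ‖antideriv v x‖ ≤ B * |M| := fun v hv x =>
    (hB v x).trans (mul_le_mul_of_nonneg_left (hv.trans (le_abs_self M)) hB0)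
  have hg := norm_gram_sub_le (continuous_antideriv v) (continuous_antideriv w)
    (hbd v hv) (hbd w hw) (D := B * ‖v - w‖)
    (fun x => by rw [← antideriv_sub]; exact hB _ x) y
  rw [← inner_gram (continuous_antideriv v), ← inner_gram (continuous_antideriv w),
    ← inner_sub_right]
  refine (abs_real_inner_le_norm _ _).trans ((mul_le_mul_of_nonneg_left hg (norm_nonneg _)).trans
    (le_of_eq ?_))
  ring

lemma Regular.mono {R R' : ℝ} (hR : 0 < R) (hRR' : R ≤ R') {v : LTwo} (h : Regular R v) :
    Regular R' v where
  norm_le := h.norm_le.trans hRR'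
  chord x z hz := (inv_anti₀ hR hRR').trans (h.chord x z hz)
  coercive w := (mul_le_mul_of_nonneg_right (inv_anti₀ hR hRR') (sq_nonneg _)).trans (h.coercive w)

/-- An intersection of closed conditions, each continuous in v. Closedness carries regularity to the
endpoint of an existence interval. -/
lemma isClosed_regular (R : ℝ) : IsClosed {v | Regular R v} := by
  have h1 : ∀ x z, Continuous fun v : LTwo => chordRatio (antideriv v) x z := fun x z =>
    LipOnBalls.continuous fun M => by
      obtain ⟨L, -, hL⟩ := exists_chordRatio_lipschitz M
      exact ⟨L, fun v w hv hw => hL v w hv hw x z⟩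
  have h2 : ∀ y : E3, Continuous fun v : LTwo =>
      mean fun x => (inner ℝ (antideriv v x) y : ℝ) ^ 2 := fun y =>
    LipOnBalls.continuous fun M => by
      obtain ⟨L, -, hL⟩ := exists_form_lipschitz M
      refine ⟨L * ‖y‖ ^ 2, fun v w hv hw => (hL v w hv hw y).trans (le_of_eq (by ring))⟩
  have : {v | Regular R v} = {v : LTwo | ‖v‖ ≤ R} ∩
      ((⋂ x, ⋂ z, ⋂ _ : |z| ≤ π, {v : LTwo | R⁻¹ ≤ chordRatio (antideriv v) x z}) ∩
      ⋂ y : E3, {v : LTwo | R⁻¹ * ‖y‖ ^ 2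
        ≤ ‖y‖ ^ 2 - mean fun x => (inner ℝ (antideriv v x) y : ℝ) ^ 2}) := by
    ext v
    simp only [mem_ofPred_eq, mem_inter_iff, mem_iInter]
    exact ⟨fun h => ⟨h.norm_le, h.chord, h.coercive⟩, fun h => ⟨h.1, h.2.1, h.2.2⟩⟩
  rw [this]
  refine (isClosed_le continuous_norm continuous_const).inter ((isClosed_iInter fun x =>
    isClosed_iInter fun z => isClosed_iInter fun _ => isClosed_le continuous_const (h1 x z)).inter
    (isClosed_iInter fun y => isClosed_le continuous_const (continuous_const.sub (h2 y))))

/-- The gap between 1/R and 1/(R + 1) absorbs a small change of the chord ratio and of the quadratic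
form. The radius δ depends on R alone. -/
lemma exists_regular_nhds {R : ℝ} (hR : 1 ≤ R) : ∃ δ > 0, ∀ v w, Regular R v → ‖w - v‖ < δ →
    Regular (R + 1) w := by
  obtain ⟨L₁, hL₁, h₁⟩ := exists_chordRatio_lipschitz (R + 1)
  obtain ⟨L₂, hL₂, h₂⟩ := exists_form_lipschitz (R + 1)
  have hR0 : 0 < R := by linarith
  set d := R⁻¹ - (R + 1)⁻¹ with hd
  have hd0 : 0 < d := sub_pos.mpr (inv_strictAnti₀ hR0 (by linarith))
  refine ⟨min 1 (d / (L₁ + L₂ + 1)), by positivity, fun v w hv hw => ?_⟩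
  have hw1 : ‖w - v‖ < 1 := hw.trans_le (min_le_left _ _)
  have hw2 : (L₁ + L₂ + 1) * ‖w - v‖ ≤ d := by
    have := hw.le.trans (min_le_right _ _)
    rwa [le_div_iff₀ (by positivity), mul_comm] at this
  have hn := norm_nonneg (w - v)
  have hb1 : L₁ * ‖w - v‖ ≤ d := by nlinarith
  have hb2 : L₂ * ‖w - v‖ ≤ d := by nlinarith
  have hwn : ‖w‖ ≤ R + 1 := by
    have h3 := norm_add_le (w - v) v
    rw [sub_add_cancel] at h3
    linarith [hv.norm_le]
  have hvn : ‖v‖ ≤ R + 1 := by linarith [hv.norm_le]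
  refine ⟨hwn, fun x z hz => ?_, fun y => ?_⟩
  · have h3 := (abs_le.mp (h₁ w v hwn hvn x z)).1
    have h4 := hv.chord x z hz
    linarith
  · have h3 := (abs_le.mp (h₂ w v hwn hvn y)).2
    have h4 := hv.coercive y
    have h5 := mul_le_mul_of_nonneg_right hb2 (sq_nonneg ‖y‖)
    have h6 : d * ‖y‖ ^ 2 = R⁻¹ * ‖y‖ ^ 2 - (R + 1)⁻¹ * ‖y‖ ^ 2 := by rw [hd]; ring
    linarith

/-! ### Admissible fields are regular -/

/-- Rolle's theorem for the primitive of ⟨u, w⟩, which takes equal values at ±π because u has mean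
zero. -/
lemma exists_inner_eq_zero (v : LTwo) (w : E3) : ∃ x, (inner ℝ (antideriv v x) w : ℝ) = 0 := by
  have hc : Continuous fun x => (inner ℝ (antideriv v x) w : ℝ) :=
    (continuous_antideriv v).inner continuous_const
  have hd := fun x => (hc.integral_hasStrictDerivAt (-π) x).hasDerivAt
  have hzero : ∫ x in (-π)..π, (inner ℝ (antideriv v x) w : ℝ) = 0 := by
    have h1 := mean_clm_comp (innerSL ℝ w) (hasPrim_antideriv v |>.congr_ae EventuallyEq.rfl |>.memLp_top.integrable le_top)
    rw [mean_antideriv, map_zero, mean, smul_eq_zero, or_iff_right (by positivity)] at h1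
    simpa only [innerSL_apply_apply, real_inner_comm] using h1
  obtain ⟨c, -, hc0⟩ := exists_hasDerivAt_eq_zero neg_pi_lt_pi
    (f := fun y => ∫ x in (-π)..y, (inner ℝ (antideriv v x) w : ℝ))
    (fun x _ => (hd x).continuousAt.continuousWithinAt) (by simp [hzero]) fun x _ => hd x
  exact ⟨c, hc0⟩

/-- Unit fields with mean zero are coercive. -/
lemma exists_coercive (M : ℝ) : ∃ c > 0, ∀ v : LTwo, ‖v‖ ≤ M → (∀ x, ‖antideriv v x‖ = 1) →
    IsGramCoercive c (antideriv v) := by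
  have hH := holderConst_nonneg
  set A := (holderConst * |M|) ^ 2 with hA
  have hA0 : 0 ≤ A := sq_nonneg _
  -- Within distance ρ of a zero of ⟨u, w⟩, Hölder continuity gives ⟨u, w⟩² ≤ Aρ‖w‖² ≤ ‖w‖²/2. The
  -- coercivity deficit is thus at least ‖w‖²/2 on an interval of length 2ρ, which fits into one
  -- period.
  set ρ := min 1 (2 * (A + 1))⁻¹ with hρ
  have hρ0 : 0 < ρ := by positivity
  have hρ1 : ρ ≤ 1 := min_le_left _ _
  have hρA : A * ρ ≤ 1 / 2 := by
    have h1 : ρ ≤ (2 * (A + 1))⁻¹ := min_le_right _ _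
    have h2 : A * ρ ≤ A * (2 * (A + 1))⁻¹ := mul_le_mul_of_nonneg_left h1 hA0
    refine h2.trans ?_
    rw [← div_eq_mul_inv, div_le_iff₀ (by positivity)]
    linarith
  refine ⟨(2 * π)⁻¹ * ρ, by positivity, fun v hv h1 w => ?_⟩
  have hu := continuous_antideriv v
  set φ : ℝ → ℝ := fun x => ‖w‖ ^ 2 - (inner ℝ (antideriv v x) w : ℝ) ^ 2 with hφ
  have hφc : Continuous φ := by
    have := hu.inner (continuous_const (y := w)) (𝕜 := ℝ)
    fun_prop
  have hφ0 : ∀ x, 0 ≤ φ x := fun x => by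
    have h2 := abs_real_inner_le_norm (antideriv v x) w
    rw [h1, one_mul] at h2
    have := sq_le_sq' (by linarith [abs_nonneg (inner ℝ (antideriv v x) w : ℝ), norm_nonneg w]) h2
    rw [sq_abs] at this
    simp only [hφ]
    linarith
  have hmean : ‖w‖ ^ 2 - (mean fun x => (inner ℝ (antideriv v x) w : ℝ) ^ 2) = mean φ := by
    have hi : Continuous fun x => (inner ℝ (antideriv v x) w : ℝ) ^ 2 :=
      (hu.inner continuous_const).pow 2
    rw [hφ, mean_sub (integrable_const _) (integrable_of_continuous_torus hi), mean_const]
  obtain ⟨x₀, hx₀⟩ := exists_inner_eq_zero v w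
  have hper : Function.Periodic φ (2 * π) := fun x => by
    simp only [hφ, antideriv_periodic v x]
  have hlow : ∀ x ∈ Icc (x₀ - ρ) (x₀ + ρ), ‖w‖ ^ 2 / 2 ≤ φ x := fun x hx => by
    have hxa : |x - x₀| ≤ ρ := abs_le.mpr ⟨by linarith [hx.1], by linarith [hx.2]⟩
    have h2 : |(inner ℝ (antideriv v x) w : ℝ)| ≤ holderConst * |M| * √ρ * ‖w‖ := by
      rw [show (inner ℝ (antideriv v x) w : ℝ) = inner ℝ (antideriv v x - antideriv v x₀) w by
        rw [inner_sub_left, hx₀, sub_zero]]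
      refine (abs_real_inner_le_norm _ _).trans (mul_le_mul_of_nonneg_right ?_ (norm_nonneg _))
      refine (norm_antideriv_sub_le v (by linarith [Real.pi_gt_three])).trans ?_
      have := hv.trans (le_abs_self M)
      gcongr
    have h3 := pow_le_pow_left₀ (abs_nonneg _) h2 2
    rw [sq_abs, mul_pow, mul_pow, Real.sq_sqrt hρ0.le, ← hA] at h3
    have h4 := mul_le_mul_of_nonneg_right hρA (sq_nonneg ‖w‖)
    simp only [hφ]
    linarith
  have hint : ρ * ‖w‖ ^ 2 ≤ ∫ x in (-π)..π, φ x := by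
    have h2 : ∫ x in (-π)..π, φ x = ∫ x in (x₀ - π)..(x₀ - π + 2 * π), φ x := by
      rw [hper.intervalIntegral_add_eq (x₀ - π) (-π)]
      congr 1; ring
    have h3 : ∫ _ in (x₀ - ρ)..(x₀ + ρ), ‖w‖ ^ 2 / 2 ≤ ∫ x in (x₀ - ρ)..(x₀ + ρ), φ x :=
      intervalIntegral.integral_mono_on (by linarith)
        ((continuous_const (y := ‖w‖ ^ 2 / 2)).intervalIntegrable (μ := volume) _ _)
        (hφc.intervalIntegrable _ _) hlow
    have h4 : ∫ x in (x₀ - ρ)..(x₀ + ρ), φ x ≤ ∫ x in (x₀ - π)..(x₀ - π + 2 * π), φ x :=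
      intervalIntegral.integral_mono_interval (by linarith [Real.pi_gt_three]) (by linarith)
        (by linarith [Real.pi_gt_three]) (Eventually.of_forall hφ0) (hφc.intervalIntegrable _ _)
    rw [intervalIntegral.integral_const, smul_eq_mul] at h3
    rw [h2]
    linarith
  rw [hmean, mean, smul_eq_mul, mul_assoc]
  exact mul_le_mul_of_nonneg_left hint (by positivity)

lemma theta_le_of_distortion_le {γ : ℝ → E3} {D : ℝ} (hD : 0 ≤ D)
    (h : distortion γ ≤ ENNReal.ofReal D) (x y : ℝ) : theta (x - y) ≤ D * ‖γ x - γ y‖ := by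
  rcases (show 0 ≤ theta (x - y) from norm_nonneg _).eq_or_lt with h0 | h0
  · rw [← h0]; positivity
  · have h1 : ENNReal.ofReal (theta (x - y)) / ENNReal.ofReal ‖γ x - γ y‖ ≤ ENNReal.ofReal D :=
      (le_iSup₂_of_le x y (le_iSup (fun _ : 0 < theta (x - y) =>
        ENNReal.ofReal (theta (x - y)) / ENNReal.ofReal ‖γ x - γ y‖) h0)).trans h
    rw [ENNReal.div_le_iff_le_mul (Or.inr ENNReal.ofReal_ne_top) (Or.inl ENNReal.ofReal_ne_top),
      ← ENNReal.ofReal_mul hD] at h1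
    exact (ENNReal.ofReal_le_ofReal_iff (by positivity)).mp h1

/-- Bounds on the `H¹` norm and the distortion give regularity. -/
lemma exists_regular (M D : ℝ) : ∃ R, 1 ≤ R ∧ ∀ v : LTwo, ‖v‖ ≤ M → (∀ x, ‖antideriv v x‖ = 1) →
    distortion (inducedCurve (antideriv v)) ≤ ENNReal.ofReal D → Regular R v := by
  obtain ⟨c, hc0, hc⟩ := exists_coercive M
  set D' := max D 1 with hD'
  have hD1 : 1 ≤ D' := le_max_right _ _
  refine ⟨max (max 1 M) (max c⁻¹ (D' ^ 2)), (le_max_left _ _).trans (le_max_left _ _),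
    fun v hv h1 hdist => ⟨?_, fun x z hz => ?_, fun w => ?_⟩⟩
  · exact hv.trans ((le_max_right _ _).trans (le_max_left _ _))
  · have hR : (max (max 1 M) (max c⁻¹ (D' ^ 2)))⁻¹ ≤ (D' ^ 2)⁻¹ :=
      inv_anti₀ (by positivity) ((le_max_right _ _).trans (le_max_right _ _))
    refine hR.trans ?_
    rw [chordRatio_eq_norm_sq (continuous_antideriv v) h1, ← inv_pow]
    refine pow_le_pow_left₀ (by positivity) ?_ 2
    -- Distortion says nothing on the diagonal, where the arc mean is u(x) itself and has length
    -- one.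
    rcases eq_or_ne z 0 with rfl | hz0
    · have : arcMean (antideriv v) x 0 = antideriv v x := by simp [arcMean]
      rw [this, h1]
      exact inv_le_one_of_one_le₀ hD1
    · have h2 := theta_le_of_distortion_le (by linarith)
        (hdist.trans (ENNReal.ofReal_le_ofReal (le_max_left D 1))) x (x - z)
      rw [inducedCurve_sub, sub_sub_cancel, theta_eq_abs hz, norm_smul, Real.norm_eq_abs,
        mul_left_comm] at h2
      have h3 : 1 ≤ D' * ‖arcMean (antideriv v) x z‖ :=
        le_of_mul_le_mul_left (by linarith) (abs_pos.mpr hz0)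
      rw [inv_eq_one_div, div_le_iff₀ (by positivity)]
      linarith
  · refine (mul_le_mul_of_nonneg_right ?_ (sq_nonneg _)).trans (hc v hv h1 w)
    exact inv_le_of_inv_le₀ hc0 ((le_max_left _ _).trans (le_max_right _ _))

lemma IsBiLipschitz.exists_distortion_le {γ : ℝ → E3} (h : IsBiLipschitz γ) :
    ∃ D, distortion γ ≤ ENNReal.ofReal D := by
  obtain ⟨l, hl, hb⟩ := h
  refine ⟨l, iSup_le fun x => iSup_le fun y => iSup_le fun _ => ?_⟩
  rw [ENNReal.div_le_iff_le_mul (Or.inr ENNReal.ofReal_ne_top) (Or.inl ENNReal.ofReal_ne_top),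
    ← ENNReal.ofReal_mul hl.le]
  refine ENNReal.ofReal_le_ofReal ?_
  have := (hb x y).1
  rwa [inv_mul_le_iff₀ hl] at this

/-- The chord ratio is a squared quotient, so √R would serve as the constant; R ≥ 1 allows the
cruder R. -/
lemma Regular.isAdmissible {R : ℝ} (hR : 1 ≤ R) {v : LTwo} (h : Regular R v)
    (h1 : ∀ x, ‖antideriv v x‖ = 1) : IsAdmissible (antideriv v) where
  memH1 := memH1_antideriv v
  mean_zero := mean_antideriv v
  unit_speed := h1
  biLipschitz := by
    refine ⟨R, by linarith, fun x y => ?_⟩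
    set z := toIocMod Real.two_pi_pos (-π) (x - y) with hz
    have hzm := toIocMod_mem_torus (x - y)
    have hza : |z| ≤ π := abs_le.mpr ⟨hzm.1.le, hzm.2⟩
    have hθ : theta (x - y) = |z| := by
      rw [← theta_periodic.apply_toIocMod, theta_eq_abs hza]
    have hγ : inducedCurve (antideriv v) y = inducedCurve (antideriv v) (x - z) := by
      have h2 : Function.Periodic (fun s => inducedCurve (antideriv v) (x - s)) (2 * π) := fun s => by
        simp only
        rw [← inducedCurve_periodic v (x - (s + 2 * π))]
        congr 1; ring
      have := h2.apply_toIocMod (x - y)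
      simpa using this.symm
    have hc := h.chord x z hza
    rw [chordRatio_eq_norm_sq (continuous_antideriv v) h1] at hc
    rw [hθ, hγ, inducedCurve_sub, norm_smul, Real.norm_eq_abs]
    constructor
    · rw [mul_comm]
      refine mul_le_mul_of_nonneg_left ?_ (abs_nonneg _)
      refine abs_le_of_sq_le_sq' (le_trans ?_ hc) (norm_nonneg _) |>.2
      rw [sq]
      exact mul_le_of_le_one_left (by positivity) (inv_le_one_of_one_le₀ hR)
    · exact mul_le_of_le_one_right (abs_nonneg _) (norm_arcMean_le (fun y => (h1 y).le) x z)

/-! ### Mild solutions in terms of the derivative of the tangent field -/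

/-- `G` is a Lipschitz extension of the lower order terms, as a function of the derivative of
the tangent field, from the set of `R`-regular fields. -/
structure IsNonlinearity (K : ℝ → ℝ → ℝ) (R : ℝ) (G : LTwo → LOne) : Prop where
  one_le : 1 ≤ R
  lipschitz : ∃ L, LipschitzWith L G
  mean_eq : ∀ v, Regular R v → mean v = 0 → meanL (G v) = 0
  projected : ∃ C : ℝ, ∀ v, Regular R v → mean v = 0 → ∃ a : LInf, ‖a‖ ≤ C ∧
    G v =ᵐ[torusMeasure] fun x =>
      a x + (‖v x‖ ^ 2 - inner ℝ (a x) (antideriv v x)) • antideriv v x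
  eq_lowerOrder : ∀ v, Regular R v → mean v = 0 → (∀ x, ‖antideriv v x‖ = 1) →
    G v =ᵐ[torusMeasure] lowerOrder K (antideriv v)

lemma IsHomogeneous.exists_isNonlinearity {K : ℝ → ℝ → ℝ} {h : ℝ → ℝ} {p R : ℝ}
    (hK : IsHomogeneous K h p) (hdeg : IsZeroDegenerate h p ∨ ∃ m : ℕ, IsDegenerate h p m)
    (hR : 1 ≤ R) : ∃ G, IsNonlinearity K R G := by
  obtain ⟨G, hL, C, hC⟩ := hK.exists_nonlinearity hdeg hR
  exact ⟨G, hR, hL, fun v hv hm => (hC v hv hm).1, ⟨C, fun v hv hm => (hC v hv hm).2.1⟩,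
    fun v hv hm => (hC v hv hm).2.2⟩

variable {K : ℝ → ℝ → ℝ} {R T : ℝ} {G : LTwo → LOne} {v : ℝ → LTwo} {τ₀ : ℝ → E3}
  {τ : ℝ → ℝ → E3}

lemma IsNonlinearity.continuous (hG : IsNonlinearity K R G) : Continuous G := by
  obtain ⟨L, hL⟩ := hG.lipschitz
  exact hL.continuous

/-- The primitive is evaluated under the time integral by `antideriv_heatD`; the subtracted means
vanish because G has mean zero on regular fields. -/
lemma IsNonlinearity.antideriv_duhamel (hG : IsNonlinearity K R G)
    (hv : ContinuousOn v (Icc 0 T)) (hreg : ∀ t ∈ Icc 0 T, Regular R (v t))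
    (hm : ∀ t ∈ Icc 0 T, mean (v t) = 0) (h1 : ∀ t ∈ Icc 0 T, ∀ x, ‖antideriv (v t) x‖ = 1)
    (v₀ : LTwo) {t : ℝ} (ht : t ∈ Icc 0 T) (x : ℝ) :
    antideriv (heatFlow v₀ t + volterra heatD (fun s => G (v s)) t) x
      = heatSemigroup t (antideriv v₀) x
        + ∫ s in (0 : ℝ)..t, heatSemigroup (t - s) (lowerOrder K (antideriv (v s))) x := by
  have hGc : ContinuousOn (fun s => G (v s)) (Icc 0 T) :=
    hG.continuous.comp_continuousOn hv
  rw [← antiEval_apply, map_add, antiEval_apply, antideriv_heatFlow v₀ ht.1,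
    clm_volterra_heatD _ hGc ht]
  congr 1
  refine intervalIntegral_congr_Ico ht.1 fun s hs => ?_
  have hs' : s ∈ Icc 0 T := ⟨hs.1, hs.2.le.trans ht.2⟩
  have hts : 0 < t - s := sub_pos.mpr hs.2
  rw [antiEval_apply, antideriv_heatD hts, ← meanL_apply, hG.mean_eq _ (hreg s hs') (hm s hs'),
    sub_zero]
  exact heatSemigroup_congr_ae (hG.eq_lowerOrder _ (hreg s hs') (hm s hs') (h1 s hs')) hts.ne' x

lemma norm_eq_h1norm {v : LTwo} (hv : mean v = 0) : ‖v‖ = √(2 * π) * h1norm (antideriv v) := by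
  rw [h1norm_antideriv, centre_eq_self hv, ← mul_assoc, ← Real.sqrt_mul (by positivity),
    mul_inv_cancel₀ (by positivity), Real.sqrt_one, one_mul]

lemma norm_sub_eq_h1norm {v w : LTwo} (hv : mean v = 0) (hw : mean w = 0) :
    ‖v - w‖ = √(2 * π) * h1norm (antideriv v - antideriv w) := by
  rw [h1norm_antideriv_sub, centre_eq_self hv, centre_eq_self hw, ← mul_assoc,
    ← Real.sqrt_mul (by positivity), mul_inv_cancel₀ (by positivity), Real.sqrt_one, one_mul]

lemma IsAdmissible.antideriv_derivTwo {u : ℝ → E3} (h : IsAdmissible u) :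
    antideriv (derivTwo u) = u := h.memH1.antideriv_derivTwo h.mean_zero

lemma IsAdmissible.mean_derivTwo {u : ℝ → E3} (h : IsAdmissible u) :
    mean (derivTwo u) = 0 := h.memH1.mean_derivTwo h.mean_zero

lemma IsAdmissible.norm_antideriv_derivTwo {u : ℝ → E3} (h : IsAdmissible u) (x : ℝ) :
    ‖antideriv (derivTwo u) x‖ = 1 := by
  rw [h.antideriv_derivTwo, h.unit_speed]

lemma IsAdmissible.exists_regular {u : ℝ → E3} (h : IsAdmissible u) :
    ∃ R, 1 ≤ R ∧ Regular R (derivTwo u) := by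
  obtain ⟨D, hD⟩ := h.biLipschitz.exists_distortion_le
  obtain ⟨R, hR, hreg⟩ := CurveFlow.exists_regular ‖derivTwo u‖ D
  exact ⟨R, hR, hreg _ le_rfl h.norm_antideriv_derivTwo (by rwa [h.antideriv_derivTwo])⟩

lemma IsMildSolution.continuousOn_derivTwo (h : IsMildSolution K τ₀ T τ) :
    ContinuousOn (fun t => derivTwo (τ t)) (Icc 0 T) := fun t ht => by
  refine tendsto_iff_norm_sub_tendsto_zero.mpr ?_
  have h1 := (h.continuous t ht).const_mul √(2 * π)
  rw [mul_zero] at h1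
  refine h1.congr' ?_
  filter_upwards [self_mem_nhdsWithin] with s hs
  rw [norm_sub_eq_h1norm (h.admissible s hs).mean_derivTwo (h.admissible t ht).mean_derivTwo,
    (h.admissible s hs).antideriv_derivTwo, (h.admissible t ht).antideriv_derivTwo]

/-- Every time has a neighbourhood on which a single constant works, by continuity in L², and
compactness of [0, T] leaves finitely many constants. -/
lemma IsMildSolution.exists_regular (h : IsMildSolution K τ₀ T τ) :
    ∃ R, 1 ≤ R ∧ ∀ t ∈ Icc 0 T, Regular R (derivTwo (τ t)) := by
  refine isCompact_Icc.induction_on (p := fun s => ∃ R, 1 ≤ R ∧ ∀ t ∈ s, Regular R (derivTwo (τ t)))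
    ⟨1, le_rfl, by simp⟩ (fun s s' hss ⟨R, hR, h⟩ => ⟨R, hR, fun t ht => h t (hss ht)⟩) ?_ ?_
  · rintro s s' ⟨R, hR, h⟩ ⟨R', hR', h'⟩
    refine ⟨max R R', hR.trans (le_max_left _ _), fun t ht => ?_⟩
    rcases ht with ht | ht
    · exact (h t ht).mono (by linarith) (le_max_left _ _)
    · exact (h' t ht).mono (by linarith) (le_max_right _ _)
  · intro t ht
    obtain ⟨R, hR, hreg⟩ := (h.admissible t ht).exists_regular
    obtain ⟨δ, hδ, hδr⟩ := exists_regular_nhds hR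
    refine ⟨_, h.continuousOn_derivTwo t ht (Metric.ball_mem_nhds _ hδ), R + 1, by linarith,
      fun s hs => hδr _ _ hreg ?_⟩
    simpa [dist_eq_norm] using hs

/-- Both sides have mean zero and, by Duhamel's formula, the same primitive, which determines them.
-/
lemma IsMildSolution.eq_volterra (h : IsMildSolution K τ₀ T τ) (hG : IsNonlinearity K R G)
    (hreg : ∀ t ∈ Icc 0 T, Regular R (derivTwo (τ t))) (h₀ : IsAdmissible τ₀) :
    ∀ t ∈ Icc 0 T, derivTwo (τ t) = heatFlow (derivTwo τ₀) t
      + volterra heatD (fun s => G (derivTwo (τ s))) t := by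
  intro t ht
  have hm := fun t ht => (h.admissible t ht).mean_derivTwo
  have hcont := h.continuousOn_derivTwo
  have hGc : ContinuousOn (fun s => G (derivTwo (τ s))) (Icc 0 T) :=
    hG.continuous.comp_continuousOn hcont
  have key : antideriv (heatFlow (derivTwo τ₀) t
      + volterra heatD (fun s => G (derivTwo (τ s))) t) = τ t := by
    funext x
    rw [hG.antideriv_duhamel hcont hreg hm
      (fun t ht => (h.admissible t ht).norm_antideriv_derivTwo) _ ht, h.duhamel t ht x,
      h₀.antideriv_derivTwo]
    refine congrArg (heatSemigroup t τ₀ x + ·) ?_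
    refine intervalIntegral_congr_Ico ht.1 fun s hs => ?_
    rw [(h.admissible s ⟨hs.1, hs.2.le.trans ht.2⟩).antideriv_derivTwo]
  have hzero : mean (heatFlow (derivTwo τ₀) t
      + volterra heatD (fun s => G (derivTwo (τ s))) t : LTwo) = 0 := by
    rw [← mean_congr_ae (coeFn_toOne _), ← meanL_apply, map_add, map_add,
      meanL_heatFlow h₀.mean_derivTwo ht.1,
      meanL_volterra_heatD hGc ht, add_zero]
  rw [← centre_eq_self hzero, ← derivTwo_antideriv, key]

/-- Regular solutions of the integral equation for the derivative are mild solutions. -/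
lemma IsNonlinearity.isMildSolution (hG : IsNonlinearity K R G) (hT : 0 ≤ T)
    (h₀ : IsAdmissible τ₀) (hv : ContinuousOn v (Icc 0 T))
    (heq : ∀ t ∈ Icc 0 T, v t = heatFlow (derivTwo τ₀) t + volterra heatD (fun s => G (v s)) t)
    (hreg : ∀ t ∈ Icc 0 T, Regular R (v t)) :
    IsMildSolution K τ₀ T fun t => antideriv (v t) := by
  have hv0 : v 0 = derivTwo τ₀ := by
    rw [heq 0 (left_mem_Icc.mpr hT), heatFlow_zero, volterra, intervalIntegral.integral_same,
      add_zero]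
  have hGc : ContinuousOn (fun s => G (v s)) (Icc 0 T) := hG.continuous.comp_continuousOn hv
  have hm : ∀ t ∈ Icc 0 T, mean (v t) = 0 := fun t ht => by
    rw [← mean_congr_ae (coeFn_toOne _), ← meanL_apply, heq t ht, map_add, map_add,
      meanL_heatFlow h₀.mean_derivTwo ht.1, meanL_volterra_heatD hGc ht, add_zero]
  have hsol : IsIntegralSolution T v fun s => G (v s) :=
    ⟨hT, hm 0 (left_mem_Icc.mpr hT), hv, hGc, by rwa [hv0],
      fun t ht => hG.mean_eq _ (hreg t ht) (hm t ht)⟩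
  obtain ⟨C, hC⟩ := hG.projected
  -- Only once unit length is known does G coincide with the actual lower order terms.
  have h1 := hsol.norm_eq_one (fun t ht => (hreg t ht).norm_le)
    (fun t ht => hC _ (hreg t ht) (hm t ht)) (by rw [hv0]; exact h₀.norm_antideriv_derivTwo)
  refine ⟨fun t ht => (hreg t ht).isAdmissible hG.one_le (h1 t ht), fun t ht => ?_,
    fun t ht x => ?_⟩
  · have h2 := (tendsto_iff_norm_sub_tendsto_zero.mp (hv t ht)).const_mul (√(2 * π))⁻¹
    rw [mul_zero] at h2
    refine h2.congr' ?_
    filter_upwards [self_mem_nhdsWithin] with s hs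
    rw [norm_sub_eq_h1norm (hm s hs) (hm t ht), inv_mul_cancel_left₀ (by positivity)]
  · have h3 := hG.antideriv_duhamel hv hreg hm h1 (derivTwo τ₀) ht x
    rwa [← heq t ht, h₀.antideriv_derivTwo] at h3

lemma IsMildSolution.mono (h : IsMildSolution K τ₀ T τ) {T' : ℝ} (hT : T' ≤ T) :
    IsMildSolution K τ₀ T' τ := by
  have hs : Icc 0 T' ⊆ Icc 0 T := Icc_subset_Icc_right hT
  exact ⟨fun t ht => h.admissible t (hs ht),
    fun t ht => (h.continuous t (hs ht)).mono_left (nhdsWithin_mono _ hs),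
    fun t ht => h.duhamel t (hs ht)⟩

lemma IsMildSolution.congr (h : IsMildSolution K τ₀ T τ) {σ : ℝ → ℝ → E3}
    (hσ : EqOn σ τ (Icc 0 T)) : IsMildSolution K τ₀ T σ := by
  refine ⟨fun t ht => hσ ht ▸ h.admissible t ht, fun t ht => ?_, fun t ht x => ?_⟩
  · refine (h.continuous t ht).congr' ?_
    filter_upwards [self_mem_nhdsWithin] with s hs
    rw [hσ hs, hσ ht]
  · rw [hσ ht, h.duhamel t ht x]
    refine congrArg (heatSemigroup t τ₀ x + ·) ?_
    refine intervalIntegral_congr_Ico ht.1 fun s hs => ?_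
    rw [hσ ⟨hs.1, hs.2.le.trans ht.2⟩]

/-! ### Uniqueness, local existence and continuation -/

variable {K : ℝ → ℝ → ℝ} {h : ℝ → ℝ} {p R S T : ℝ} {G : LTwo → LOne} {u : ℝ → LTwo}
  {τ₀ : ℝ → E3} {τ σ : ℝ → ℝ → E3}

/-- On [0, T] both solutions are regular with one common constant, hence solve the same globally
Lipschitz Volterra equation. -/
lemma IsMildSolution.eqOn (hK : IsHomogeneous K h p)
    (hdeg : IsZeroDegenerate h p ∨ ∃ m : ℕ, IsDegenerate h p m) (h₀ : IsAdmissible τ₀)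
    (hT : 0 ≤ T) (hσ : IsMildSolution K τ₀ T σ) (hτ : IsMildSolution K τ₀ T τ) :
    EqOn σ τ (Icc 0 T) := by
  obtain ⟨R₁, hR₁, h₁⟩ := hσ.exists_regular
  obtain ⟨R₂, hR₂, h₂⟩ := hτ.exists_regular
  obtain ⟨G, hG⟩ := hK.exists_isNonlinearity hdeg (hR₁.trans (le_max_left R₁ R₂))
  obtain ⟨L, hL⟩ := hG.lipschitz
  have := isSingularKernel_heatD.volterra_unique hT hL hσ.continuousOn_derivTwo
    hτ.continuousOn_derivTwo
    (hσ.eq_volterra hG (fun t ht => (h₁ t ht).mono (by linarith) (le_max_left _ _)) h₀)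
    (hτ.eq_volterra hG (fun t ht => (h₂ t ht).mono (by linarith) (le_max_right _ _)) h₀)
  intro t ht
  rw [← (hσ.admissible t ht).antideriv_derivTwo, ← (hτ.admissible t ht).antideriv_derivTwo]
  exact congrArg antideriv (this ht)

/-- The nonlinearity is correct up to R + 1 while u is R-regular up to S, and continuity keeps u (R
+ 1)-regular a little longer. S = 0 yields local existence, S > 0 continuation. -/
lemma IsNonlinearity.exists_extension (hG : IsNonlinearity K (R + 1) G) (hR : 1 ≤ R) (hS : 0 ≤ S)
    (h₀ : IsAdmissible τ₀) (hu : ContinuousOn u (Icc 0 (S + 1)))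
    (heq : ∀ t ∈ Icc 0 (S + 1),
      u t = heatFlow (derivTwo τ₀) t + volterra heatD (fun s => G (u s)) t)
    (hreg : ∀ t ∈ Icc 0 S, Regular R (u t)) :
    ∃ S' > S, ∃ σ, IsMildSolution K τ₀ S' σ := by
  obtain ⟨δ, hδ, hδr⟩ := exists_regular_nhds hR
  have hS1 : S ∈ Icc 0 (S + 1) := ⟨hS, by linarith⟩
  obtain ⟨ε, hε, hball⟩ := Metric.mem_nhdsWithin_iff.mp
    (hu S hS1 (Metric.ball_mem_nhds _ hδ))
  have hm : min (ε / 2) 1 ≤ ε / 2 := min_le_left _ _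
  have hm1 : min (ε / 2) 1 ≤ 1 := min_le_right _ _
  have hm0 : 0 < min (ε / 2) 1 := by positivity
  have hsub : Icc 0 (S + min (ε / 2) 1) ⊆ Icc 0 (S + 1) := Icc_subset_Icc_right (by linarith)
  refine ⟨S + min (ε / 2) 1, by linarith, _, hG.isMildSolution (by linarith) h₀ (hu.mono hsub)
    (fun t ht => heq t (hsub ht)) fun t ht => ?_⟩
  rcases le_or_gt t S with h | h
  · exact (hreg t ⟨ht.1, h⟩).mono (by linarith) (by linarith)
  · refine hδr (u S) _ (hreg S ⟨hS, le_rfl⟩) ?_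
    have : t ∈ Metric.ball S ε := by
      rw [Metric.mem_ball, Real.dist_eq, abs_of_pos (by linarith)]
      linarith [ht.2]
    simpa [dist_eq_norm] using hball ⟨this, hsub ht⟩

lemma continuousOn_heatFlow_derivTwo (h₀ : IsAdmissible τ₀) (T : ℝ) :
    ContinuousOn (heatFlow (derivTwo τ₀)) (Icc 0 T) :=
  (continuousOn_heatFlow h₀.mean_derivTwo).mono Icc_subset_Ici_self

lemma exists_isMildSolution (hK : IsHomogeneous K h p)
    (hdeg : IsZeroDegenerate h p ∨ ∃ m : ℕ, IsDegenerate h p m) (h₀ : IsAdmissible τ₀) :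
    ∃ T > 0, ∃ σ, IsMildSolution K τ₀ T σ := by
  obtain ⟨R, hR, hreg⟩ := h₀.exists_regular
  obtain ⟨G, hG⟩ := hK.exists_isNonlinearity hdeg (R := R + 1) (by linarith)
  obtain ⟨L, hL⟩ := hG.lipschitz
  obtain ⟨u, hu, heq⟩ := isSingularKernel_heatD.volterra_exists (T := 0 + 1) (by norm_num) hL
    (continuousOn_heatFlow_derivTwo h₀ _)
  refine hG.exists_extension hR le_rfl h₀ hu heq fun t ht => ?_
  obtain rfl : t = 0 := le_antisymm ht.2 ht.1
  rw [heq 0 ⟨le_rfl, by norm_num⟩, heatFlow_zero, volterra, intervalIntegral.integral_same,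
    add_zero]
  exact hreg

/-- The extended equation has a solution u beyond S regardless of τ. By uniqueness u = τ_x before S,
so u is R-regular there, hence also at S because regularity is closed. -/
lemma exists_isMildSolution_gt (hK : IsHomogeneous K h p)
    (hdeg : IsZeroDegenerate h p ∨ ∃ m : ℕ, IsDegenerate h p m) (h₀ : IsAdmissible τ₀)
    (hS : 0 < S) (hτ : ∀ T < S, IsMildSolution K τ₀ T τ) (hR : 1 ≤ R)
    (hreg : ∀ t ∈ Ico 0 S, Regular R (derivTwo (τ t))) :
    ∃ S' > S, ∃ σ, IsMildSolution K τ₀ S' σ := by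
  obtain ⟨G, hG⟩ := hK.exists_isNonlinearity hdeg (R := R + 1) (by linarith)
  obtain ⟨L, hL⟩ := hG.lipschitz
  obtain ⟨u, hu, heq⟩ := isSingularKernel_heatD.volterra_exists (T := S + 1) (by linarith) hL
    (continuousOn_heatFlow_derivTwo h₀ _)
  have hmaps : MapsTo u (Ico 0 S) {v | Regular R v} := fun t ht => by
    have hsub : Icc 0 t ⊆ Icc 0 (S + 1) := Icc_subset_Icc_right (by linarith [ht.2])
    have hut := isSingularKernel_heatD.volterra_unique ht.1 hL (hu.mono hsub)
      (hτ t ht.2).continuousOn_derivTwo (fun s hs => heq s (hsub hs))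
      ((hτ t ht.2).eq_volterra hG (fun s hs =>
        (hreg s ⟨hs.1, hs.2.trans_lt ht.2⟩).mono (by linarith) (by linarith)) h₀)
    have hut' : u t = derivTwo (τ t) := hut ⟨ht.1, le_rfl⟩
    rw [mem_ofPred_eq, hut']
    exact hreg t ht
  refine hG.exists_extension hR hS.le h₀ hu heq fun t ht => ?_
  rcases ht.2.lt_or_eq with hlt | rfl
  · exact hmaps ⟨ht.1, hlt⟩
  · have hcl : t ∈ closure (Ico 0 t) := by
      rw [closure_Ico hS.ne]
      exact ht
    have hc : ContinuousWithinAt u (Ico 0 t) t :=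
      (hu t ⟨hS.le, by linarith⟩).mono fun s hs => ⟨hs.1, by linarith [hs.2]⟩
    exact (isClosed_regular R).closure_subset (hc.mem_closure hcl hmaps)

/-! ### The maximal solution -/

lemma exists_mem_existenceTimes {t : ℝ} (ht : ENNReal.ofReal t < maximalTime K τ₀) :
    ∃ T ∈ existenceTimes K τ₀, t < T := by
  obtain ⟨T, hT, h⟩ := by simpa only [maximalTime, lt_iSup_iff] using ht
  exact ⟨T, hT, (ENNReal.ofReal_lt_ofReal_iff'.mp h).1⟩

lemma maximalTime_pos (hK : IsHomogeneous K h p)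
    (hdeg : IsZeroDegenerate h p ∨ ∃ m : ℕ, IsDegenerate h p m) (h₀ : IsAdmissible τ₀) :
    0 < maximalTime K τ₀ := by
  obtain ⟨T, hT, hσ⟩ := exists_isMildSolution hK hdeg h₀
  exact (ENNReal.ofReal_pos.mpr hT).trans_le
    (le_iSup₂_of_le T (show T ∈ existenceTimes K τ₀ from ⟨hT, hσ⟩) le_rfl)

/-- At each time some mild solution reaching it is selected, and uniqueness makes the choice
irrelevant. The value 0 is used only at times that no mild solution reaches. -/
lemma exists_maximal (hK : IsHomogeneous K h p)
    (hdeg : IsZeroDegenerate h p ∨ ∃ m : ℕ, IsDegenerate h p m) (h₀ : IsAdmissible τ₀) :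
    ∃ τ : ℝ → ℝ → E3,
      (∀ T : ℝ, ENNReal.ofReal T < maximalTime K τ₀ → IsMildSolution K τ₀ T τ) ∧
      ∀ (T : ℝ) (σ : ℝ → ℝ → E3), IsMildSolution K τ₀ T σ → EqOn σ τ (Icc 0 T) := by
  classical
  set τ : ℝ → ℝ → E3 := fun t =>
    if h : ∃ q : ℝ × (ℝ → ℝ → E3), IsMildSolution K τ₀ q.1 q.2 ∧ t ∈ Icc 0 q.1
    then h.choose.2 t else 0 with hτ
  have huniq : ∀ (T : ℝ) (σ : ℝ → ℝ → E3), IsMildSolution K τ₀ T σ → EqOn σ τ (Icc 0 T) := by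
    intro T σ hσ t ht
    have hex : ∃ q : ℝ × (ℝ → ℝ → E3), IsMildSolution K τ₀ q.1 q.2 ∧ t ∈ Icc 0 q.1 :=
      ⟨(T, σ), hσ, ht⟩
    obtain ⟨h1, h2⟩ := hex.choose_spec
    simp only [hτ, dif_pos hex]
    exact (hσ.mono ht.2).eqOn hK hdeg h₀ ht.1 (h1.mono h2.2) ⟨ht.1, le_rfl⟩
  refine ⟨τ, fun T hT => ?_, huniq⟩
  obtain ⟨T', ⟨-, σ, hσ⟩, hlt⟩ := exists_mem_existenceTimes hT
  exact (hσ.mono hlt.le).congr fun t ht => (huniq T' σ hσ ⟨ht.1, ht.2.trans hlt.le⟩).symm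

/-- The bounds give one regularity constant near T*, and compactness gives one on the remaining
closed interval. A mild solution then exists beyond T*, contradicting the supremum. -/
lemma not_eventually_bounded (hK : IsHomogeneous K h p)
    (hdeg : IsZeroDegenerate h p ∨ ∃ m : ℕ, IsDegenerate h p m) (h₀ : IsAdmissible τ₀)
    (hτ : ∀ T : ℝ, ENNReal.ofReal T < maximalTime K τ₀ → IsMildSolution K τ₀ T τ)
    (hfin : maximalTime K τ₀ ≠ ∞) (H D : ℝ) :
    ¬ ∀ᶠ t in 𝓝[<] (maximalTime K τ₀).toReal,
      h1norm (τ t) ≤ H ∧ distortion (inducedCurve (τ t)) ≤ ENNReal.ofReal D := by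
  set S := (maximalTime K τ₀).toReal with hS
  have hpos := maximalTime_pos hK hdeg h₀
  have hS0 : 0 < S := ENNReal.toReal_pos hpos.ne' hfin
  have hofS : ENNReal.ofReal S = maximalTime K τ₀ := ENNReal.ofReal_toReal hfin
  have hmild : ∀ T < S, IsMildSolution K τ₀ T τ := fun T hT =>
    hτ T (by rw [← hofS]; exact (ENNReal.ofReal_lt_ofReal_iff hS0).mpr hT)
  intro hev
  obtain ⟨a, haS, ha⟩ := (mem_nhdsLT_iff_exists_Ioo_subset).mp hev
  -- A time in [0, S) beyond a: compactness handles the times up to b, the assumed bounds those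
  -- after it.
  set b := max ((a + S) / 2) 0 with hb
  have hab : a < b := lt_of_lt_of_le (by linarith [show a < S from haS]) (le_max_left _ _)
  have hbS : b < S := max_lt (by linarith [show a < S from haS]) hS0
  obtain ⟨R₁, hR₁, h₁⟩ := (hmild b hbS).exists_regular
  obtain ⟨R₂, hR₂, h₂⟩ := exists_regular (√(2 * π) * H) D
  obtain ⟨S', hS', hσ⟩ := exists_isMildSolution_gt hK hdeg h₀ hS0 hmild
    (hR₁.trans (le_max_left R₁ R₂)) fun t ht => by
      rcases le_or_gt t b with htb | htb
      · exact (h₁ t ⟨ht.1, htb⟩).mono (by linarith) (le_max_left _ _)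
      · have hadm := (hmild t ht.2).admissible t ⟨ht.1, le_rfl⟩
        have hbd := ha ⟨hab.trans htb, ht.2⟩
        refine (h₂ _ ?_ hadm.norm_antideriv_derivTwo ?_).mono (by linarith) (le_max_right _ _)
        · rw [norm_eq_h1norm hadm.mean_derivTwo, hadm.antideriv_derivTwo]
          exact mul_le_mul_of_nonneg_left hbd.1 (Real.sqrt_nonneg _)
        · rw [hadm.antideriv_derivTwo]
          exact hbd.2
  have hle : ENNReal.ofReal S' ≤ maximalTime K τ₀ :=
    le_iSup₂_of_le S' (show S' ∈ existenceTimes K τ₀ from ⟨hS0.trans hS', hσ⟩) le_rfl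
  rw [← hofS] at hle
  exact absurd ((ENNReal.ofReal_le_ofReal_iff hS0.le).mp hle) (not_le.mpr hS')

lemma exists_eventually_le_ofReal {α : Type*} {l : Filter α} {f : α → ℝ≥0∞}
    (hf : limsup f l ≠ ∞) : ∃ D : ℝ, 0 ≤ D ∧ ∀ᶠ x in l, f x ≤ ENNReal.ofReal D := by
  obtain ⟨b, hb, hbt⟩ := exists_between (lt_top_iff_ne_top.mpr hf)
  refine ⟨b.toReal, ENNReal.toReal_nonneg, ?_⟩
  rw [ENNReal.ofReal_toReal hbt.ne]
  exact (eventually_lt_of_limsup_lt hb).mono fun x hx => hx.le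

end CurveFlow

end

/-! ### Assembly of the main theorem -/

open CurveFlow
theorem mainTheorem4
    (K : ℝ → ℝ → ℝ) (h : ℝ → ℝ) (p : ℝ)
    (hK : IsHomogeneous K h p)
    (hdeg : IsZeroDegenerate h p ∨ ∃ m : ℕ, IsDegenerate h p m)
    (τ₀ : ℝ → E3) (hτ₀ : IsAdmissible τ₀) :
    0 < maximalTime K τ₀ ∧
    ∃ τ : ℝ → ℝ → E3,
      -- `τ` is a mild solution on `[0, T*)`
      (∀ T : ℝ, 0 < T → ENNReal.ofReal T < maximalTime K τ₀ → IsMildSolution K τ₀ T τ) ∧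
      -- every mild solution agrees with `τ`
      (∀ (T : ℝ) (σ : ℝ → ℝ → E3), IsMildSolution K τ₀ T σ →
        ∀ t ∈ Icc 0 T, ENNReal.ofReal t < maximalTime K τ₀ → σ t = τ t) ∧
      -- blow-up alternative
      (maximalTime K τ₀ < ∞ →
        limsup (fun t => ENNReal.ofReal (h1norm (τ t)))
            (𝓝[<] (maximalTime K τ₀).toReal) = ∞ ∨
        limsup (fun t => distortion (inducedCurve (τ t)))
            (𝓝[<] (maximalTime K τ₀).toReal) = ∞) ∧
      -- uniform bounds give global existence
      ((∃ H D : ℝ, ∀ t : ℝ, 0 ≤ t → ENNReal.ofReal t < maximalTime K τ₀ →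
          h1norm (τ t) ≤ H ∧ distortion (inducedCurve (τ t)) ≤ ENNReal.ofReal D) →
        maximalTime K τ₀ = ∞ ∧ ∀ T : ℝ, 0 < T → IsMildSolution K τ₀ T τ) := by
  have hpos := maximalTime_pos hK hdeg hτ₀
  obtain ⟨τ, hτ, huniq⟩ := exists_maximal hK hdeg hτ₀
  refine ⟨hpos, τ, fun T _ hT => hτ T hT, fun T σ hσ t ht _ => huniq T σ hσ ht, fun hfin => ?_, ?_⟩
  -- If both upper limits were finite, both quantities would be bounded near T*, which
  -- `not_eventually_bounded` excludes.
  · by_contra! hne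
    obtain ⟨H, hH0, hH⟩ := exists_eventually_le_ofReal hne.1
    obtain ⟨D, -, hD⟩ := exists_eventually_le_ofReal hne.2
    refine not_eventually_bounded hK hdeg hτ₀ hτ hfin.ne H D ?_
    filter_upwards [hH, hD] with t h1 h2
    exact ⟨(ENNReal.ofReal_le_ofReal_iff hH0).mp h1, h2⟩
  · rintro ⟨H, D, hbd⟩
    have htop : maximalTime K τ₀ = ∞ := by
      by_contra hfin
      refine not_eventually_bounded hK hdeg hτ₀ hτ hfin H D ?_
      filter_upwards [Ioo_mem_nhdsLT (ENNReal.toReal_pos hpos.ne' hfin)] with t ht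
      exact hbd t ht.1.le ((ENNReal.ofReal_lt_iff_lt_toReal ht.1.le hfin).mpr ht.2)
    exact ⟨htop, fun T _ => hτ T (htop ▸ ENNReal.ofReal_lt_top)⟩
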